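/- **Setting.** Fix numerical constants $0<c_{low}<c_{up}$. A *$(\varepsilon_0,\delta)$ clusterable dataset* ($\varepsilon_0,\delta>0$) consists of unit vectors $x_1,\dots,x_n\in\mathbb R^d$, unit vectors (cluster centers) $c_1,\dots,c_K\in\mathbb R^d$, class labels $\alpha_1,\dots,\alpha_{\bar K}\in[-1,1]$ with $\bar K\le K$ and $|\alpha_r-\alpha_s|\ge\delta$ for $r\ne s$, an assignment of every sample to a cluster such that $\|x_i-c_\ell\|_2\le\varepsilon_0$ whenever $x_i$ belongs to cluster $\ell$, with the number $n_\ell$ of samples in cluster $\ell$ obeying $c_{low}\,n/K\le n_\ell\le c_{up}\,n/K$, and an assignment of every cluster to a class such that $\|c_\ell-c_{\ell'}\|_2\ge 2\varepsilon_0$ if the clusters $\ell,\ell'$ belong to different classes. The ground truth label $\tilde y_i$ of $x_i$ is the label of the class of its cluster; the ground truth label $\tilde y(x)$ of a point $x$ is the label of the class of the center closest to $x$. In a *$(\rho,\varepsilon_0,\delta)$ corrupted dataset* $\{(x_i,y_i)\}_{i=1}^n$ the labels satisfy $y_i\in\{\alpha_1,\dots,\alpha_{\bar K}\}$ and, in every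 cluster $\ell$, at most $\rho n_\ell$ samples have $y_i\neq\tilde y_i$. Let $\phi:\mathbb R\to\mathbb R$ be twice differentiable with $|\phi(0)|,|\phi'|,|\phi''|\le\Gamma$ for some $\Gamma\ge1$. Let $f(W,x)=v^T\phi(Wx)$ with $W\in\mathbb R^{k\times d}$, where $\lfloor k/2\rfloor$ entries of $v\in\mathbb R^k$ equal $1/\sqrt k$, $\lfloor k/2\rfloor$ entries equal $-1/\sqrt k$, and the remaining entry is $0$ if $k$ is odd. Let $\mathcal L(W)=\frac12\sum_{i=1}^n(y_i-f(W,x_i))^2$ and $W_{t+1}=W_t-\eta\nabla\mathcal L(W_t)$, where $W_0$ has i.i.d. $\mathcal N(0,1)$ entries. Let $C\in\mathbb R^{K\times d}$ be the matrix with rows $c_\ell$, $\|C\|$ its spectral norm, and $\lambda=\lambda(C)$ the minimum eigenvalue of $\Sigma(C)=(CC^T)\odot\mathbb E_{g\sim\mathcal N(0,I_d)}[\phi'(Cg)\phi'(Cg)^T]$. Put $$L=\log\Big(\frac{\Gamma\sqrt{n\log K}}{\rho}\Big).$$ We say that the network with weights $W$ assigns $x$ to the label $\alpha_r$ if $\alpha_r$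 is the unique minimizer of $|f(W,x)-\alpha_s|$ over $1\le s\le\bar K$; let $\mathrm{err}(W)$ be the number of training inputs $x_i$ that are not assigned to $\tilde y_i$. **Theorem.** There is a constant $A_1>0$ such that for every $A_2\ge A_1$ there are constants $c,C_0>0$ for which the following holds; $A_1$ depends only on $c_{low},c_{up}$, and $c,C_0$ only on $c_{low},c_{up},A_2$. Let $n,K\ge1$ and $0<\rho\le1$, let a $(\rho,\varepsilon_0,\delta)$ corrupted dataset and a network be given as above with $\lambda>0$, and assume $$\varepsilon_0\le c\,\frac{\lambda}{\Gamma^2KL},\qquad k\ge C_0\,\Gamma^{10}\,\frac{K^2\|C\|^4}{\lambda^4}\,L^6,\qquad 0<\eta\le\frac{K}{2c_{up}\,n\,\Gamma^2\|C\|^2}.$$ Let the number of iterations $\tau$ be any integer with $$\Big\lceil A_1\frac{K}{\eta n\lambda}L\Big\rceil\le\tau\le\Big\lceil A_2\frac{K}{\eta n\lambda}L\Big\rceil .$$ Then, with probability at least $1-3/K^{100}-Ke^{-100d}$ over $W_0$, all of the following hold. 1. $\displaystyle \frac{1}{\sqrt n}\Big(\sum_{i=1}^n (f(W_\tau,x_i)-\tilde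 y_i)^2\Big)^{1/2}\le 4\rho+C_0\,\frac{\varepsilon_0\Gamma^3K\sqrt{\log K}}{\lambda}\,L.$ 2. If $\rho\le\delta/8$, then $\displaystyle \frac{\mathrm{err}(W_\tau)}{n}\le C_0\,\frac{\varepsilon_0K}{\delta}\,\frac{\Gamma^3\sqrt{\log K}}{\lambda}\,L.$ 3. If $\rho\le\delta/8$ and $\displaystyle \varepsilon_0\le c\,\delta\min\Big(\frac{\lambda^2}{\Gamma^5K^2L^3},\frac1{\Gamma\sqrt d}\Big)$, then for every center $c_\ell$ every $x\in\mathbb R^d$ with $\|x-c_\ell\|_2\le\varepsilon_0$ is assigned to the label of the class of $c_\ell$, which is its ground truth label $\tilde y(x)$; in particular every training input $x_i$ is assigned to $\tilde y_i$, so that all corrupted labels are corrected. 4. For all $0\le t\le\tau$, $\displaystyle \|W_t-W_0\|_F\le C_0\Big(\Gamma\sqrt{\frac{K\log K}{\lambda}}+t\,\eta\,\varepsilon_0\,\frac{\Gamma^4Kn}{\lambda}\,L^2\Big).$ With $\eta=\frac{K}{2c_{up}n\Gamma^2\|C\|^2}$ the number of iterations is of order $\frac{\|C\|^2}{\lambda}$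 and the second term in item 4 of order $\frac{K^2}{\lambda\|C\|^2}\,t\,\varepsilon_0$, up to logarithms and factors that depend on $\Gamma$ and $c_{up}$. -/

import Mathlib

open MeasureTheory ProbabilityTheory Matrix

noncomputable section

/-- An `(ε₀, δ)` clusterable dataset of `n` points in `ℝ^d` with `K` clusters and `Kbar` classes,
with balancedness constants `clow`, `cup`. The ground truth label of sample `i` is
`α (cls (cl i))`, the value of the class of its cluster. -/
structure ClusterableDataset (clow cup ε₀ δ : ℝ) (n K Kbar d : ℕ) where
  /-- the inputs `x_i` -/
  x : Fin n → EuclideanSpace ℝ (Fin d)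
  /-- the cluster centers `c_ℓ` -/
  c : Fin K → EuclideanSpace ℝ (Fin d)
  /-- the label values `α_r` of the classes -/
  α : Fin Kbar → ℝ
  /-- the cluster to which a sample belongs -/
  cl : Fin n → Fin K
  /-- the class to which a cluster belongs -/
  cls : Fin K → Fin Kbar
  classes_le : Kbar ≤ K
  noise_pos : 0 < ε₀
  separation_pos : 0 < δ
  norm_input : ∀ i, ‖x i‖ = 1
  norm_center : ∀ l, ‖c l‖ = 1
  balanced_low : ∀ l, clow * ((n : ℝ) / K) ≤ ((Finset.univ.filter fun i => cl i = l).card : ℝ)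
  balanced_up : ∀ l, ((Finset.univ.filter fun i => cl i = l).card : ℝ) ≤ cup * ((n : ℝ) / K)
  input_near : ∀ i, ‖x i - c (cl i)‖ ≤ ε₀
  label_mem : ∀ r, α r ∈ Set.Icc (-1 : ℝ) 1
  label_sep : ∀ r s, r ≠ s → δ ≤ |α r - α s|
  center_sep : ∀ l l', cls l ≠ cls l' → 2 * ε₀ ≤ ‖c l - c l'‖

namespace ClusterableDataset

variable {clow cup ε₀ δ : ℝ} {n K Kbar d : ℕ}

/-- The ground truth label of the `i`-th training sample. -/
def trueLabel (D : ClusterableDataset clow cup ε₀ δ n K Kbar d) (i : Fin n) : ℝ :=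
  D.α (D.cls (D.cl i))

/-- The matrix `C` whose rows are the cluster centers. -/
def centerMatrix (D : ClusterableDataset clow cup ε₀ δ n K Kbar d) : Matrix (Fin K) (Fin d) ℝ :=
  Matrix.of fun l j => D.c l j

/-- `r` is the class given to `z` by the ground truth label function: the class of a cluster
center closest to `z`. -/
def IsTrueClass (D : ClusterableDataset clow cup ε₀ δ n K Kbar d)
    (z : EuclideanSpace ℝ (Fin d)) (r : Fin Kbar) : Prop :=
  ∃ l, (∀ l', ‖z - D.c l‖ ≤ ‖z - D.c l'‖) ∧ D.cls l = r

end ClusterableDataset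

/-- A `(ρ, ε₀, δ)` corrupted dataset: in each cluster, at most a fraction `ρ` of the
labels is replaced by other class labels. -/
structure CorruptedDataset (clow cup ρ ε₀ δ : ℝ) (n K Kbar d : ℕ) extends
    ClusterableDataset clow cup ε₀ δ n K Kbar d where
  /-- the (possibly corrupted) training labels -/
  y : Fin n → ℝ
  y_mem : ∀ i, y i ∈ Set.range α
  corruption : ∀ l,
    ((Finset.univ.filter fun i => cl i = l ∧ y i ≠ α (cls (cl i))).card : ℝ)
      ≤ ρ * ((Finset.univ.filter fun i => cl i = l).card : ℝ)

/-- Half of the entries of `v` are `1/√k` and half are `-1/√k`; if `k` is odd, the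
remaining entry is zero. -/
structure IsOutputWeight {k : ℕ} (v : Fin k → ℝ) : Prop where
  pos : (Finset.univ.filter fun r => v r = 1 / √(k : ℝ)).card = k / 2
  neg : (Finset.univ.filter fun r => v r = -(1 / √(k : ℝ))).card = k / 2
  zero : (Finset.univ.filter fun r => v r = 0).card = k % 2

/-- The one-hidden-layer network `f(W, z) = vᵀ φ(W z)`. -/
def network {k d : ℕ} (φ : ℝ → ℝ) (v : Fin k → ℝ) (W : Matrix (Fin k) (Fin d) ℝ)
    (z : EuclideanSpace ℝ (Fin d)) : ℝ :=
  v ⬝ᵥ fun r => φ ((W *ᵥ z.ofLp) r)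

/-- The quadratic loss `L(W) = 1/2 ∑ᵢ (yᵢ - f(W, xᵢ))²`. -/
def trainLoss {n k d : ℕ} (φ : ℝ → ℝ) (v : Fin k → ℝ) (x : Fin n → EuclideanSpace ℝ (Fin d))
    (y : Fin n → ℝ) (W : Matrix (Fin k) (Fin d) ℝ) : ℝ :=
  1 / 2 * ∑ i, (y i - network φ v W (x i)) ^ 2

/-- The gradient of a function of a matrix: the matrix of its partial derivatives. -/
def matrixGradient {k d : ℕ} (F : Matrix (Fin k) (Fin d) ℝ → ℝ) (W : Matrix (Fin k) (Fin d) ℝ) :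
    Matrix (Fin k) (Fin d) ℝ :=
  Matrix.of fun a b => deriv (fun t : ℝ => F (W + t • Matrix.single a b (1 : ℝ))) 0

/-- The iterates `W_{τ+1} = W_τ - η ∇L(W_τ)` of gradient descent started at `W₀`. -/
def gradientDescent {k d : ℕ} (F : Matrix (Fin k) (Fin d) ℝ → ℝ) (η : ℝ)
    (W₀ : Matrix (Fin k) (Fin d) ℝ) : ℕ → Matrix (Fin k) (Fin d) ℝ
  | 0 => W₀
  | t + 1 => gradientDescent F η W₀ t - η • matrixGradient F (gradientDescent F η W₀ t)

/-- The law of a `k × d` array of i.i.d. standard normal entries. -/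
def gaussianArray (k d : ℕ) : Measure (Fin k → Fin d → ℝ) :=
  Measure.pi fun _ : Fin k => Measure.pi fun _ : Fin d => gaussianReal 0 1

/-- The Frobenius norm. -/
def frobNorm {k d : ℕ} (W : Matrix (Fin k) (Fin d) ℝ) : ℝ :=
  √(∑ a, ∑ b, W a b ^ 2)

/-- The spectral norm (largest singular value): the operator norm between Euclidean spaces. -/
def specNorm {K d : ℕ} (C : Matrix (Fin K) (Fin d) ℝ) : ℝ :=
  ‖(Matrix.toEuclideanLin C).toContinuousLinearMap‖

/-- The neural net cluster covariance `Σ(C) = (C Cᵀ) ⊙ E[φ'(C g) φ'(C g)ᵀ]`, `g ∼ N(0, I_d)`. -/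
def clusterCovariance {K d : ℕ} (φ : ℝ → ℝ) (C : Matrix (Fin K) (Fin d) ℝ) :
    Matrix (Fin K) (Fin K) ℝ :=
  (C * Cᵀ) ⊙ Matrix.of fun l l' =>
    ∫ g : Fin d → ℝ, deriv φ ((C *ᵥ g) l) * deriv φ ((C *ᵥ g) l')
      ∂(Measure.pi fun _ : Fin d => gaussianReal 0 1)

theorem clusterCovariance_isHermitian {K d : ℕ} (φ : ℝ → ℝ) (C : Matrix (Fin K) (Fin d) ℝ) :
    (clusterCovariance φ C).IsHermitian := by
  ext l l'
  simp only [clusterCovariance, Matrix.conjTranspose_apply, Matrix.hadamard_apply,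
    Matrix.of_apply, star_trivial, Matrix.mul_apply, Matrix.transpose_apply]
  simp only [mul_comm]

/-- `λ(C)`, the minimum eigenvalue of `Σ(C)`. -/
def minClusterEigenvalue {K d : ℕ} (φ : ℝ → ℝ) (C : Matrix (Fin K) (Fin d) ℝ) : ℝ :=
  ⨅ l, (clusterCovariance_isHermitian φ C).eigenvalues l

/-- The output value `u` is assigned to class `r`: the label `α r` is the unique closest one
to `u` among all class labels. -/
def AssignedTo {Kbar : ℕ} (α : Fin Kbar → ℝ) (u : ℝ) (r : Fin Kbar) : Prop :=
  ∀ s, s ≠ r → |u - α r| < |u - α s|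

/-- The logarithmic factor `log (Γ √(n log K) / ρ)`. -/
def logFactor (Γ : ℝ) (n K : ℕ) (ρ : ℝ) : ℝ :=
  Real.log (Γ * √((n : ℝ) * Real.log K) / ρ)

open scoped Classical in
/-- The number of training samples that the network with weights `W` does not assign to their
ground truth class. -/
def numErrors {clow cup ε₀ δ : ℝ} {n K Kbar d k : ℕ}
    (D : ClusterableDataset clow cup ε₀ δ n K Kbar d) (φ : ℝ → ℝ) (v : Fin k → ℝ)
    (W : Matrix (Fin k) (Fin d) ℝ) : ℕ :=
  (Finset.univ.filter fun i =>
    ¬ AssignedTo D.α (network φ v W (D.x i)) (D.cls (D.cl i))).card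

/-- The four conclusions about a gradient descent trajectory `W` at time `τ`, with `lam = λ(C)`,
`L` the logarithmic factor, `cs` a small and `cb` a big constant. -/
structure RobustAt {clow cup ρ ε₀ δ : ℝ} {n K Kbar d k : ℕ}
    (D : CorruptedDataset clow cup ρ ε₀ δ n K Kbar d) (φ : ℝ → ℝ) (v : Fin k → ℝ)
    (Γ η lam L cs cb : ℝ) (W : ℕ → Matrix (Fin k) (Fin d) ℝ) (τ : ℕ) : Prop where
  /-- normalized `ℓ₂` error with respect to the ground truth labels -/
  l2_error :
    √(∑ i, (network φ v (W τ) (D.x i) - D.trueLabel i) ^ 2) / √(n : ℝ)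
      ≤ 4 * ρ + cb * (ε₀ * Γ ^ 3 * K * √(Real.log K) / lam) * L
  /-- fraction of prediction errors with respect to the ground truth labels -/
  error_fraction : ρ ≤ δ / 8 →
    (numErrors D.toClusterableDataset φ v (W τ) : ℝ) / n
      ≤ cb * (ε₀ * K / δ) * (Γ ^ 3 * √(Real.log K) / lam) * L
  /-- every input within `ε₀` of a center gets the label of that center, which is its ground
  truth label; in particular all training inputs get their ground truth labels -/
  correct : ρ ≤ δ / 8 →
    ε₀ ≤ cs * δ * min (lam ^ 2 / (Γ ^ 5 * K ^ 2 * L ^ 3)) (1 / (Γ * √(d : ℝ))) →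
      (∀ l z, ‖z - D.c l‖ ≤ ε₀ →
        AssignedTo D.α (network φ v (W τ) z) (D.cls l) ∧
        ∀ r, D.IsTrueClass z r → AssignedTo D.α (network φ v (W τ) z) r) ∧
      (∀ i, AssignedTo D.α (network φ v (W τ) (D.x i)) (D.cls (D.cl i)))
  /-- distance to initialization -/
  distance : ∀ t ≤ τ,
    frobNorm (W t - W 0)
      ≤ cb * (Γ * √(K * Real.log K / lam) + t * η * ε₀ * (Γ ^ 4 * K * n / lam) * L ^ 2)

end

/-!
Why the theorem is true.

Write `f(W, z)` for the network, `Q(W) = ∑ l, n_l (f(W, c_l) - ȳ_l)²` for the loss in which every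
input is replaced by the center of its cluster, with `ȳ_l` the mean label of the cluster `l`, and
`p` for half the gradient of `Q`. The gradient of the training loss differs from `p` only through
the distance of the inputs to their centers, so gradient descent on the training loss is gradient
descent on `Q / 2` with a gradient error of norm at most `X`, proportional to `ε₀`
(`GoodStart.norm_grad_error_le`).

At the random initial weights the Gram matrix of the gradients at the centers is at least `λ(C) / 4`
(`measure_init_cond`), and this persists in a ball whose radius is small compared to `√k`. Hence
`a Q ≤ ‖p‖²` in the ball, with `a` of order `λ n / K` (`centerLoss_le_norm_centerGrad_sq`), and one
step of inexact descent gives `Q(W_{t+1}) ≤ Q(W_t) - η ‖p‖² + η X²` (`centerLoss_step_le`). The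
potential `√(Q + X² / a)` pays for the length of the path: up to `η √a X`, it decreases by at least
`√a / 4` times the length `η ‖p‖` of the step (`sqrt_potential_step`). So the path stays within a
ball of radius of order `Γ √(K log K / λ)`, up to the accumulated noise, and `Q` decreases
geometrically to its noise level `X² / a` (`inexact_gradient_descent`, `GoodStart.trajectory`).

After the prescribed number of iterations the outputs at the centers are thus close to `ȳ_l`, and
`ȳ_l` is within `2 ρ` of the ground truth label since at most a fraction `ρ` of the labels is
corrupted (`abs_clusterMean_sub_label_le`). The outputs at other inputs are compared with those at
the centers: in quadratic mean over the training inputs by `GoodStart.sqrt_sum_net_sub_sq_le`, and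
uniformly over the balls around the centers by `abs_net_sub_center_le`.

The probabilistic input consists of sub-Gaussian bounds at the initial weights. The outputs of the
network at one point, and their increments between two points, are sub-Gaussian because the output
weights sum to zero, which turns the nonlinear network into a centered sum of independent Lipschitz
functions of Gaussian vectors (`hasSubgaussianMGF_net`, `hasSubgaussianMGF_net_sub`); a chaining
argument gives the supremum over a ball (`measure_init_ball`).
-/

/-! ### Inexact gradient descent under a Polyak–Łojasiewicz inequality -/

/-- One step of the potential argument: with `Ψ² = Q + X²/a`, an inexact gradient step of size `z`
decreases `Ψ` by a multiple of `z`, up to the gradient error `X`. -/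
lemma sqrt_potential_step {Q Q' z X a η : ℝ} (hQ : 0 ≤ Q) (hQ' : 0 ≤ Q') (hz : 0 ≤ z) (hX : 0 < X)
    (ha : 0 < a) (hη : 0 < η) (hdesc : Q' ≤ Q - η * z ^ 2 + η * X ^ 2) (hpl : a * Q ≤ z ^ 2) :
    √(Q' + X ^ 2 / a) + η * √a * z / 4 ≤ √(Q + X ^ 2 / a) + η * √a * X := by
  set s := √a with hs
  have hsa : s ^ 2 = a := Real.sq_sqrt ha.le
  set P := √(Q + X ^ 2 / a) with hP
  set P' := √(Q' + X ^ 2 / a) with hP'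
  have hpos : 0 < X ^ 2 / a := by positivity
  have hP2 : P ^ 2 = Q + X ^ 2 / a := Real.sq_sqrt (by linarith)
  have hP'2 : P' ^ 2 = Q' + X ^ 2 / a := Real.sq_sqrt (by linarith)
  have h1 : s ^ 2 * P ^ 2 ≤ z ^ 2 + X ^ 2 := by
    rw [hP2, hsa, mul_add, mul_div_cancel₀ _ ha.ne']; linarith
  have h2 : X ^ 2 ≤ s ^ 2 * P ^ 2 := by
    rw [hP2, hsa, mul_add, mul_div_cancel₀ _ ha.ne']; nlinarith
  have h3 : s * P ≤ z + X := by
    apply le_of_sq_le_sq _ (by positivity)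
    nlinarith
  have h4 : X ≤ s * P := by
    apply le_of_sq_le_sq _ (by positivity)
    nlinarith
  have h5 : 2 * P * P' ≤ P ^ 2 + P' ^ 2 := by nlinarith [sq_nonneg (P - P')]
  have h7 : 2 * (s * P) * (z / 4) - 2 * (s * P) * X ≤ z ^ 2 - X ^ 2 := by
    nlinarith [mul_nonneg hz (sub_nonneg.2 h3), mul_nonneg hX.le (sub_nonneg.2 h4),
      sq_nonneg (z - X)]
  have h8 : 2 * P * (P' + η * s * z / 4) ≤ 2 * P * (P + η * s * X) := by
    nlinarith [mul_le_mul_of_nonneg_left h7 hη.le]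
  exact le_of_mul_le_mul_left h8 (by positivity)

/-- Inexact gradient descent under a Polyak–Łojasiewicz inequality which holds only in a ball of
radius `R` and below the level `Qmax`. Here `Q t` is twice the loss, `z t` the norm of its
gradient, `X` the size of the gradient error, and `D t` the distance to the starting point. The
iterates stay in the ball, and the loss converges linearly to the level `X² / a`. -/
theorem inexact_gradient_descent {Q z D : ℕ → ℝ} {X a η R Qmax : ℝ} {τ : ℕ}
    (hQ : ∀ t, 0 ≤ Q t) (hz : ∀ t, 0 ≤ z t) (hX : 0 < X) (ha : 0 < a) (hη : 0 < η)
    (hηa : η * a ≤ 1) (hD0 : D 0 = 0)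
    (hstep : ∀ t < τ, D t ≤ R → Q t ≤ Qmax →
      Q (t + 1) ≤ Q t - η * z t ^ 2 + η * X ^ 2 ∧ a * Q t ≤ z t ^ 2 ∧
        D (t + 1) ≤ D t + η * z t + η * X)
    (hQmax : Q 0 + X ^ 2 / a ≤ Qmax)
    (hR : 4 * (√(Q 0) + X / √a) / √a + 5 * (η * τ) * X ≤ R) :
    ∀ t ≤ τ, D t ≤ 4 * (√(Q 0) + X / √a) / √a + 5 * (η * t) * X ∧
      Q t ≤ (1 - η * a) ^ t * Q 0 + X ^ 2 / a := by
  set s := √a with hs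
  have hs0 : 0 < s := Real.sqrt_pos.2 ha
  have hPsi0 : √(Q 0 + X ^ 2 / a) ≤ √(Q 0) + X / s := by
    have h1 : X ^ 2 / a = (X / s) ^ 2 := by rw [div_pow, hs, Real.sq_sqrt ha.le]
    rw [h1]
    refine (Real.sqrt_le_left (by positivity)).2 ?_
    have := Real.sq_sqrt (hQ 0)
    have : 0 ≤ √(Q 0) * (X / s) := by positivity
    nlinarith
  have key : ∀ t ≤ τ, D t ≤ 4 / s * (√(Q 0 + X ^ 2 / a) - √(Q t + X ^ 2 / a))
      + 5 * (η * t) * X ∧ Q t ≤ (1 - η * a) ^ t * Q 0 + X ^ 2 / a := by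
    intro t
    induction t with
    | zero => intro _; simp [hD0]; positivity
    | succ t ih =>
      intro ht
      obtain ⟨ihD, ihQ⟩ := ih (by omega)
      have htR : D t ≤ R := by
        refine ihD.trans (le_trans ?_ hR)
        have h1 : 4 / s * (√(Q 0 + X ^ 2 / a) - √(Q t + X ^ 2 / a))
            ≤ 4 / s * (√(Q 0) + X / s) := by
          gcongr
          linarith [Real.sqrt_nonneg (Q t + X ^ 2 / a)]
        have h2 : (t : ℝ) ≤ τ := by exact_mod_cast (by omega : t ≤ τ)
        have h3 : 5 * (η * t) * X ≤ 5 * (η * τ) * X := by gcongr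
        calc _ ≤ 4 / s * (√(Q 0) + X / s) + 5 * (η * τ) * X := add_le_add h1 h3
          _ = _ := by ring
      have htQ : Q t ≤ Qmax := by
        refine ihQ.trans (le_trans ?_ hQmax)
        gcongr
        exact mul_le_of_le_one_left (hQ 0)
          (pow_le_one₀ (by linarith) (by nlinarith [mul_pos hη ha]))
      obtain ⟨h1, h2, h3⟩ := hstep t (by omega) htR htQ
      constructor
      · have h4 := sqrt_potential_step (hQ t) (hQ (t + 1)) (hz t) hX ha hη h1 h2
        have h5 : η * z t + η * X ≤ 4 / s * (√(Q t + X ^ 2 / a) - √(Q (t + 1) + X ^ 2 / a))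
            + 5 * η * X := by
          have h6 : 4 / s * (η * s * z t / 4 - η * s * X)
              ≤ 4 / s * (√(Q t + X ^ 2 / a) - √(Q (t + 1) + X ^ 2 / a)) := by
            rw [← hs] at h4
            exact mul_le_mul_of_nonneg_left (by linarith) (by positivity)
          have h7 : 4 / s * (η * s * z t / 4 - η * s * X) = η * z t - 4 * η * X := by
            field_simp
          linarith
        push_cast
        calc _ ≤ D t + (η * z t + η * X) := by linarith
          _ ≤ _ := add_le_add ihD h5
          _ = _ := by ring
      · have h4 : Q (t + 1) ≤ (1 - η * a) * Q t + η * X ^ 2 := by nlinarith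
        calc _ ≤ (1 - η * a) * ((1 - η * a) ^ t * Q 0 + X ^ 2 / a) + η * X ^ 2 := by
              have := mul_le_mul_of_nonneg_left ihQ (sub_nonneg.2 hηa)
              linarith
          _ = _ := by field_simp; ring
  intro t ht
  obtain ⟨h1, h2⟩ := key t ht
  refine ⟨h1.trans ?_, h2⟩
  have h3 : 4 / s * (√(Q 0 + X ^ 2 / a) - √(Q t + X ^ 2 / a)) ≤ 4 / s * (√(Q 0) + X / s) := by
    gcongr
    linarith [Real.sqrt_nonneg (Q t + X ^ 2 / a)]
  calc _ ≤ 4 / s * (√(Q 0) + X / s) + 5 * (η * t) * X := by linarith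
    _ = _ := by ring

/-! ### Scalar estimates for a smooth activation -/

/-- `φ` is differentiable, and `φ'` is bounded by `Γ` and `Γ`-Lipschitz. -/
structure SmoothActivation (φ : ℝ → ℝ) (Γ : ℝ) : Prop where
  diff : Differentiable ℝ φ
  deriv_le : ∀ z, |deriv φ z| ≤ Γ
  deriv_lip : ∀ a b, |deriv φ a - deriv φ b| ≤ Γ * |a - b|

namespace SmoothActivation

variable {φ : ℝ → ℝ} {Γ : ℝ}

lemma of_second_deriv (h : Differentiable ℝ φ) (h' : Differentiable ℝ (deriv φ))
    (h1 : ∀ z, |deriv φ z| ≤ Γ) (h2 : ∀ z, |deriv (deriv φ) z| ≤ Γ) : SmoothActivation φ Γ where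
  diff := h
  deriv_le := h1
  deriv_lip a b := by
    have := convex_univ.norm_image_sub_le_of_norm_deriv_le (f := deriv φ) (C := Γ)
      (fun x _ => h' x) (fun x _ => h2 x) (Set.mem_univ b) (Set.mem_univ a)
    simpa using this

lemma nonneg (h : SmoothActivation φ Γ) : 0 ≤ Γ := (abs_nonneg _).trans (h.deriv_le 0)

lemma abs_sub_le (h : SmoothActivation φ Γ) (a b : ℝ) : |φ a - φ b| ≤ Γ * |a - b| := by
  have := convex_univ.norm_image_sub_le_of_norm_deriv_le (f := φ) (C := Γ)
    (fun x _ => h.diff x) (fun x _ => h.deriv_le x) (Set.mem_univ b) (Set.mem_univ a)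
  simpa using this

/-- A difference of two increments of `φ` is a difference of two linear terms with slopes taken at
corresponding points of the two segments. -/
lemma exists_sub_sub_eq (h : SmoothActivation φ Γ) (a a' b b' : ℝ) :
    ∃ s ∈ Set.Ioo (0 : ℝ) 1, (φ a' - φ a) - (φ b' - φ b)
      = deriv φ (a + s * (a' - a)) * (a' - a) - deriv φ (b + s * (b' - b)) * (b' - b) := by
  have hd : ∀ (p q : ℝ) (s : ℝ), HasDerivAt (fun s => φ (p + s * (q - p)))
      (deriv φ (p + s * (q - p)) * (q - p)) s := by
    intro p q s
    have h1 : HasDerivAt (fun s : ℝ => p + s * (q - p)) (q - p) s := by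
      simpa using ((hasDerivAt_id s).mul_const (q - p)).const_add p
    exact (h.diff _).hasDerivAt.comp s h1
  obtain ⟨s, hs, hs'⟩ := exists_hasDerivAt_eq_slope
    (fun s => φ (a + s * (a' - a)) - φ (b + s * (b' - b))) _ (zero_lt_one)
    (fun s _ => ((hd a a' s).sub (hd b b' s)).continuousAt.continuousWithinAt)
    (fun s _ => (hd a a' s).sub (hd b b' s))
  refine ⟨s, hs, ?_⟩
  rw [hs']
  simp
  ring

lemma abs_sub_sub_le (h : SmoothActivation φ Γ) (a a' b b' : ℝ) :
    |(φ a' - φ a) - (φ b' - φ b)|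
      ≤ Γ * |(a' - a) - (b' - b)| + Γ * |b' - b| * (|a - b| + |(a' - a) - (b' - b)|) := by
  obtain ⟨s, ⟨hs0, hs1⟩, hs⟩ := h.exists_sub_sub_eq a a' b b'
  rw [hs]
  have e : deriv φ (a + s * (a' - a)) * (a' - a) - deriv φ (b + s * (b' - b)) * (b' - b)
      = deriv φ (a + s * (a' - a)) * ((a' - a) - (b' - b))
        + (deriv φ (a + s * (a' - a)) - deriv φ (b + s * (b' - b))) * (b' - b) := by ring
  rw [e]
  refine (abs_add_le _ _).trans (add_le_add ?_ ?_)
  · rw [abs_mul]; gcongr; exact h.deriv_le _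
  · rw [abs_mul, mul_right_comm]
    gcongr
    refine (h.deriv_lip _ _).trans ?_
    have := h.nonneg
    gcongr
    have e2 : a + s * (a' - a) - (b + s * (b' - b)) = (a - b) + s * ((a' - a) - (b' - b)) := by ring
    rw [e2]
    refine (abs_add_le _ _).trans (add_le_add le_rfl ?_)
    rw [abs_mul, abs_of_pos hs0]
    exact mul_le_of_le_one_left (abs_nonneg _) hs1.le

lemma abs_taylor_le (h : SmoothActivation φ Γ) (a t : ℝ) :
    |φ (a + t) - φ a - deriv φ a * t| ≤ Γ * t ^ 2 := by
  obtain ⟨s, ⟨hs0, hs1⟩, hs⟩ := h.exists_sub_sub_eq a (a + t) 0 0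
  have e : φ (a + t) - φ a - deriv φ a * t = (deriv φ (a + s * t) - deriv φ a) * t := by
    simp only [sub_self, mul_zero, sub_zero, add_sub_cancel_left] at hs
    rw [hs]; ring
  rw [e, abs_mul]
  calc _ ≤ Γ * |a + s * t - a| * |t| := by gcongr; exact h.deriv_lip _ _
    _ = Γ * s * t ^ 2 := by
      rw [add_sub_cancel_left, abs_mul, abs_of_pos hs0, ← sq_abs t]; ring
    _ ≤ Γ * 1 * t ^ 2 := by
      have := h.nonneg
      gcongr
    _ = _ := by ring

end SmoothActivation

/-! ### One-hidden-layer networks with weights in a Hilbert space -/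

section Network

variable {k : ℕ} {E : Type*} [NormedAddCommGroup E] [InnerProductSpace ℝ E]

/-- The network `∑ᵣ vᵣ φ(⟪Wᵣ, z⟫)`. The rows of the weight matrix are gathered in an `ℓ²` product,
whose norm is the Frobenius norm. -/
noncomputable def net (φ : ℝ → ℝ) (v : Fin k → ℝ) (W : PiLp 2 fun _ : Fin k => E) (z : E) : ℝ :=
  ∑ r, v r * φ (inner ℝ (W r) z)

/-- The gradient of `net φ v W z` with respect to `W`. -/
noncomputable def netGrad (φ : ℝ → ℝ) (v : Fin k → ℝ) (W : PiLp 2 fun _ : Fin k => E) (z : E) :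
    PiLp 2 fun _ : Fin k => E :=
  WithLp.toLp 2 fun r => (v r * deriv φ (inner ℝ (W r) z)) • z

/-- The vector `W u` of pre-activations. -/
noncomputable def preact (W : PiLp 2 fun _ : Fin k => E) (u : E) : EuclideanSpace ℝ (Fin k) :=
  WithLp.toLp 2 fun r => inner ℝ (W r) u

/-- The output weights are at most `κ`, and form a vector of norm at most one. -/
structure OutputBound (v : Fin k → ℝ) (κ : ℝ) : Prop where
  nonneg : 0 ≤ κ
  abs_le : ∀ r, |v r| ≤ κ
  sum_sq_le : ∑ r, v r ^ 2 ≤ 1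

variable {φ : ℝ → ℝ} {Γ κ : ℝ} {v : Fin k → ℝ} (W W' h : PiLp 2 fun _ : Fin k => E)

lemma preact_add_left (u : E) : preact (W + h) u = preact W u + preact h u := by
  ext r; simp [preact, inner_add_left]

lemma preact_add_right (u u' : E) : preact W (u + u') = preact W u + preact W u' := by
  ext r; simp [preact, inner_add_right]

lemma preact_smul_right (t : ℝ) (u : E) : preact W (t • u) = t • preact W u := by
  ext r; simp [preact, inner_smul_right]

lemma norm_preact_sq (u : E) : ‖preact W u‖ ^ 2 = ∑ r, inner ℝ (W r) u ^ 2 := by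
  simp [preact, EuclideanSpace.norm_sq_eq]

lemma norm_preact_le (u : E) : ‖preact W u‖ ≤ ‖W‖ * ‖u‖ := by
  apply le_of_sq_le_sq _ (by positivity)
  rw [norm_preact_sq, mul_pow, PiLp.norm_sq_eq_of_L2, Finset.sum_mul]
  refine Finset.sum_le_sum fun r _ => ?_
  rw [← mul_pow, ← sq_abs]
  gcongr
  exact abs_real_inner_le_norm _ _

lemma sum_norm_mul_abs_inner_le (u : E) : ∑ r, ‖h r‖ * |inner ℝ (W r) u| ≤ ‖h‖ * ‖preact W u‖ := by
  refine (Real.sum_mul_le_sqrt_mul_sqrt _ _ _).trans (le_of_eq ?_)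
  rw [← PiLp.norm_sq_eq_of_L2, Real.sqrt_sq (norm_nonneg _)]
  simp only [sq_abs]
  rw [← norm_preact_sq, Real.sqrt_sq (norm_nonneg _)]

lemma OutputBound.sum_abs_mul_le (hv : OutputBound v κ) (x : Fin k → ℝ) :
    ∑ r, |v r| * x r ≤ √(∑ r, x r ^ 2) := by
  refine (Real.sum_mul_le_sqrt_mul_sqrt _ _ _).trans ?_
  simp only [sq_abs]
  exact mul_le_of_le_one_left (Real.sqrt_nonneg _) (Real.sqrt_le_one.2 hv.sum_sq_le)

/-- Second order Taylor estimate: the curvature of the network is of order `κ`. -/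
lemma abs_net_taylor_le (hφ : SmoothActivation φ Γ) (hv : OutputBound v κ) {z : E}
    (hz : ‖z‖ ≤ 1) :
    |net φ v (W + h) z - net φ v W z - inner ℝ (netGrad φ v W z) h| ≤ Γ * κ * ‖h‖ ^ 2 := by
  have e : net φ v (W + h) z - net φ v W z - inner ℝ (netGrad φ v W z) h
      = ∑ r, v r * (φ (inner ℝ (W r) z + inner ℝ (h r) z) - φ (inner ℝ (W r) z)
          - deriv φ (inner ℝ (W r) z) * inner ℝ (h r) z) := by
    simp only [net, netGrad, PiLp.inner_apply, PiLp.add_apply, inner_add_left, inner_smul_left,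
      ← Finset.sum_sub_distrib]
    refine Finset.sum_congr rfl fun r _ => ?_
    rw [real_inner_comm z (h r)]
    simp
    ring
  rw [e, PiLp.norm_sq_eq_of_L2, Finset.mul_sum]
  refine (Finset.abs_sum_le_sum_abs _ _).trans (Finset.sum_le_sum fun r _ => ?_)
  rw [abs_mul]
  have h1 : inner ℝ (h r) z ^ 2 ≤ ‖h r‖ ^ 2 := by
    rw [← sq_abs]
    gcongr
    exact (abs_real_inner_le_norm _ _).trans (mul_le_of_le_one_right (norm_nonneg _) hz)
  calc _ ≤ κ * (Γ * inner ℝ (h r) z ^ 2) := by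
        gcongr
        · exact hv.nonneg
        · exact hv.abs_le r
        · exact hφ.abs_taylor_le _ _
    _ ≤ κ * (Γ * ‖h r‖ ^ 2) := by
        have := hv.nonneg
        have := hφ.nonneg
        gcongr
    _ = _ := by ring

lemma norm_netGrad_le (hφ : SmoothActivation φ Γ) (hv : OutputBound v κ) {z : E}
    (hz : ‖z‖ ≤ 1) : ‖netGrad φ v W z‖ ≤ Γ := by
  apply le_of_sq_le_sq _ hφ.nonneg
  rw [PiLp.norm_sq_eq_of_L2]
  calc _ ≤ ∑ r, v r ^ 2 * Γ ^ 2 := by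
        refine Finset.sum_le_sum fun r _ => ?_
        rw [← mul_pow, ← sq_abs (v r * Γ)]
        gcongr
        simp only [netGrad, norm_smul, Real.norm_eq_abs, abs_mul, abs_of_nonneg hφ.nonneg]
        calc _ ≤ |v r| * Γ * 1 := by
              have := hφ.nonneg
              gcongr
              exact hφ.deriv_le _
          _ = _ := mul_one _
    _ ≤ 1 * Γ ^ 2 := by
        rw [← Finset.sum_mul]
        gcongr
        exact hv.sum_sq_le
    _ = _ := one_mul _

/-- Gradients at nearby inputs are close. -/
lemma norm_netGrad_sub_le (hφ : SmoothActivation φ Γ) (hv : OutputBound v κ) (x : E) {c : E}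
    (hc : ‖c‖ ≤ 1) :
    ‖netGrad φ v W x - netGrad φ v W c‖ ≤ Γ * ‖x - c‖ + Γ * κ * ‖preact W (x - c)‖ := by
  have hΓ := hφ.nonneg
  have e : netGrad φ v W x - netGrad φ v W c
      = WithLp.toLp 2 (fun r => (v r * deriv φ (inner ℝ (W r) x)) • (x - c))
        + WithLp.toLp 2
          (fun r => (v r * (deriv φ (inner ℝ (W r) x) - deriv φ (inner ℝ (W r) c))) • c) := by
    ext r
    simp only [netGrad, PiLp.sub_apply, PiLp.add_apply]
    module
  rw [e]
  refine (norm_add_le _ _).trans (add_le_add ?_ ?_)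
  · apply le_of_sq_le_sq _ (by positivity)
    rw [PiLp.norm_sq_eq_of_L2]
    calc _ ≤ ∑ r, v r ^ 2 * (Γ * ‖x - c‖) ^ 2 := by
          refine Finset.sum_le_sum fun r _ => ?_
          simp only [norm_smul, Real.norm_eq_abs, abs_mul, mul_pow, sq_abs]
          rw [mul_assoc, ← sq_abs (deriv φ _)]
          gcongr
          exact hφ.deriv_le _
      _ ≤ 1 * (Γ * ‖x - c‖) ^ 2 := by
          rw [← Finset.sum_mul]
          gcongr
          exact hv.sum_sq_le
      _ = _ := one_mul _
  · have := hv.nonneg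
    apply le_of_sq_le_sq _ (by positivity)
    rw [PiLp.norm_sq_eq_of_L2, mul_pow, norm_preact_sq, Finset.mul_sum]
    refine Finset.sum_le_sum fun r _ => ?_
    rw [← sq_abs (inner ℝ (W r) (x - c)), ← mul_pow]
    gcongr
    simp only [norm_smul, Real.norm_eq_abs, abs_mul, inner_sub_right]
    calc _ ≤ κ * (Γ * |inner ℝ (W r) x - inner ℝ (W r) c|) * 1 := by
          gcongr
          · exact hv.abs_le r
          · exact hφ.deriv_lip _ _
      _ = _ := by ring

/-- How much the difference of the outputs at two nearby inputs changes with the weights. -/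
lemma abs_net_sub_sub_le (hφ : SmoothActivation φ Γ) (hv : OutputBound v κ) (x : E) {c : E}
    (hc : ‖c‖ ≤ 1) :
    |(net φ v (W + h) x - net φ v (W + h) c) - (net φ v W x - net φ v W c)|
      ≤ Γ * ‖h‖ * (‖x - c‖ + κ * ‖preact W (x - c)‖ + κ * ‖h‖ * ‖x - c‖) := by
  have hΓ := hφ.nonneg
  have hκ := hv.nonneg
  set u := x - c with hu
  have e : (net φ v (W + h) x - net φ v (W + h) c) - (net φ v W x - net φ v W c)
      = ∑ r, v r * ((φ (inner ℝ (W r) x + inner ℝ (h r) x) - φ (inner ℝ (W r) x))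
          - (φ (inner ℝ (W r) c + inner ℝ (h r) c) - φ (inner ℝ (W r) c))) := by
    simp only [net, PiLp.add_apply, inner_add_left, ← Finset.sum_sub_distrib]
    refine Finset.sum_congr rfl fun r _ => ?_
    ring
  have hterm : ∀ r, |v r * ((φ (inner ℝ (W r) x + inner ℝ (h r) x) - φ (inner ℝ (W r) x))
          - (φ (inner ℝ (W r) c + inner ℝ (h r) c) - φ (inner ℝ (W r) c)))|
      ≤ Γ * ‖u‖ * (|v r| * ‖h r‖) + Γ * κ * (‖h r‖ * |inner ℝ (W r) u|)
        + Γ * κ * ‖u‖ * ‖h r‖ ^ 2 := by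
    intro r
    rw [abs_mul]
    have h0 := hφ.abs_sub_sub_le (inner ℝ (W r) x) (inner ℝ (W r) x + inner ℝ (h r) x)
      (inner ℝ (W r) c) (inner ℝ (W r) c + inner ℝ (h r) c)
    simp only [add_sub_cancel_left, ← inner_sub_right, ← hu] at h0
    have h1 : |inner ℝ (h r) u| ≤ ‖h r‖ * ‖u‖ := abs_real_inner_le_norm _ _
    have h2 : |inner ℝ (h r) c| ≤ ‖h r‖ :=
      (abs_real_inner_le_norm _ _).trans (mul_le_of_le_one_right (norm_nonneg _) hc)
    have h3 : Γ * |inner ℝ (h r) u| + Γ * |inner ℝ (h r) c| *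
        (|inner ℝ (W r) u| + |inner ℝ (h r) u|)
        ≤ Γ * (‖h r‖ * ‖u‖) + Γ * ‖h r‖ * (|inner ℝ (W r) u| + ‖h r‖ * ‖u‖) := by gcongr
    have h4 := h0.trans h3
    calc _ ≤ |v r| * (Γ * (‖h r‖ * ‖u‖) + Γ * ‖h r‖ * (|inner ℝ (W r) u| + ‖h r‖ * ‖u‖)) := by
          gcongr
      _ = Γ * ‖u‖ * (|v r| * ‖h r‖)
          + |v r| * (Γ * ‖h r‖ * (|inner ℝ (W r) u| + ‖h r‖ * ‖u‖)) := by ring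
      _ ≤ Γ * ‖u‖ * (|v r| * ‖h r‖)
          + κ * (Γ * ‖h r‖ * (|inner ℝ (W r) u| + ‖h r‖ * ‖u‖)) := by
          gcongr
          exact hv.abs_le r
      _ = _ := by ring
  rw [e]
  refine (Finset.abs_sum_le_sum_abs _ _).trans ((Finset.sum_le_sum fun r _ => hterm r).trans ?_)
  rw [Finset.sum_add_distrib, Finset.sum_add_distrib, ← Finset.mul_sum, ← Finset.mul_sum,
    ← Finset.mul_sum, ← PiLp.norm_sq_eq_of_L2]
  calc _ ≤ Γ * ‖u‖ * ‖h‖ + Γ * κ * (‖h‖ * ‖preact W u‖) + Γ * κ * ‖u‖ * ‖h‖ ^ 2 := by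
        gcongr
        · refine (hv.sum_abs_mul_le _).trans_eq ?_
          rw [← PiLp.norm_sq_eq_of_L2, Real.sqrt_sq (norm_nonneg _)]
        · exact sum_norm_mul_abs_inner_le W h u
    _ = _ := by ring

/-! ### The network at the cluster centers -/

variable {ι : Type*} [Fintype ι] {c : ι → E} {S : ℝ}

/-- The adjoint of a bounded analysis operator is bounded by the same constant. -/
lemma norm_sum_smul_sq_le (hS : ∀ u, ∑ l, inner ℝ u (c l) ^ 2 ≤ S ^ 2 * ‖u‖ ^ 2) (s : ι → ℝ) :
    ‖∑ l, s l • c l‖ ^ 2 ≤ S ^ 2 * ∑ l, s l ^ 2 := by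
  set u := ∑ l, s l • c l with hu
  have h1 : ‖u‖ ^ 2 = ∑ l, s l * inner ℝ u (c l) := by
    rw [← real_inner_self_eq_norm_sq]
    conv_lhs => rw [hu, inner_sum, ← hu]
    simp [inner_smul_right]
  have h2 := Finset.sum_mul_sq_le_sq_mul_sq Finset.univ s (fun l => inner ℝ u (c l))
  rw [← h1] at h2
  have hs : 0 ≤ ∑ l, s l ^ 2 := Finset.sum_nonneg fun _ _ => sq_nonneg _
  by_cases hu0 : ‖u‖ ^ 2 = 0
  · rw [hu0]; positivity
  · have hpos : 0 < ‖u‖ ^ 2 := lt_of_le_of_ne (sq_nonneg _) (Ne.symm hu0)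
    have h3 := h2.trans (mul_le_mul_of_nonneg_left (hS u) hs)
    have h4 : ‖u‖ ^ 2 * ‖u‖ ^ 2 ≤ ‖u‖ ^ 2 * (S ^ 2 * ∑ l, s l ^ 2) := by nlinarith
    exact le_of_mul_le_mul_left h4 hpos

lemma sum_net_sub_sq_le (hφ : SmoothActivation φ Γ) (hv : OutputBound v κ)
    (hS : ∀ u, ∑ l, inner ℝ u (c l) ^ 2 ≤ S ^ 2 * ‖u‖ ^ 2) :
    ∑ l, (net φ v (W + h) (c l) - net φ v W (c l)) ^ 2 ≤ Γ ^ 2 * S ^ 2 * ‖h‖ ^ 2 := by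
  have h1 : ∀ l, (net φ v (W + h) (c l) - net φ v W (c l)) ^ 2
      ≤ Γ ^ 2 * ∑ r, inner ℝ (h r) (c l) ^ 2 := by
    intro l
    have e : net φ v (W + h) (c l) - net φ v W (c l)
        = ∑ r, v r * (φ (inner ℝ (W r) (c l) + inner ℝ (h r) (c l)) - φ (inner ℝ (W r) (c l))) := by
      simp only [net, PiLp.add_apply, inner_add_left, ← Finset.sum_sub_distrib, mul_sub]
    rw [e]
    refine (Finset.sum_mul_sq_le_sq_mul_sq _ _ _).trans ?_
    calc _ ≤ 1 * ∑ r, (φ (inner ℝ (W r) (c l) + inner ℝ (h r) (c l))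
              - φ (inner ℝ (W r) (c l))) ^ 2 := by
          gcongr
          exact hv.sum_sq_le
      _ ≤ ∑ r, Γ ^ 2 * inner ℝ (h r) (c l) ^ 2 := by
          rw [one_mul]
          refine Finset.sum_le_sum fun r _ => ?_
          rw [← sq_abs, ← sq_abs (inner ℝ (h r) (c l)), ← mul_pow]
          gcongr
          simpa using hφ.abs_sub_le (inner ℝ (W r) (c l) + inner ℝ (h r) (c l))
            (inner ℝ (W r) (c l))
      _ = _ := by rw [Finset.mul_sum]
  refine (Finset.sum_le_sum fun l _ => h1 l).trans ?_
  rw [← Finset.mul_sum, Finset.sum_comm, mul_assoc, PiLp.norm_sq_eq_of_L2,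
    Finset.mul_sum (a := S ^ 2)]
  exact mul_le_mul_of_nonneg_left (Finset.sum_le_sum fun r _ => hS _) (sq_nonneg _)

/-- The adjoint Jacobian at the centers is Lipschitz in the weights, with a constant of
order `κ`. -/
lemma norm_sum_smul_netGrad_sub_le (hφ : SmoothActivation φ Γ) (hv : OutputBound v κ)
    (hc : ∀ l, ‖c l‖ ≤ 1) (hS0 : 0 ≤ S)
    (hS : ∀ u, ∑ l, inner ℝ u (c l) ^ 2 ≤ S ^ 2 * ‖u‖ ^ 2) (s : ι → ℝ) :
    ‖∑ l, s l • (netGrad φ v W (c l) - netGrad φ v W' (c l))‖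
      ≤ Γ * κ * S * ‖W - W'‖ * √(∑ l, s l ^ 2) := by
  have hΓ := hφ.nonneg
  have hκ := hv.nonneg
  have hs : 0 ≤ ∑ l, s l ^ 2 := Finset.sum_nonneg fun _ _ => sq_nonneg _
  apply le_of_sq_le_sq _ (by positivity)
  rw [mul_pow, Real.sq_sqrt hs, PiLp.norm_sq_eq_of_L2]
  have h1 : ∀ r, ‖(∑ l, s l • (netGrad φ v W (c l) - netGrad φ v W' (c l))) r‖ ^ 2
      ≤ S ^ 2 * ((κ * Γ) ^ 2 * ‖(W - W') r‖ ^ 2 * ∑ l, s l ^ 2) := by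
    intro r
    have e : (∑ l, s l • (netGrad φ v W (c l) - netGrad φ v W' (c l))) r
        = ∑ l, (s l * (v r * (deriv φ (inner ℝ (W r) (c l)) - deriv φ (inner ℝ (W' r) (c l)))))
            • c l := by
      simp only [netGrad, WithLp.ofLp_sum, Finset.sum_apply, PiLp.smul_apply, PiLp.sub_apply]
      refine Finset.sum_congr rfl fun l _ => ?_
      module
    rw [e]
    refine (norm_sum_smul_sq_le hS _).trans ?_
    gcongr
    rw [Finset.mul_sum]
    refine Finset.sum_le_sum fun l _ => ?_
    rw [mul_pow, mul_comm, ← mul_pow (κ * Γ)]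
    gcongr ?_ * _
    rw [← sq_abs]
    gcongr
    rw [abs_mul, mul_assoc]
    gcongr
    · exact hv.abs_le r
    · refine (hφ.deriv_lip _ _).trans ?_
      gcongr
      rw [← inner_sub_left]
      exact (abs_real_inner_le_norm _ _).trans (mul_le_of_le_one_right (norm_nonneg _) (hc l))
  refine (Finset.sum_le_sum fun r _ => h1 r).trans (le_of_eq ?_)
  rw [← Finset.mul_sum, ← Finset.sum_mul, ← Finset.mul_sum, ← PiLp.norm_sq_eq_of_L2]
  ring

/-- Twice the weighted quadratic loss of the network at the centers, with targets `b` and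
weights `m`. -/
noncomputable def centerLoss (φ : ℝ → ℝ) (v : Fin k → ℝ) (c : ι → E) (m b : ι → ℝ)
    (W : PiLp 2 fun _ : Fin k => E) : ℝ :=
  ∑ l, m l * (net φ v W (c l) - b l) ^ 2

/-- The gradient of half of `centerLoss`. -/
noncomputable def centerGrad (φ : ℝ → ℝ) (v : Fin k → ℝ) (c : ι → E) (m b : ι → ℝ)
    (W : PiLp 2 fun _ : Fin k => E) : PiLp 2 fun _ : Fin k => E :=
  ∑ l, (m l * (net φ v W (c l) - b l)) • netGrad φ v W (c l)

variable {m b : ι → ℝ}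

lemma centerLoss_nonneg (hm : ∀ l, 0 ≤ m l) : 0 ≤ centerLoss φ v c m b W :=
  Finset.sum_nonneg fun l _ => mul_nonneg (hm l) (sq_nonneg _)

lemma centerLoss_add_le (hφ : SmoothActivation φ Γ) (hv : OutputBound v κ)
    (hc : ∀ l, ‖c l‖ ≤ 1) (hS : ∀ u, ∑ l, inner ℝ u (c l) ^ 2 ≤ S ^ 2 * ‖u‖ ^ 2) {mup : ℝ}
    (hm : ∀ l, 0 ≤ m l) (hmup : ∀ l, m l ≤ mup) (hmup0 : 0 ≤ mup) :
    centerLoss φ v c m b (W + h) ≤ centerLoss φ v c m b W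
      + 2 * inner ℝ (centerGrad φ v c m b W) h
      + (mup * (Γ ^ 2 * S ^ 2) + 2 * (Γ * κ) * (√(∑ l, m l) * √(centerLoss φ v c m b W)))
        * ‖h‖ ^ 2 := by
  have hΓ := hφ.nonneg
  have hκ := hv.nonneg
  set q : ι → ℝ := fun l => net φ v W (c l) - b l with hq
  set Δ : ι → ℝ := fun l => net φ v (W + h) (c l) - net φ v W (c l) with hΔ
  have h1 : ∑ l, m l * Δ l ^ 2 ≤ mup * (Γ ^ 2 * S ^ 2 * ‖h‖ ^ 2) := by
    calc _ ≤ ∑ l, mup * Δ l ^ 2 := by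
          refine Finset.sum_le_sum fun l _ => ?_
          gcongr
          exact hmup l
      _ ≤ _ := by
          rw [← Finset.mul_sum]
          gcongr
          exact sum_net_sub_sq_le W h hφ hv hS
  have h2 : ∑ l, m l * |q l| ≤ √(∑ l, m l) * √(centerLoss φ v c m b W) := by
    have e : ∑ l, m l * |q l| = ∑ l, √(m l) * (√(m l) * |q l|) := by
      refine Finset.sum_congr rfl fun l _ => ?_
      rw [← mul_assoc, Real.mul_self_sqrt (hm l)]
    rw [e]
    refine (Real.sum_mul_le_sqrt_mul_sqrt _ _ _).trans (le_of_eq ?_)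
    simp only [centerLoss, mul_pow, sq_abs, Real.sq_sqrt (hm _), hq]
  have h3 : ∑ l, m l * q l * Δ l ≤ inner ℝ (centerGrad φ v c m b W) h
      + ∑ l, m l * |q l| * (Γ * κ * ‖h‖ ^ 2) := by
    rw [centerGrad, sum_inner, ← Finset.sum_add_distrib]
    refine Finset.sum_le_sum fun l _ => ?_
    rw [real_inner_smul_left]
    have h4 : m l * q l * (Δ l - inner ℝ (netGrad φ v W (c l)) h)
        ≤ m l * |q l| * (Γ * κ * ‖h‖ ^ 2) := by
      rw [mul_assoc, mul_assoc]
      refine mul_le_mul_of_nonneg_left ((le_abs_self _).trans ?_) (hm l)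
      rw [abs_mul]
      gcongr
      exact abs_net_taylor_le W h hφ hv (hc l)
    simp only [hq] at h4 ⊢
    linarith
  rw [← Finset.sum_mul] at h3
  have h5 : centerLoss φ v c m b (W + h) = centerLoss φ v c m b W + 2 * ∑ l, m l * q l * Δ l
      + ∑ l, m l * Δ l ^ 2 := by
    rw [centerLoss, centerLoss, Finset.mul_sum, ← Finset.sum_add_distrib, ← Finset.sum_add_distrib]
    refine Finset.sum_congr rfl fun l _ => ?_
    simp only [hq, hΔ]
    ring
  have h6 := mul_le_mul_of_nonneg_right h2 (by positivity : 0 ≤ Γ * κ * ‖h‖ ^ 2)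
  rw [h5]
  nlinarith

/-- The descent inequality for a gradient step with gradient error `ξ`. -/
lemma centerLoss_step_le (hφ : SmoothActivation φ Γ) (hv : OutputBound v κ)
    (hc : ∀ l, ‖c l‖ ≤ 1) (hS : ∀ u, ∑ l, inner ℝ u (c l) ^ 2 ≤ S ^ 2 * ‖u‖ ^ 2) {mup : ℝ}
    (hm : ∀ l, 0 ≤ m l) (hmup : ∀ l, m l ≤ mup) (hmup0 : 0 ≤ mup) {η : ℝ} (hη : 0 ≤ η)
    (hη' : η * (2 * (mup * (Γ ^ 2 * S ^ 2))) ≤ 1)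
    (hcurv : 2 * (Γ * κ) * (√(∑ l, m l) * √(centerLoss φ v c m b W)) ≤ mup * (Γ ^ 2 * S ^ 2))
    (ξ : PiLp 2 fun _ : Fin k => E) :
    centerLoss φ v c m b (W - η • (centerGrad φ v c m b W - ξ)) ≤ centerLoss φ v c m b W
      - η * ‖centerGrad φ v c m b W‖ ^ 2 + η * ‖ξ‖ ^ 2 := by
  set p := centerGrad φ v c m b W with hp
  have h1 := centerLoss_add_le W (-(η • (p - ξ))) (b := b) hφ hv hc hS hm hmup hmup0
  rw [← sub_eq_add_neg, ← hp, inner_neg_right, norm_neg, norm_smul, mul_pow, Real.norm_eq_abs,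
    sq_abs, real_inner_smul_right] at h1
  have h2 : (mup * (Γ ^ 2 * S ^ 2) + 2 * (Γ * κ) * (√(∑ l, m l) * √(centerLoss φ v c m b W)))
        * (η ^ 2 * ‖p - ξ‖ ^ 2) ≤ η * ‖p - ξ‖ ^ 2 := by
    calc _ ≤ (2 * (mup * (Γ ^ 2 * S ^ 2))) * (η ^ 2 * ‖p - ξ‖ ^ 2) := by gcongr; linarith
      _ = (η * (2 * (mup * (Γ ^ 2 * S ^ 2)))) * (η * ‖p - ξ‖ ^ 2) := by ring
      _ ≤ 1 * (η * ‖p - ξ‖ ^ 2) := by gcongr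
      _ = _ := one_mul _
  have h3 : 2 * inner ℝ p (p - ξ) = ‖p‖ ^ 2 + ‖p - ξ‖ ^ 2 - ‖ξ‖ ^ 2 := by
    rw [norm_sub_sq_real, inner_sub_right, real_inner_self_eq_norm_sq]; ring
  have h4 : η * (2 * inner ℝ p (p - ξ)) = η * (‖p‖ ^ 2 + ‖p - ξ‖ ^ 2 - ‖ξ‖ ^ 2) := by rw [h3]
  linarith

/-- The Polyak–Łojasiewicz inequality for the center loss near weights `W'` whose Jacobian at the
centers is well conditioned. -/
lemma centerLoss_le_norm_centerGrad_sq (hφ : SmoothActivation φ Γ) (hv : OutputBound v κ)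
    (hc : ∀ l, ‖c l‖ ≤ 1) (hS0 : 0 ≤ S)
    (hS : ∀ u, ∑ l, inner ℝ u (c l) ^ 2 ≤ S ^ 2 * ‖u‖ ^ 2) {mlo lam : ℝ}
    (hmlo0 : 0 ≤ mlo) (hmlo : ∀ l, mlo ≤ m l) (hlam : 0 ≤ lam)
    (hW' : ∀ s : ι → ℝ, lam / 4 * ∑ l, s l ^ 2 ≤ ‖∑ l, s l • netGrad φ v W' (c l)‖ ^ 2)
    (hWW' : Γ * κ * S * ‖W - W'‖ ≤ √lam / 4) :
    lam / 16 * mlo * centerLoss φ v c m b W ≤ ‖centerGrad φ v c m b W‖ ^ 2 := by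
  set s : ι → ℝ := fun l => m l * (net φ v W (c l) - b l) with hs
  have hs0 : 0 ≤ ∑ l, s l ^ 2 := Finset.sum_nonneg fun _ _ => sq_nonneg _
  have h1 : √lam / 2 * √(∑ l, s l ^ 2) ≤ ‖∑ l, s l • netGrad φ v W' (c l)‖ := by
    apply le_of_sq_le_sq _ (norm_nonneg _)
    rw [mul_pow, div_pow, Real.sq_sqrt hlam, Real.sq_sqrt hs0,
      show (2 : ℝ) ^ 2 = 4 by norm_num]
    exact hW' s
  have h2 : ‖∑ l, s l • (netGrad φ v W (c l) - netGrad φ v W' (c l))‖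
      ≤ √lam / 4 * √(∑ l, s l ^ 2) :=
    (norm_sum_smul_netGrad_sub_le W W' hφ hv hc hS0 hS s).trans (by gcongr)
  have h3 : √lam / 4 * √(∑ l, s l ^ 2) ≤ ‖centerGrad φ v c m b W‖ := by
    have e : ∑ l, s l • netGrad φ v W' (c l) = centerGrad φ v c m b W
        - ∑ l, s l • (netGrad φ v W (c l) - netGrad φ v W' (c l)) := by
      simp only [smul_sub, Finset.sum_sub_distrib, centerGrad, hs]
      abel
    have h4 := norm_sub_le (centerGrad φ v c m b W)
      (∑ l, s l • (netGrad φ v W (c l) - netGrad φ v W' (c l)))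
    rw [← e] at h4
    linarith
  have h5 : lam / 16 * ∑ l, s l ^ 2 ≤ ‖centerGrad φ v c m b W‖ ^ 2 := by
    have := pow_le_pow_left₀ (by positivity) h3 2
    rw [mul_pow, div_pow, Real.sq_sqrt hlam, Real.sq_sqrt hs0,
      show (4 : ℝ) ^ 2 = 16 by norm_num] at this
    exact this
  refine le_trans ?_ h5
  rw [mul_assoc]
  gcongr
  rw [centerLoss, Finset.mul_sum]
  refine Finset.sum_le_sum fun l _ => ?_
  simp only [hs]
  have : mlo * m l ≤ m l * m l := mul_le_mul_of_nonneg_right (hmlo l) (hmlo0.trans (hmlo l))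
  nlinarith [mul_le_mul_of_nonneg_right this (sq_nonneg (net φ v W (c l) - b l))]

end Network

/-! ### Gradient descent on clustered data -/

section Clustered

variable {k : ℕ} {E : Type*} [NormedAddCommGroup E] [InnerProductSpace ℝ E]
  {I ι : Type*} [Fintype I] [DecidableEq ι]

/-- The gradient of the quadratic training loss with inputs `x` and labels `y`. -/
noncomputable def trainGrad (φ : ℝ → ℝ) (v : Fin k → ℝ) (x : I → E) (y : I → ℝ)
    (W : PiLp 2 fun _ : Fin k => E) : PiLp 2 fun _ : Fin k => E :=
  ∑ i, (net φ v W (x i) - y i) • netGrad φ v W (x i)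

/-- The number of samples of cluster `l`. -/
noncomputable def clusterSize (cl : I → ι) (l : ι) : ℝ :=
  ((Finset.univ.filter fun i => cl i = l).card : ℝ)

/-- The mean of the labels in cluster `l`. -/
noncomputable def clusterMean (cl : I → ι) (y : I → ℝ) (l : ι) : ℝ :=
  (∑ i with cl i = l, y i) / clusterSize cl l

variable {φ : ℝ → ℝ} {Γ κ : ℝ} {v : Fin k → ℝ} {x : I → E} {y : I → ℝ} {c : ι → E} {cl : I → ι}

lemma clusterSize_nonneg (l : ι) : 0 ≤ clusterSize cl l := Nat.cast_nonneg _

lemma clusterSize_mul_clusterMean (hpos : ∀ l, 0 < clusterSize cl l) (l : ι) :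
    clusterSize cl l * clusterMean cl y l = ∑ i with cl i = l, y i :=
  mul_div_cancel₀ _ (hpos l).ne'

lemma abs_clusterMean_sub_le (hpos : ∀ l, 0 < clusterSize cl l) (l : ι) (α : ℝ) :
    |clusterMean cl y l - α| ≤ (∑ i with cl i = l, |y i - α|) / clusterSize cl l := by
  have h : |clusterMean cl y l - α| * clusterSize cl l
      = |clusterSize cl l * clusterMean cl y l - α * clusterSize cl l| := by
    rw [← abs_of_pos (hpos l), ← abs_mul, abs_of_pos (hpos l)]
    ring_nf
  rw [le_div_iff₀ (hpos l), h, clusterSize_mul_clusterMean hpos]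
  have : ∑ i with cl i = l, y i - α * clusterSize cl l = ∑ i with cl i = l, (y i - α) := by
    simp [clusterSize, mul_comm]
  rw [this]
  exact Finset.abs_sum_le_sum_abs _ _

lemma abs_clusterMean_le (hpos : ∀ l, 0 < clusterSize cl l) (hy : ∀ i, |y i| ≤ 1) (l : ι) :
    |clusterMean cl y l| ≤ 1 := by
  have h := abs_clusterMean_sub_le (y := y) hpos l 0
  simp only [sub_zero] at h
  refine h.trans (div_le_one_of_le₀ ?_ (hpos l).le)
  refine (Finset.sum_le_sum fun i _ => hy i).trans ?_
  simp [clusterSize]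

variable [Fintype ι]

lemma sum_clusterSize_mul (f : ι → ℝ) : ∑ l, clusterSize cl l * f l = ∑ i, f (cl i) := by
  rw [← Finset.sum_fiberwise Finset.univ cl]
  refine Finset.sum_congr rfl fun l _ => ?_
  rw [Finset.sum_congr rfl (g := fun _ => f l)]
  · simp [clusterSize]
  · intro i hi
    rw [(Finset.mem_filter.1 hi).2]

lemma sum_clusterSize : ∑ l, clusterSize cl l = Fintype.card I := by
  simpa using sum_clusterSize_mul (cl := cl) fun _ => 1

lemma centerLoss_clusterMean (W : PiLp 2 fun _ : Fin k => E) :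
    centerLoss φ v c (clusterSize cl) (clusterMean cl y) W
      = ∑ i, (net φ v W (c (cl i)) - clusterMean cl y (cl i)) ^ 2 := by
  rw [centerLoss, sum_clusterSize_mul (fun l => (net φ v W (c l) - clusterMean cl y l) ^ 2)]

/-- Replacing the labels by their cluster means does not change the gradient of the loss with
inputs at the cluster centers. -/
lemma centerGrad_clusterMean (hpos : ∀ l, 0 < clusterSize cl l)
    (W : PiLp 2 fun _ : Fin k => E) :
    centerGrad φ v c (clusterSize cl) (clusterMean cl y) W
      = ∑ i, (net φ v W (c (cl i)) - y i) • netGrad φ v W (c (cl i)) := by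
  rw [centerGrad, ← Finset.sum_fiberwise Finset.univ cl]
  refine Finset.sum_congr rfl fun l _ => ?_
  rw [Finset.sum_congr rfl (g := fun i => (net φ v W (c l) - y i) • netGrad φ v W (c l)),
    ← Finset.sum_smul, Finset.sum_sub_distrib, mul_sub, clusterSize_mul_clusterMean hpos]
  · simp [clusterSize]
  · intro i hi
    rw [(Finset.mem_filter.1 hi).2]

lemma norm_sum_smul_le (s : I → ℝ) (u : I → PiLp 2 fun _ : Fin k => E) :
    ‖∑ i, s i • u i‖ ≤ √(∑ i, s i ^ 2) * √(∑ i, ‖u i‖ ^ 2) := by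
  refine (norm_sum_le _ _).trans ?_
  simp only [norm_smul, Real.norm_eq_abs]
  refine (Real.sum_mul_le_sqrt_mul_sqrt _ _ _).trans (le_of_eq ?_)
  simp only [sq_abs]

/-- The training gradient is close to the gradient of the center loss. -/
lemma norm_centerGrad_sub_trainGrad_le (hφ : SmoothActivation φ Γ) (hv : OutputBound v κ)
    (hx : ∀ i, ‖x i‖ ≤ 1) (hpos : ∀ l, 0 < clusterSize cl l) (W : PiLp 2 fun _ : Fin k => E) :
    ‖centerGrad φ v c (clusterSize cl) (clusterMean cl y) W - trainGrad φ v x y W‖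
      ≤ √(∑ i, (net φ v W (c (cl i)) - y i) ^ 2)
          * √(∑ i, ‖netGrad φ v W (x i) - netGrad φ v W (c (cl i))‖ ^ 2)
        + √(∑ i, (net φ v W (x i) - net φ v W (c (cl i))) ^ 2)
          * (√(Fintype.card I : ℝ) * Γ) := by
  have hΓ := hφ.nonneg
  have e : centerGrad φ v c (clusterSize cl) (clusterMean cl y) W - trainGrad φ v x y W
      = -(∑ i, (net φ v W (c (cl i)) - y i) •
            (netGrad φ v W (x i) - netGrad φ v W (c (cl i)))
        + ∑ i, (net φ v W (x i) - net φ v W (c (cl i))) • netGrad φ v W (x i)) := by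
    rw [centerGrad_clusterMean hpos, trainGrad, ← Finset.sum_sub_distrib, ← Finset.sum_add_distrib,
      ← Finset.sum_neg_distrib]
    refine Finset.sum_congr rfl fun i _ => ?_
    module
  rw [e, norm_neg]
  refine (norm_add_le _ _).trans (add_le_add (norm_sum_smul_le _ _) ?_)
  refine (norm_sum_smul_le _ _).trans ?_
  gcongr
  rw [Real.sqrt_le_left (by positivity), mul_pow, Real.sq_sqrt (Nat.cast_nonneg _)]
  calc _ ≤ ∑ _i : I, Γ ^ 2 := by
        refine Finset.sum_le_sum fun i _ => ?_
        gcongr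
        exact norm_netGrad_le W hφ hv (hx i)
    _ = _ := by simp

/-- What is used about the data and about the initial weights `W₀`: `lam` is the eigenvalue `λ(C)`,
`S` bounds the spectral norm of the matrix of centers, `lg` stands for `log K`, and `mlo`, `mup`
bound the cluster sizes. -/
structure GoodStart (φ : ℝ → ℝ) (v : Fin k → ℝ) (x : I → E) (y : I → ℝ) (c : ι → E) (cl : I → ι)
    (W₀ : PiLp 2 fun _ : Fin k => E) (Γ κ ε lg lam S mlo mup : ℝ) : Prop where
  smooth : SmoothActivation φ Γ
  one_le : 1 ≤ Γ
  output : OutputBound v κ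
  scale : κ ^ 2 * k ≤ 1
  norm_input : ∀ i, ‖x i‖ ≤ 1
  norm_center : ∀ l, ‖c l‖ ≤ 1
  near : ∀ i, ‖x i - c (cl i)‖ ≤ ε
  eps_pos : 0 < ε
  label : ∀ i, |y i| ≤ 1
  spec_nonneg : 0 ≤ S
  spec : ∀ u, ∑ l, inner ℝ u (c l) ^ 2 ≤ S ^ 2 * ‖u‖ ^ 2
  size_pos : 0 < mlo
  size_ge : ∀ l, mlo ≤ clusterSize cl l
  size_le : ∀ l, clusterSize cl l ≤ mup
  lam_pos : 0 < lam
  log_ge : 2 / 3 ≤ lg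
  init_output : ∀ l, |net φ v W₀ (c l)| ≤ 15 * Γ * √lg
  init_cond : ∀ s : ι → ℝ, lam / 4 * ∑ l, s l ^ 2 ≤ ‖∑ l, s l • netGrad φ v W₀ (c l)‖ ^ 2
  init_diff : ∑ i, (net φ v W₀ (x i) - net φ v W₀ (c (cl i))) ^ 2
    ≤ 441 * (Fintype.card I * Γ ^ 2 * ε ^ 2 * lg)
  init_preact : ∑ i, ‖preact W₀ (x i - c (cl i))‖ ^ 2 ≤ 9 * (Fintype.card I * k * ε ^ 2)

namespace GoodStart

variable {W₀ W : PiLp 2 fun _ : Fin k => E} {ε lg lam S mlo mup R : ℝ}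

local notation "n" => (Fintype.card I : ℝ)

lemma clusterSize_pos (hg : GoodStart φ v x y c cl W₀ Γ κ ε lg lam S mlo mup) (l : ι) :
    0 < clusterSize cl l := hg.size_pos.trans_le (hg.size_ge l)

lemma norm_preact_le (hg : GoodStart φ v x y c cl W₀ Γ κ ε lg lam S mlo mup) (hR : ‖W - W₀‖ ≤ R)
    (hκR : κ * R ≤ 1) (i : I) :
    κ * ‖preact W (x i - c (cl i))‖ ≤ κ * ‖preact W₀ (x i - c (cl i))‖ + ε := by
  have hκ := hg.output.nonneg
  have hε := hg.eps_pos
  have h1 : ‖preact W (x i - c (cl i))‖ ≤ ‖preact W₀ (x i - c (cl i))‖ + R * ε := by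
    rw [show W = W₀ + (W - W₀) by abel, preact_add_left]
    refine (norm_add_le _ _).trans (add_le_add le_rfl ((_root_.norm_preact_le _ _).trans ?_))
    gcongr
    · exact (norm_nonneg _).trans hR
    · exact hg.near i
  calc _ ≤ κ * (‖preact W₀ (x i - c (cl i))‖ + R * ε) := by gcongr
    _ = κ * ‖preact W₀ (x i - c (cl i))‖ + (κ * R) * ε := by ring
    _ ≤ κ * ‖preact W₀ (x i - c (cl i))‖ + 1 * ε := by gcongr
    _ = _ := by ring

lemma sum_scaled_preact_sq_le (hg : GoodStart φ v x y c cl W₀ Γ κ ε lg lam S mlo mup) :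
    ∑ i, (κ * ‖preact W₀ (x i - c (cl i))‖) ^ 2 ≤ 9 * (n * ε ^ 2) := by
  simp only [mul_pow]
  rw [← Finset.mul_sum]
  calc _ ≤ κ ^ 2 * (9 * (n * k * ε ^ 2)) := by gcongr; exact hg.init_preact
    _ = (κ ^ 2 * k) * (9 * (n * ε ^ 2)) := by ring
    _ ≤ 1 * (9 * (n * ε ^ 2)) := by gcongr; exact hg.scale
    _ = _ := one_mul _

lemma sum_norm_netGrad_sub_sq_le (hg : GoodStart φ v x y c cl W₀ Γ κ ε lg lam S mlo mup)
    (hR : ‖W - W₀‖ ≤ R) (hκR : κ * R ≤ 1) :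
    ∑ i, ‖netGrad φ v W (x i) - netGrad φ v W (c (cl i))‖ ^ 2 ≤ (6 * Γ * ε * √n) ^ 2 := by
  have hΓ := hg.smooth.nonneg
  have h1 : ∀ i, ‖netGrad φ v W (x i) - netGrad φ v W (c (cl i))‖ ^ 2
      ≤ 8 * Γ ^ 2 * ε ^ 2 + 2 * Γ ^ 2 * (κ * ‖preact W₀ (x i - c (cl i))‖) ^ 2 := by
    intro i
    have h2 : ‖netGrad φ v W (x i) - netGrad φ v W (c (cl i))‖
        ≤ Γ * (2 * ε + κ * ‖preact W₀ (x i - c (cl i))‖) := by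
      refine (norm_netGrad_sub_le W hg.smooth hg.output (x i) (hg.norm_center (cl i))).trans ?_
      have h3 := hg.norm_preact_le hR hκR i
      have h4 := hg.near i
      rw [mul_assoc, ← mul_add]
      exact mul_le_mul_of_nonneg_left (by linarith) hΓ
    calc _ ≤ (Γ * (2 * ε + κ * ‖preact W₀ (x i - c (cl i))‖)) ^ 2 := by gcongr
      _ = Γ ^ 2 * (2 * ε + κ * ‖preact W₀ (x i - c (cl i))‖) ^ 2 := by ring
      _ ≤ Γ ^ 2 * (2 * (2 * ε) ^ 2 + 2 * (κ * ‖preact W₀ (x i - c (cl i))‖) ^ 2) := by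
          gcongr
          nlinarith [sq_nonneg (2 * ε - κ * ‖preact W₀ (x i - c (cl i))‖)]
      _ = _ := by ring
  calc _ ≤ ∑ i, (8 * Γ ^ 2 * ε ^ 2 + 2 * Γ ^ 2 * (κ * ‖preact W₀ (x i - c (cl i))‖) ^ 2) :=
        Finset.sum_le_sum fun i _ => h1 i
    _ = 8 * Γ ^ 2 * ε ^ 2 * n + 2 * Γ ^ 2 * ∑ i, (κ * ‖preact W₀ (x i - c (cl i))‖) ^ 2 := by
        rw [Finset.sum_add_distrib, Finset.sum_const, nsmul_eq_mul, Finset.card_univ,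
          ← Finset.mul_sum]
        ring
    _ ≤ 8 * Γ ^ 2 * ε ^ 2 * n + 2 * Γ ^ 2 * (9 * (n * ε ^ 2)) := by
        gcongr; exact hg.sum_scaled_preact_sq_le
    _ ≤ _ := by
        rw [mul_pow, Real.sq_sqrt (Nat.cast_nonneg _)]
        nlinarith

/-- Near initialization, the outputs at the inputs are close to the outputs at the centers. -/
lemma sqrt_sum_net_sub_sq_le (hg : GoodStart φ v x y c cl W₀ Γ κ ε lg lam S mlo mup) (hR0 : 0 ≤ R)
    (hR : ‖W - W₀‖ ≤ 8 * R) (hκR : κ * (8 * R) ≤ 1) :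
    √(∑ i, (net φ v W (x i) - net φ v W (c (cl i))) ^ 2)
      ≤ √n * (Γ * ε * (37 * √lg + 50 * R)) := by
  have hκ := hg.output.nonneg
  have hΓ := hg.smooth.nonneg
  have hε := hg.eps_pos
  have hlg : 0 ≤ lg := by linarith [hg.log_ge]
  have h1 : ∀ i, (net φ v W (x i) - net φ v W (c (cl i))) ^ 2
      ≤ 3 * (net φ v W₀ (x i) - net φ v W₀ (c (cl i))) ^ 2 + 768 * Γ ^ 2 * R ^ 2 * ε ^ 2
        + 192 * Γ ^ 2 * R ^ 2 * (κ * ‖preact W₀ (x i - c (cl i))‖) ^ 2 := by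
    intro i
    have h2 := abs_net_sub_sub_le W₀ (W - W₀) hg.smooth hg.output (x i) (hg.norm_center (cl i))
    rw [add_sub_cancel] at h2
    have h4 := hg.near i
    set A := κ * ‖preact W₀ (x i - c (cl i))‖ with hA
    set e := net φ v W₀ (x i) - net φ v W₀ (c (cl i)) with he
    set f := net φ v W (x i) - net φ v W (c (cl i)) with hf
    have h5 : κ * ‖W - W₀‖ ≤ 1 := le_trans (by gcongr) hκR
    have h3 : |f - e| ≤ Γ * (8 * R) * (2 * ε + A) := by
      refine h2.trans ?_
      have h6 : ‖x i - c (cl i)‖ + A + κ * ‖W - W₀‖ * ‖x i - c (cl i)‖ ≤ 2 * ε + A := by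
        have := mul_le_mul h5 h4 (norm_nonneg _) zero_le_one
        linarith
      gcongr
    have h7 : (f - e) ^ 2 ≤ (Γ * (8 * R) * (2 * ε + A)) ^ 2 := by
      rw [← sq_abs (f - e)]; gcongr
    have h8 : f ^ 2 ≤ 3 * e ^ 2 + 3 / 2 * (f - e) ^ 2 := by nlinarith [sq_nonneg (3 * e - f)]
    have h9 : (2 * ε + A) ^ 2 ≤ 2 * (2 * ε) ^ 2 + 2 * A ^ 2 := by nlinarith [sq_nonneg (2 * ε - A)]
    have h10 : (Γ * (8 * R) * (2 * ε + A)) ^ 2 ≤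
        64 * Γ ^ 2 * R ^ 2 * (2 * (2 * ε) ^ 2 + 2 * A ^ 2) := by
      calc _ = 64 * Γ ^ 2 * R ^ 2 * (2 * ε + A) ^ 2 := by ring
        _ ≤ _ := by gcongr
    nlinarith
  rw [Real.sqrt_le_left (by positivity)]
  calc _ ≤ ∑ i, (3 * (net φ v W₀ (x i) - net φ v W₀ (c (cl i))) ^ 2 + 768 * Γ ^ 2 * R ^ 2 * ε ^ 2
        + 192 * Γ ^ 2 * R ^ 2 * (κ * ‖preact W₀ (x i - c (cl i))‖) ^ 2) :=
        Finset.sum_le_sum fun i _ => h1 i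
    _ = 3 * ∑ i, (net φ v W₀ (x i) - net φ v W₀ (c (cl i))) ^ 2 + 768 * Γ ^ 2 * R ^ 2 * ε ^ 2 * n
        + 192 * Γ ^ 2 * R ^ 2 * ∑ i, (κ * ‖preact W₀ (x i - c (cl i))‖) ^ 2 := by
        rw [Finset.sum_add_distrib, Finset.sum_add_distrib, Finset.sum_const, nsmul_eq_mul,
          Finset.card_univ, ← Finset.mul_sum, ← Finset.mul_sum]
        ring
    _ ≤ 3 * (441 * (n * Γ ^ 2 * ε ^ 2 * lg)) + 768 * Γ ^ 2 * R ^ 2 * ε ^ 2 * n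
        + 192 * Γ ^ 2 * R ^ 2 * (9 * (n * ε ^ 2)) := by
        gcongr
        · exact hg.init_diff
        · exact hg.sum_scaled_preact_sq_le
    _ = n * (Γ * ε) ^ 2 * (1323 * lg + 2496 * R ^ 2) := by ring
    _ ≤ n * (Γ * ε) ^ 2 * (37 * √lg + 50 * R) ^ 2 := by
        gcongr
        have := Real.sq_sqrt hlg
        have : 0 ≤ √lg * R := by positivity
        nlinarith [sq_nonneg R]
    _ = _ := by
        rw [mul_pow (√n), Real.sq_sqrt (Nat.cast_nonneg _)]; ring

lemma sum_net_sub_label_sq_le (hg : GoodStart φ v x y c cl W₀ Γ κ ε lg lam S mlo mup) :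
    ∑ i, (net φ v W (c (cl i)) - y i) ^ 2
      ≤ 2 * centerLoss φ v c (clusterSize cl) (clusterMean cl y) W + 8 * n := by
  rw [centerLoss_clusterMean, Finset.mul_sum]
  have : 8 * n = ∑ _i : I, (8 : ℝ) := by simp; ring
  rw [this, ← Finset.sum_add_distrib]
  refine Finset.sum_le_sum fun i _ => ?_
  have h1 := abs_le.1 (abs_clusterMean_le hg.clusterSize_pos hg.label (cl i))
  have h2 := abs_le.1 (hg.label i)
  set b := clusterMean cl y (cl i)
  nlinarith [sq_nonneg ((net φ v W (c (cl i)) - b) - (b - y i))]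

/-- The size of the difference between the training gradient and the center gradient, in a ball of
radius `8 R` around the initial weights and below the loss level `1156 Γ² n lg`. -/
lemma norm_grad_error_le (hg : GoodStart φ v x y c cl W₀ Γ κ ε lg lam S mlo mup) (hR0 : 0 ≤ R)
    (hR : ‖W - W₀‖ ≤ 8 * R) (hκR : κ * (8 * R) ≤ 1)
    (hQ : centerLoss φ v c (clusterSize cl) (clusterMean cl y) W ≤ 1156 * (Γ ^ 2 * n * lg)) :
    ‖centerGrad φ v c (clusterSize cl) (clusterMean cl y) W - trainGrad φ v x y W‖
      ≤ Γ ^ 2 * ε * n * (331 * √lg + 50 * R) := by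
  have hΓ1 := hg.one_le
  have hε := hg.eps_pos
  have hlg : 0 ≤ lg := by linarith [hg.log_ge]
  refine (norm_centerGrad_sub_trainGrad_le hg.smooth hg.output hg.norm_input hg.clusterSize_pos
    W).trans ?_
  have h1 : √(∑ i, (net φ v W (c (cl i)) - y i) ^ 2) ≤ 49 * (Γ * √n * √lg) := by
    rw [Real.sqrt_le_left (by positivity)]
    have e : (49 * (Γ * √n * √lg)) ^ 2 = 2401 * (Γ ^ 2 * n * lg) := by
      rw [mul_pow, mul_pow, mul_pow, Real.sq_sqrt hlg, Real.sq_sqrt (Nat.cast_nonneg _)]; norm_num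
    rw [e]
    refine hg.sum_net_sub_label_sq_le.trans ?_
    have h2 : 1 * n * (2 / 3) ≤ Γ ^ 2 * n * lg := by
      gcongr
      · exact one_le_pow₀ hΓ1
      · exact hg.log_ge
    nlinarith
  have h2 : √(∑ i, ‖netGrad φ v W (x i) - netGrad φ v W (c (cl i))‖ ^ 2) ≤ 6 * Γ * ε * √n := by
    rw [Real.sqrt_le_left (by positivity)]
    exact hg.sum_norm_netGrad_sub_sq_le hR hκR
  have h3 := hg.sqrt_sum_net_sub_sq_le hR0 hR hκR
  calc _ ≤ 49 * (Γ * √n * √lg) * (6 * Γ * ε * √n)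
        + √n * (Γ * ε * (37 * √lg + 50 * R)) * (√n * Γ) := by gcongr
    _ = Γ ^ 2 * ε * (√n * √n) * (331 * √lg + 50 * R) := by ring
    _ = _ := by rw [Real.mul_self_sqrt (Nat.cast_nonneg _)]

lemma centerLoss_init_le (hg : GoodStart φ v x y c cl W₀ Γ κ ε lg lam S mlo mup) :
    centerLoss φ v c (clusterSize cl) (clusterMean cl y) W₀ ≤ 289 * (Γ ^ 2 * n * lg) := by
  rw [centerLoss_clusterMean]
  have hlg : 0 ≤ lg := by linarith [hg.log_ge]
  have h0 : 1 ≤ 2 * (Γ * √lg) := by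
    have h1 : (1 / 2 : ℝ) ≤ √lg := Real.le_sqrt_of_sq_le (by linarith [hg.log_ge])
    nlinarith [hg.one_le]
  calc _ ≤ ∑ _i : I, (17 * (Γ * √lg)) ^ 2 := by
        refine Finset.sum_le_sum fun i _ => ?_
        have h1 := abs_le.1 (abs_clusterMean_le hg.clusterSize_pos hg.label (cl i))
        have h2 := abs_le.1 (hg.init_output (cl i))
        apply sq_le_sq'
        · linarith
        · linarith
    _ = _ := by
        rw [mul_pow, mul_pow, Real.sq_sqrt hlg]; simp; ring

/-- The whole trajectory of gradient descent stays within `8 R` of the initial weights, and the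
center loss converges linearly up to the effect of the gradient error. -/
theorem trajectory (hg : GoodStart φ v x y c cl W₀ Γ κ ε lg lam S mlo mup) (hn : 0 < n)
    (hR0 : 0 < R) {η a X : ℝ} (hη : 0 < η) {τ : ℕ} {w : ℕ → PiLp 2 fun _ : Fin k => E}
    (hw0 : w 0 = W₀) (hw : ∀ t, w (t + 1) = w t - η • trainGrad φ v x y (w t))
    (ha : a = lam / 16 * mlo) (hX : X = Γ ^ 2 * ε * n * (331 * √lg + 50 * R))
    (hRa : R ^ 2 * a = 289 * (Γ ^ 2 * n * lg)) (hηa : η * a ≤ 1)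
    (hηS : η * (2 * (mup * (Γ ^ 2 * S ^ 2))) ≤ 1)
    (hκR : κ * (8 * R) ≤ 1) (hcond : Γ * κ * S * (8 * R) ≤ √lam / 4)
    (hcurv : 68 * (κ * Γ ^ 2 * n * √lg) ≤ mup * (Γ ^ 2 * S ^ 2))
    (hnoise : 4 * X / a + 5 * (η * τ) * X ≤ 4 * R) :
    ∀ t ≤ τ, ‖w t - W₀‖ ≤ 8 * R ∧
      centerLoss φ v c (clusterSize cl) (clusterMean cl y) (w t)
        ≤ (1 - η * a) ^ t * (289 * (Γ ^ 2 * n * lg)) + X ^ 2 / a := by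
  have hΓ : 0 < Γ := by linarith [hg.one_le]
  have hκ := hg.output.nonneg
  have hε := hg.eps_pos
  have hlam := hg.lam_pos
  have hlg : 0 < lg := by linarith [hg.log_ge]
  have hmlo := hg.size_pos
  have ha0 : 0 < a := by rw [ha]; positivity
  have hX0 : 0 < X := by rw [hX]; positivity
  set Q : ℕ → ℝ := fun t => centerLoss φ v c (clusterSize cl) (clusterMean cl y) (w t) with hQdef
  have hQ0 : Q 0 ≤ R ^ 2 * a := by
    rw [hRa]; simp only [hQdef, hw0]; exact hg.centerLoss_init_le
  have hsa2 : √a * √a = a := Real.mul_self_sqrt ha0.le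
  have hsQ0 : √(Q 0) ≤ R * √a := by
    rw [Real.sqrt_le_left (by positivity), mul_pow, Real.sq_sqrt ha0.le]; exact hQ0
  have hXR : X ≤ R * a := by
    have h1 : 0 ≤ 5 * (η * τ) * X := by positivity
    have h2 : 4 * X / a ≤ 4 * R := by linarith
    rw [div_le_iff₀ ha0] at h2
    linarith
  have hRfin : 4 * (√(Q 0) + X / √a) / √a + 5 * (η * τ) * X ≤ 8 * R := by
    have h1 : 4 * (√(Q 0) + X / √a) / √a ≤ 4 * (R * √a + X / √a) / √a := by gcongr
    have h2 : 4 * (R * √a + X / √a) / √a = 4 * R + 4 * X / (√a * √a) := by field_simp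
    rw [h2, hsa2] at h1
    linarith
  have hQmax : Q 0 + X ^ 2 / a ≤ 1156 * (Γ ^ 2 * n * lg) := by
    have h1 : X ^ 2 / a ≤ R ^ 2 * a := by
      rw [div_le_iff₀ ha0]
      calc X ^ 2 ≤ (R * a) ^ 2 := by gcongr
        _ = _ := by ring
    have h2 : 0 ≤ Γ ^ 2 * n * lg := by positivity
    linarith
  have hstep : ∀ t < τ, ‖w t - W₀‖ ≤ 8 * R → Q t ≤ 1156 * (Γ ^ 2 * n * lg) →
      Q (t + 1) ≤ Q t - η * ‖centerGrad φ v c (clusterSize cl) (clusterMean cl y) (w t)‖ ^ 2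
        + η * X ^ 2 ∧
      a * Q t ≤ ‖centerGrad φ v c (clusterSize cl) (clusterMean cl y) (w t)‖ ^ 2 ∧
      ‖w (t + 1) - W₀‖ ≤ ‖w t - W₀‖
        + η * ‖centerGrad φ v c (clusterSize cl) (clusterMean cl y) (w t)‖ + η * X := by
    intro t _ hD hQt
    set p := centerGrad φ v c (clusterSize cl) (clusterMean cl y) (w t) with hp
    set ξ := p - trainGrad φ v x y (w t) with hξ
    have hξX : ‖ξ‖ ≤ X := by
      rw [hX]; exact hg.norm_grad_error_le hR0.le hD hκR hQt
    have hwt : w (t + 1) = w t - η • (p - ξ) := by rw [hw, hξ, sub_sub_cancel]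
    refine ⟨?_, ?_, ?_⟩
    · have h1 := centerLoss_step_le (w t) hg.smooth hg.output hg.norm_center hg.spec
        (b := clusterMean cl y) (fun l => clusterSize_nonneg l) hg.size_le
        (m := clusterSize cl) ?_ hη.le hηS ?_ ξ
      · rw [← hwt, ← hp] at h1
        refine h1.trans ?_
        gcongr
      · have : 0 < Γ ^ 2 * κ ^ 2 + 1 := by positivity
        by_contra! hneg
        have h3 : mup * (Γ ^ 2 * S ^ 2) ≤ 0 :=
          mul_nonpos_of_nonpos_of_nonneg hneg.le (by positivity)
        have hI : Nonempty I := Fintype.card_pos_iff.1 (by exact_mod_cast hn)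
        obtain ⟨i⟩ := hI
        linarith [hg.size_le (cl i), hg.clusterSize_pos (cl i)]
      · rw [sum_clusterSize]
        refine le_trans ?_ hcurv
        have h2 : √(Q t) ≤ 34 * (Γ * √n * √lg) := by
          rw [Real.sqrt_le_left (by positivity)]
          calc _ ≤ _ := hQt
            _ = _ := by
              rw [mul_pow, mul_pow, mul_pow, Real.sq_sqrt hlg.le, Real.sq_sqrt hn.le]; norm_num
        calc _ ≤ 2 * (Γ * κ) * (√n * (34 * (Γ * √n * √lg))) := by gcongr
          _ = 68 * (κ * Γ ^ 2 * (√n * √n) * √lg) := by ring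
          _ = _ := by rw [Real.mul_self_sqrt hn.le]
    · rw [ha]
      have hS := hg.spec_nonneg
      refine centerLoss_le_norm_centerGrad_sq (w t) W₀ hg.smooth hg.output hg.norm_center
        hg.spec_nonneg hg.spec hmlo.le hg.size_ge hlam.le hg.init_cond (le_trans ?_ hcond)
      gcongr
    · rw [hwt, show w t - η • (p - ξ) - W₀ = (w t - W₀) - η • p + η • ξ by module]
      refine (norm_add_le _ _).trans (add_le_add ((norm_sub_le _ _).trans (le_of_eq ?_)) ?_)
      · rw [norm_smul, Real.norm_of_nonneg hη.le]
      · rw [norm_smul, Real.norm_of_nonneg hη.le]; gcongr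
  have hfin := inexact_gradient_descent (Q := Q) (D := fun t => ‖w t - W₀‖) (R := 8 * R)
    (fun t => centerLoss_nonneg _ fun l => clusterSize_nonneg l)
    (fun t => norm_nonneg _) hX0 ha0 hη hηa (by simp [hw0]) hstep hQmax hRfin
  intro t ht
  obtain ⟨h1, h2⟩ := hfin t ht
  constructor
  · refine h1.trans (le_trans ?_ hRfin)
    gcongr
  · refine h2.trans ?_
    have h3 : Q 0 ≤ 289 * (Γ ^ 2 * n * lg) := hQ0.trans hRa.le
    gcongr

end GoodStart

end Clustered

/-! ### Sub-Gaussian random variables -/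

section SubGaussian

variable {Ω : Type*} {mΩ : MeasurableSpace Ω} {μ : Measure Ω}

lemma integral_exp_sq_div_four_gaussianReal :
    ∫ g, Real.exp (g ^ 2 / 4) ∂(gaussianReal 0 1) = √2 := by
  rw [integral_gaussianReal_eq_integral_smul one_ne_zero]
  have h : ∀ g : ℝ, gaussianPDFReal 0 1 g • Real.exp (g ^ 2 / 4)
      = (√(2 * Real.pi))⁻¹ * Real.exp (-(1 / 4) * g ^ 2) := by
    intro g
    simp only [gaussianPDFReal, NNReal.coe_one, mul_one, sub_zero, smul_eq_mul]
    rw [mul_assoc, ← Real.exp_add]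
    ring_nf
  simp_rw [h]
  rw [integral_const_mul, integral_gaussian, ← Real.sqrt_inv, ← Real.sqrt_mul (by positivity)]
  congr 1
  field_simp
  norm_num

lemma integrable_exp_sq_div_four_gaussianReal :
    Integrable (fun g : ℝ => Real.exp (g ^ 2 / 4)) (gaussianReal 0 1) := by
  by_contra h
  have := integral_exp_sq_div_four_gaussianReal
  rw [integral_undef h] at this
  exact absurd this.symm (by positivity)

/-- The square of a sub-Gaussian variable has an exponential moment. It is computed by writing
`exp (X² / 4c)` as the moment generating function, at `X / √(2c)`, of an independent Gaussian. -/
lemma exp_sq_of_hasSubgaussianMGF [SFinite μ] {X : Ω → ℝ} {c : NNReal} (hX : Measurable X)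
    (h : HasSubgaussianMGF X c μ) (hc : 0 < c) :
    Integrable (fun ω => Real.exp (X ω ^ 2 / (4 * c))) μ ∧
      ∫ ω, Real.exp (X ω ^ 2 / (4 * c)) ∂μ ≤ √2 := by
  set θ : ℝ := √(2 * c)⁻¹ with hθ
  have hθ2 : θ ^ 2 = (2 * c : ℝ)⁻¹ := Real.sq_sqrt (by positivity)
  have h1 : ∀ ω, ENNReal.ofReal (Real.exp (X ω ^ 2 / (4 * c)))
      = ∫⁻ g, ENNReal.ofReal (Real.exp (θ * X ω * g)) ∂(gaussianReal 0 1) := by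
    intro ω
    rw [← ofReal_integral_eq_lintegral_ofReal (integrable_exp_mul_gaussianReal _)
      (ae_of_all _ fun _ => (Real.exp_pos _).le)]
    congr 1
    have := congrFun (mgf_fun_id_gaussianReal (μ := 0) (v := 1)) (θ * X ω)
    rw [mgf] at this
    rw [this, mul_pow, hθ2]
    congr 1
    push_cast
    field_simp
    ring
  have h2 : ∫⁻ ω, ENNReal.ofReal (Real.exp (X ω ^ 2 / (4 * c))) ∂μ ≤ ENNReal.ofReal √2 := by
    simp_rw [h1]
    rw [lintegral_lintegral_swap]
    · rw [← integral_exp_sq_div_four_gaussianReal,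
        ofReal_integral_eq_lintegral_ofReal integrable_exp_sq_div_four_gaussianReal
          (ae_of_all _ fun _ => (Real.exp_pos _).le)]
      refine lintegral_mono fun g => ?_
      have h3 : ∀ ω, θ * X ω * g = θ * g * X ω := fun ω => by ring
      simp_rw [h3]
      rw [← ofReal_integral_eq_lintegral_ofReal (h.integrable_exp_mul _)
        (ae_of_all _ fun _ => (Real.exp_pos _).le)]
      refine ENNReal.ofReal_le_ofReal ((h.mgf_le _).trans (le_of_eq ?_))
      rw [mul_pow, hθ2]
      congr 1
      field_simp
      ring
    · refine (Measurable.ennreal_ofReal ?_).aemeasurable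
      exact Real.measurable_exp.comp (((hX.comp measurable_fst).const_mul θ).mul measurable_snd)
  have h3 : Integrable (fun ω => Real.exp (X ω ^ 2 / (4 * c))) μ := by
    refine ⟨(Real.measurable_exp.comp ((hX.pow_const 2).div_const _)).aestronglyMeasurable, ?_⟩
    rw [hasFiniteIntegral_iff_ofReal (ae_of_all _ fun _ => (Real.exp_pos _).le)]
    exact h2.trans_lt ENNReal.ofReal_lt_top
  refine ⟨h3, ?_⟩
  rw [← ofReal_integral_eq_lintegral_ofReal h3 (ae_of_all _ fun _ => (Real.exp_pos _).le)] at h2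
  exact (ENNReal.ofReal_le_ofReal_iff (Real.sqrt_nonneg _)).1 h2

lemma hasSubgaussianMGF_mono {X : Ω → ℝ} {c c' : NNReal} (h : HasSubgaussianMGF X c μ)
    (hc : c ≤ c') : HasSubgaussianMGF X c' μ where
  integrable_exp_mul := h.integrable_exp_mul
  mgf_le t := (h.mgf_le t).trans (by gcongr)

/-- Two-sided sub-Gaussian tail bound. -/
lemma measure_abs_ge_le_of_hasSubgaussianMGF [IsFiniteMeasure μ] {X : Ω → ℝ} {c : NNReal}
    (h : HasSubgaussianMGF X c μ) {t : ℝ} (ht : 0 ≤ t) :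
    μ {ω | t ≤ |X ω|} ≤ ENNReal.ofReal (2 * Real.exp (-t ^ 2 / (2 * c))) := by
  have h1 : {ω | t ≤ |X ω|} = {ω | t ≤ X ω} ∪ {ω | t ≤ (-X) ω} := by
    ext ω; simp [le_abs]
  have h2 : ∀ {Y : Ω → ℝ}, HasSubgaussianMGF Y c μ →
      μ {ω | t ≤ Y ω} ≤ ENNReal.ofReal (Real.exp (-t ^ 2 / (2 * c))) := by
    intro Y hY
    rw [← ofReal_measureReal]
    exact ENNReal.ofReal_le_ofReal (hY.measure_ge_le ht)
  rw [h1, two_mul, ENNReal.ofReal_add (Real.exp_pos _).le (Real.exp_pos _).le]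
  exact (measure_union_le _ _).trans (add_le_add (h2 h) (h2 h.neg))

/-- Markov's inequality for the exponential of an average, whose terms need not be independent. -/
lemma measure_avg_ge_le_of_exp {I : Type*} [Fintype I] [Nonempty I] {X : I → Ω → ℝ} {B : ℝ}
    (hint : ∀ i, Integrable (fun ω => Real.exp (X i ω)) μ)
    (hB : ∀ i, ∫ ω, Real.exp (X i ω) ∂μ ≤ B) (t : ℝ) :
    μ {ω | Fintype.card I * t ≤ ∑ i, X i ω} ≤ ENNReal.ofReal (B * Real.exp (-t)) := by
  have hN : (0 : ℝ) < Fintype.card I := by exact_mod_cast Fintype.card_pos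
  set N : ℝ := (Fintype.card I : ℝ) with hNdef
  set A : Ω → ℝ := fun ω => ∑ i, N⁻¹ * Real.exp (X i ω) with hA
  have hAint : Integrable A μ := integrable_finsetSum _ fun i _ => (hint i).const_mul _
  have hA0 : ∀ ω, 0 ≤ A ω := fun ω => Finset.sum_nonneg fun i _ => by positivity
  have hsub : {ω | N * t ≤ ∑ i, X i ω}
      ⊆ {ω | ENNReal.ofReal (Real.exp t) ≤ ENNReal.ofReal (A ω)} := by
    intro ω hω
    refine ENNReal.ofReal_le_ofReal ?_
    have h1 := convexOn_exp.map_sum_le (t := Finset.univ) (w := fun _ : I => N⁻¹)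
      (p := fun i => X i ω) (fun _ _ => by positivity)
      (by simp [← hNdef, hN.ne']) (fun _ _ => Set.mem_univ _)
    simp only [smul_eq_mul, ← Finset.mul_sum] at h1
    simp only [hA, ← Finset.mul_sum]
    refine le_trans (Real.exp_le_exp.2 ?_) h1
    rw [inv_mul_eq_div, le_div_iff₀ hN, mul_comm]
    exact hω
  refine (measure_mono hsub).trans ?_
  refine (meas_ge_le_lintegral_div hAint.aestronglyMeasurable.aemeasurable.ennreal_ofReal
    (by simp [Real.exp_pos]) ENNReal.ofReal_ne_top).trans ?_
  rw [← ofReal_integral_eq_lintegral_ofReal hAint (ae_of_all _ hA0),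
    ← ENNReal.ofReal_div_of_pos (Real.exp_pos _), Real.exp_neg, div_eq_mul_inv]
  refine ENNReal.ofReal_le_ofReal (mul_le_mul_of_nonneg_right ?_ (by positivity))
  simp only [hA]
  rw [integral_finsetSum _ fun i _ => (hint i).const_mul _]
  calc _ = ∑ i, N⁻¹ * ∫ ω, Real.exp (X i ω) ∂μ := by simp_rw [integral_const_mul]
    _ ≤ ∑ _i : I, N⁻¹ * B := Finset.sum_le_sum fun i _ => by gcongr; exact hB i
    _ = B := by
      rw [Finset.sum_const, nsmul_eq_mul, Finset.card_univ, ← hNdef, ← mul_assoc,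
        mul_inv_cancel₀ hN.ne', one_mul]

end SubGaussian

/-! ### Random networks with Gaussian weights -/

section Gaussian

variable {d k : ℕ}

/-- The law of a vector of independent standard Gaussians. -/
noncomputable abbrev gaussianRow (d : ℕ) : Measure (Fin d → ℝ) :=
  Measure.pi fun _ : Fin d => gaussianReal 0 1

instance : IsProbabilityMeasure (gaussianArray k d) := by
  unfold gaussianArray; infer_instance

/-- The linear form `g ↦ ⟪g, u⟫`. -/
noncomputable def rowInner (u : EuclideanSpace ℝ (Fin d)) (g : Fin d → ℝ) : ℝ :=
  inner ℝ (WithLp.toLp 2 g) u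

/-- A `k × d` array as a vector of rows. -/
noncomputable def arrayWeights (w : Fin k → Fin d → ℝ) :
    PiLp 2 fun _ : Fin k => EuclideanSpace ℝ (Fin d) :=
  WithLp.toLp 2 fun r => WithLp.toLp 2 (w r)

lemma rowInner_eq_sum (u : EuclideanSpace ℝ (Fin d)) (g : Fin d → ℝ) :
    rowInner u g = ∑ j, g j * u j := by
  simp [rowInner, PiLp.inner_apply, mul_comm]

lemma continuous_rowInner (u : EuclideanSpace ℝ (Fin d)) : Continuous (rowInner u) := by
  simp_rw [funext (rowInner_eq_sum u)]; fun_prop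

lemma rowInner_sub (u u' : EuclideanSpace ℝ (Fin d)) (g : Fin d → ℝ) :
    rowInner u g - rowInner u' g = rowInner (u - u') g := by
  simp [rowInner, inner_sub_right]

lemma exp_mul_rowInner (u : EuclideanSpace ℝ (Fin d)) (t : ℝ) (g : Fin d → ℝ) :
    Real.exp (t * rowInner u g) = ∏ j, Real.exp (t * u j * g j) := by
  rw [rowInner_eq_sum, Finset.mul_sum, Real.exp_sum]
  exact Finset.prod_congr rfl fun j _ => by ring_nf

lemma integrable_exp_mul_rowInner (u : EuclideanSpace ℝ (Fin d)) (t : ℝ) :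
    Integrable (fun g => Real.exp (t * rowInner u g)) (gaussianRow d) := by
  simp_rw [exp_mul_rowInner]
  exact Integrable.fintype_prod fun j => integrable_exp_mul_gaussianReal _

lemma integral_exp_mul_rowInner (u : EuclideanSpace ℝ (Fin d)) (t : ℝ) :
    ∫ g, Real.exp (t * rowInner u g) ∂(gaussianRow d) = Real.exp (t ^ 2 * ‖u‖ ^ 2 / 2) := by
  simp_rw [exp_mul_rowInner]
  rw [integral_fintype_prod_eq_prod (f := fun j x => Real.exp (t * u j * x))]
  have h : ∀ j, ∫ x, Real.exp (t * u j * x) ∂(gaussianReal 0 1)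
      = Real.exp (t ^ 2 * u j ^ 2 / 2) := by
    intro j
    have := congrFun (mgf_fun_id_gaussianReal (μ := 0) (v := 1)) (t * u j)
    rw [mgf] at this
    rw [this]
    congr 1
    push_cast
    ring
  simp_rw [h]
  rw [← Real.exp_sum, EuclideanSpace.norm_sq_eq, Finset.mul_sum, Finset.sum_div]
  simp

lemma hasSubgaussianMGF_rowInner {u : EuclideanSpace ℝ (Fin d)} {c : NNReal}
    (hu : ‖u‖ ^ 2 ≤ c) : HasSubgaussianMGF (rowInner u) c (gaussianRow d) where
  integrable_exp_mul := integrable_exp_mul_rowInner u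
  mgf_le t := by
    rw [mgf, integral_exp_mul_rowInner]
    have : t ^ 2 * ‖u‖ ^ 2 ≤ t ^ 2 * c := by gcongr
    exact Real.exp_le_exp.2 (by linarith)

/-- For a function `Y` of a Gaussian row which is dominated by a linear form, the product
`E[exp (sY)] E[exp (-sY)]` does not see the mean of `Y`; it is bounded by `(E[cosh (sY)])²`. -/
lemma mgf_mul_mgf_neg_le {Y : (Fin d → ℝ) → ℝ} {Γ : ℝ} {u : EuclideanSpace ℝ (Fin d)}
    (hYm : Measurable Y) (hY : ∀ g, |Y g| ≤ Γ * |rowInner u g|) (s : ℝ) :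
    Integrable (fun g => Real.exp (s * Y g)) (gaussianRow d) ∧
    (∫ g, Real.exp (s * Y g) ∂(gaussianRow d)) * (∫ g, Real.exp (-s * Y g) ∂(gaussianRow d))
      ≤ Real.exp (s ^ 2 * (Γ ^ 2 * ‖u‖ ^ 2)) := by
  have hsY : ∀ s g, |s * Y g| ≤ |s * Γ * rowInner u g| := by
    intro s g
    rw [abs_mul, mul_assoc, abs_mul s, abs_mul Γ]
    gcongr
    exact (hY g).trans (by gcongr; exact le_abs_self _)
  have hdom : Integrable (fun g => Real.exp (s * Γ * rowInner u g)
      + Real.exp (-(s * Γ) * rowInner u g)) (gaussianRow d) :=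
    (integrable_exp_mul_rowInner u _).add (integrable_exp_mul_rowInner u _)
  have hsum : ∀ s' : ℝ, (s' = s ∨ s' = -s) → ∀ g, Real.exp (s' * Y g) + Real.exp (-s' * Y g)
      ≤ Real.exp (s * Γ * rowInner u g) + Real.exp (-(s * Γ) * rowInner u g) := by
    intro s' hs' g
    have h1 : Real.cosh (s' * Y g) ≤ Real.cosh (s * Γ * rowInner u g) := by
      rw [Real.cosh_le_cosh]
      rcases hs' with rfl | rfl
      · exact hsY _ g
      · rw [neg_mul, abs_neg]; exact hsY _ g
    rw [Real.cosh_eq, Real.cosh_eq] at h1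
    simp only [neg_mul] at h1 ⊢
    linarith
  have hint : ∀ s' : ℝ, (s' = s ∨ s' = -s) →
      Integrable (fun g => Real.exp (s' * Y g)) (gaussianRow d) := by
    intro s' hs'
    refine hdom.mono' (Real.measurable_exp.comp (hYm.const_mul s')).aestronglyMeasurable
      (ae_of_all _ fun g => ?_)
    rw [Real.norm_of_nonneg (Real.exp_pos _).le]
    linarith [hsum s' hs' g, Real.exp_pos (-s' * Y g)]
  refine ⟨hint s (Or.inl rfl), ?_⟩
  set a := ∫ g, Real.exp (s * Y g) ∂(gaussianRow d) with ha
  set b := ∫ g, Real.exp (-s * Y g) ∂(gaussianRow d) with hb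
  have hab : a + b ≤ 2 * Real.exp (s ^ 2 * (Γ ^ 2 * ‖u‖ ^ 2) / 2) := by
    rw [ha, hb, ← integral_add (hint s (Or.inl rfl)) (hint (-s) (Or.inr rfl))]
    refine (integral_mono ((hint s (Or.inl rfl)).add (hint (-s) (Or.inr rfl))) hdom
      fun g => hsum s (Or.inl rfl) g).trans (le_of_eq ?_)
    rw [integral_add (integrable_exp_mul_rowInner u _) (integrable_exp_mul_rowInner u _),
      integral_exp_mul_rowInner, integral_exp_mul_rowInner]
    ring_nf
  have ha0 : 0 ≤ a := integral_nonneg fun _ => (Real.exp_pos _).le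
  have hb0 : 0 ≤ b := integral_nonneg fun _ => (Real.exp_pos _).le
  have h2 : Real.exp (s ^ 2 * (Γ ^ 2 * ‖u‖ ^ 2))
      = Real.exp (s ^ 2 * (Γ ^ 2 * ‖u‖ ^ 2) / 2) ^ 2 := by
    rw [← Real.exp_nat_mul]; congr 1; push_cast; ring
  rw [h2]
  nlinarith [sq_nonneg (a - b)]

namespace IsOutputWeight

variable {v : Fin k → ℝ}

/-- Products over the output weights: `k / 2` factors for each sign. -/
lemma prod_eq (hv : IsOutputWeight v) (hk : 0 < k) {M : Type*} [CommMonoid M] (g : ℝ → M) :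
    ∏ r, g (v r) = g (1 / √(k : ℝ)) ^ (k / 2) * g (-(1 / √(k : ℝ))) ^ (k / 2) * g 0 ^ (k % 2) := by
  set κ : ℝ := 1 / √(k : ℝ) with hκ
  have hκ0 : 0 < κ := by positivity
  have hc : ∀ a : ℝ, ∏ r with v r = a, g (v r)
      = g a ^ (Finset.univ.filter fun r => v r = a).card := by
    intro a
    rw [← Finset.prod_const]
    exact Finset.prod_congr rfl fun r hr => by rw [(Finset.mem_filter.1 hr).2]
  have hd1 : Disjoint (Finset.univ.filter fun r => v r = κ)
      (Finset.univ.filter fun r => v r = -κ) := by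
    rw [Finset.disjoint_filter]; intro r _ h1 h2; linarith
  have hd2 : Disjoint ((Finset.univ.filter fun r => v r = κ) ∪
      (Finset.univ.filter fun r => v r = -κ)) (Finset.univ.filter fun r => v r = 0) := by
    rw [Finset.disjoint_union_left, Finset.disjoint_filter, Finset.disjoint_filter]
    constructor <;> intro r _ h1 h2 <;> linarith
  have huniv : ((Finset.univ.filter fun r => v r = κ) ∪ (Finset.univ.filter fun r => v r = -κ))
      ∪ (Finset.univ.filter fun r => v r = 0) = Finset.univ := by
    rw [← Finset.card_eq_iff_eq_univ, Finset.card_union_of_disjoint hd2,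
      Finset.card_union_of_disjoint hd1, hv.pos, hv.neg, hv.zero, Fintype.card_fin]
    omega
  rw [← huniv, Finset.prod_union hd2, Finset.prod_union hd1, hc, hc, hc, hv.pos, hv.neg, hv.zero]

lemma sum_eq (hv : IsOutputWeight v) (hk : 0 < k) (g : ℝ → ℝ) :
    ∑ r, g (v r) = (k / 2 : ℕ) * g (1 / √(k : ℝ)) + (k / 2 : ℕ) * g (-(1 / √(k : ℝ)))
      + (k % 2 : ℕ) * g 0 := by
  have := hv.prod_eq hk fun x => Multiplicative.ofAdd (g x)
  rw [← ofAdd_sum] at this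
  have h := congrArg Multiplicative.toAdd this
  simpa using h

lemma sum_eq_zero (hv : IsOutputWeight v) (hk : 0 < k) : ∑ r, v r = 0 := by
  rw [hv.sum_eq hk fun x => x]; ring

lemma sum_sq_eq (hv : IsOutputWeight v) (hk : 0 < k) :
    ∑ r, v r ^ 2 = 2 * (k / 2 : ℕ) / k := by
  have : (0 : ℝ) < k := by exact_mod_cast hk
  rw [hv.sum_eq hk fun x => x ^ 2, neg_sq, div_pow, Real.sq_sqrt this.le]
  ring

lemma outputBound (hv : IsOutputWeight v) (hk : 0 < k) : OutputBound v (1 / √(k : ℝ)) where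
  nonneg := by positivity
  abs_le := by
    have h := hv.sum_eq hk fun x => if |x| ≤ 1 / √(k : ℝ) then 0 else 1
    have hκ : (0 : ℝ) ≤ 1 / √(k : ℝ) := by positivity
    rw [if_pos (by rw [abs_of_nonneg hκ]), if_pos (by rw [abs_neg, abs_of_nonneg hκ]),
      if_pos (by simp)] at h
    simp only [mul_zero, add_zero] at h
    rw [Finset.sum_eq_zero_iff_of_nonneg (fun r _ => by split_ifs <;> norm_num)] at h
    intro r
    by_contra hr
    have := h r (Finset.mem_univ r)
    rw [if_neg hr] at this
    exact one_ne_zero this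
  sum_sq_le := by
    have hk' : (0 : ℝ) < k := by exact_mod_cast hk
    rw [hv.sum_sq_eq hk, div_le_one hk']
    exact_mod_cast (by omega : 2 * (k / 2) ≤ k)

lemma half_le_sum_sq (hv : IsOutputWeight v) (hk : 2 ≤ k) : 1 / 2 ≤ ∑ r, v r ^ 2 := by
  have hk' : (0 : ℝ) < k := by exact_mod_cast (by omega : 0 < k)
  rw [hv.sum_sq_eq (by omega), le_div_iff₀ hk']
  have : (k : ℝ) ≤ 4 * (k / 2 : ℕ) := by exact_mod_cast (by omega : k ≤ 4 * (k / 2))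
  linarith

end IsOutputWeight

/-- Weighted sums of a function of the rows which is dominated by a linear form are sub-Gaussian:
the means cancel because the output weights come in opposite pairs. -/
theorem hasSubgaussianMGF_sum_output {v : Fin k → ℝ} (hv : IsOutputWeight v) (hk : 0 < k)
    {Y : (Fin d → ℝ) → ℝ} {Γ : ℝ} {u : EuclideanSpace ℝ (Fin d)} (hYm : Measurable Y)
    (hY : ∀ g, |Y g| ≤ Γ * |rowInner u g|) {c : NNReal} (hc : Γ ^ 2 * ‖u‖ ^ 2 ≤ c) :
    HasSubgaussianMGF (fun w : Fin k → Fin d → ℝ => ∑ r, v r * Y (w r)) c (gaussianArray k d) := by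
  have hexp : ∀ (t : ℝ) (w : Fin k → Fin d → ℝ), Real.exp (t * ∑ r, v r * Y (w r))
      = ∏ r, Real.exp (t * v r * Y (w r)) := by
    intro t w
    rw [Finset.mul_sum, Real.exp_sum]
    exact Finset.prod_congr rfl fun r _ => by ring_nf
  have hk' : (0 : ℝ) < k := by exact_mod_cast hk
  constructor
  · intro t
    simp_rw [hexp]
    exact Integrable.fintype_prod (f := fun r g => Real.exp (t * v r * Y g))
      fun r => (mgf_mul_mgf_neg_le hYm hY _).1
  · intro t
    rw [mgf]
    simp_rw [hexp]
    rw [gaussianArray, integral_fintype_prod_eq_prod (f := fun r g => Real.exp (t * v r * Y g)),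
      hv.prod_eq hk fun a => ∫ g, Real.exp (t * a * Y g) ∂(gaussianRow d), ← mul_pow]
    have h0 : ∫ g, Real.exp (t * 0 * Y g) ∂(gaussianRow d) = 1 := by simp
    have h1 := (mgf_mul_mgf_neg_le hYm hY (t * (1 / √(k : ℝ)))).2
    rw [h0, one_pow, mul_one, mul_neg]
    refine (pow_le_pow_left₀ ?_ h1 _).trans ?_
    · exact mul_nonneg (integral_nonneg fun _ => (Real.exp_pos _).le)
        (integral_nonneg fun _ => (Real.exp_pos _).le)
    · rw [← Real.exp_nat_mul, Real.exp_le_exp, mul_pow, div_pow, Real.sq_sqrt hk'.le]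
      have h2 : ((k / 2 : ℕ) : ℝ) ≤ k / 2 := Nat.cast_div_le
      calc _ ≤ (k / 2 : ℝ) * (t ^ 2 * (1 ^ 2 / k) * (Γ ^ 2 * ‖u‖ ^ 2)) := by gcongr
        _ = t ^ 2 * (Γ ^ 2 * ‖u‖ ^ 2) / 2 := by field_simp
        _ ≤ t ^ 2 * c / 2 := by gcongr
        _ = _ := by ring

variable {φ : ℝ → ℝ} {Γ : ℝ} {v : Fin k → ℝ}

lemma net_arrayWeights (w : Fin k → Fin d → ℝ) (z : EuclideanSpace ℝ (Fin d)) :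
    net φ v (arrayWeights w) z = ∑ r, v r * φ (rowInner z (w r)) := rfl

/-- The output at a point is sub-Gaussian. -/
lemma hasSubgaussianMGF_net (hv : IsOutputWeight v) (hk : 0 < k) (hφ : SmoothActivation φ Γ)
    {z : EuclideanSpace ℝ (Fin d)} {c : NNReal} (hc : Γ ^ 2 * ‖z‖ ^ 2 ≤ c) :
    HasSubgaussianMGF (fun w => net φ v (arrayWeights w) z) c (gaussianArray k d) := by
  have h := hasSubgaussianMGF_sum_output hv hk (Y := fun g => φ (rowInner z g) - φ 0)
    ((hφ.diff.continuous.comp (continuous_rowInner z)).sub continuous_const).measurable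
    (fun g => by simpa using hφ.abs_sub_le (rowInner z g) 0) hc
  convert h using 2 with w
  simp only [mul_sub, Finset.sum_sub_distrib, ← Finset.sum_mul, hv.sum_eq_zero hk, zero_mul,
    sub_zero]
  rfl

/-- The increments of the random network are sub-Gaussian. -/
lemma hasSubgaussianMGF_net_sub (hv : IsOutputWeight v) (hk : 0 < k) (hφ : SmoothActivation φ Γ)
    {z z' : EuclideanSpace ℝ (Fin d)} {c : NNReal} (hc : Γ ^ 2 * ‖z - z'‖ ^ 2 ≤ c) :
    HasSubgaussianMGF (fun w => net φ v (arrayWeights w) z - net φ v (arrayWeights w) z') c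
      (gaussianArray k d) := by
  have h := hasSubgaussianMGF_sum_output hv hk
    (Y := fun g => φ (rowInner z g) - φ (rowInner z' g))
    ((hφ.diff.continuous.comp (continuous_rowInner z)).sub
      (hφ.diff.continuous.comp (continuous_rowInner z'))).measurable
    (fun g => by rw [← rowInner_sub]; exact hφ.abs_sub_le _ _) hc
  convert h using 2 with w
  simp only [mul_sub, Finset.sum_sub_distrib]
  rfl

/-- Exponential moment of the squared pre-activations at a vector of norm at most `σ`. -/
lemma exp_norm_preact_sq {u : EuclideanSpace ℝ (Fin d)} {σ : ℝ} (hσ : 0 < σ) (hu : ‖u‖ ≤ σ) :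
    Integrable (fun w => Real.exp (‖preact (arrayWeights w) u‖ ^ 2 / (4 * σ ^ 2)))
        (gaussianArray k d) ∧
      ∫ w, Real.exp (‖preact (arrayWeights w) u‖ ^ 2 / (4 * σ ^ 2)) ∂(gaussianArray k d)
        ≤ √2 ^ k := by
  have e : ∀ w : Fin k → Fin d → ℝ, Real.exp (‖preact (arrayWeights w) u‖ ^ 2 / (4 * σ ^ 2))
      = ∏ r, Real.exp (rowInner u (w r) ^ 2 / (4 * σ ^ 2)) := by
    intro w
    rw [norm_preact_sq, Finset.sum_div, Real.exp_sum]
    rfl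
  have h := exp_sq_of_hasSubgaussianMGF (continuous_rowInner u).measurable
    (hasSubgaussianMGF_rowInner (u := u) (c := ⟨σ ^ 2, sq_nonneg σ⟩)
      (by change ‖u‖ ^ 2 ≤ σ ^ 2; gcongr))
    (by change (0 : ℝ) < σ ^ 2; positivity)
  change Integrable (fun g => Real.exp (rowInner u g ^ 2 / (4 * σ ^ 2))) _ ∧
    ∫ g, Real.exp (rowInner u g ^ 2 / (4 * σ ^ 2)) ∂_ ≤ √2 at h
  simp_rw [e]
  refine ⟨Integrable.fintype_prod fun r => h.1, ?_⟩
  rw [gaussianArray, integral_fintype_prod_eq_prod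
    (f := fun r g => Real.exp (rowInner u g ^ 2 / (4 * σ ^ 2))), Finset.prod_const,
    Finset.card_univ, Fintype.card_fin]
  exact pow_le_pow_left₀ (integral_nonneg fun _ => (Real.exp_pos _).le) h.2 _

end Gaussian

/-! ### Nets and chaining in the unit ball -/

section Nets

variable {E : Type*} [NormedAddCommGroup E] [NormedSpace ℝ E]

variable (E) in
/-- The unit ball of a `d`-dimensional space has a `1/2`-net of at most `5 ^ d` points: half of a
maximal `1`-separated subset of the ball of radius two. -/
lemma exists_half_net [FiniteDimensional ℝ E] :
    ∃ N : Finset E, N.card ≤ 5 ^ Module.finrank ℝ E ∧ (∀ u ∈ N, ‖u‖ ≤ 1) ∧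
    ∀ z : E, ‖z‖ ≤ 1 → ∃ u ∈ N, ‖z - u‖ ≤ 1 / 2 := by
  classical
  set P : ℕ → Prop := fun m => ∃ s : Finset E, s.card = m ∧ (∀ c ∈ s, ‖c‖ ≤ 2) ∧
    ∀ c ∈ s, ∀ e ∈ s, c ≠ e → 1 ≤ ‖c - e‖ with hP
  have hP0 : P 0 := ⟨∅, by simp⟩
  obtain ⟨s, hcard, hs2, hsep⟩ := Nat.findGreatest_spec (P := P)
    (Nat.zero_le (5 ^ Module.finrank ℝ E)) hP0
  refine ⟨s.image fun c => (1 / 2 : ℝ) • c, Finset.card_image_le.trans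
    (Besicovitch.card_le_of_separated s hs2 hsep), ?_, ?_⟩
  · intro u hu
    obtain ⟨c, hc, rfl⟩ := Finset.mem_image.1 hu
    rw [norm_smul, Real.norm_of_nonneg (by norm_num)]
    linarith [hs2 c hc]
  · intro z hz
    by_contra! h
    have hfar : ∀ c ∈ s, 1 ≤ ‖(2 : ℝ) • z - c‖ := by
      intro c hc
      have h1 := h _ (Finset.mem_image_of_mem _ hc)
      have h2 : (2 : ℝ) • z - c = (2 : ℝ) • (z - (1 / 2 : ℝ) • c) := by
        rw [smul_sub, smul_smul]; norm_num
      rw [h2, norm_smul, Real.norm_of_nonneg (by norm_num)]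
      linarith
    have hnot : (2 : ℝ) • z ∉ s := fun hmem => by
      have := hfar _ hmem
      simp at this
      linarith
    have hP1 : P (s.card + 1) := by
      refine ⟨insert ((2 : ℝ) • z) s, Finset.card_insert_of_notMem hnot, ?_, ?_⟩
      · intro c hc
        rcases Finset.mem_insert.1 hc with rfl | hc
        · rw [norm_smul, Real.norm_of_nonneg (by norm_num)]; linarith
        · exact hs2 c hc
      · intro c hc e he hce
        rcases Finset.mem_insert.1 hc with rfl | hc <;> rcases Finset.mem_insert.1 he with rfl | he
        · exact absurd rfl hce
        · exact hfar e he
        · rw [norm_sub_rev]; exact hfar c hc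
        · exact hsep c hc e he hce
    obtain ⟨s', hs'card, hs'2, hs'sep⟩ := hP1
    have hle : s.card + 1 ≤ 5 ^ Module.finrank ℝ E := by
      rw [← hs'card]; exact Besicovitch.card_le_of_separated s' hs'2 hs'sep
    have := Nat.le_findGreatest (P := P) hle ⟨s', hs'card, hs'2, hs'sep⟩
    omega

/-- A point of the unit ball is the limit of a chain whose `m`-th link is `2⁻ᵐ` times a point of
the net. -/
lemma exists_chain {N : Finset E} (hN : ∀ z : E, ‖z‖ ≤ 1 → ∃ u ∈ N, ‖z - u‖ ≤ 1 / 2)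
    {z : E} (hz : ‖z‖ ≤ 1) :
    ∃ s u : ℕ → E, s 0 = 0 ∧ (∀ m, u m ∈ N) ∧ (∀ m, s (m + 1) = s m + (1 / 2 : ℝ) ^ m • u m) ∧
      ∀ m, ‖z - s m‖ ≤ (1 / 2 : ℝ) ^ m := by
  choose! g hgN hg using hN
  -- the rescaled remainder after `m` links
  set ρ : ℕ → E := fun m => (fun y => (2 : ℝ) • (y - g y))^[m] z with hρ
  have hρs : ∀ m, ρ (m + 1) = (2 : ℝ) • (ρ m - g (ρ m)) := fun m =>
    Function.iterate_succ_apply' _ _ _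
  have hρ1 : ∀ m, ‖ρ m‖ ≤ 1 := by
    intro m
    induction m with
    | zero => exact hz
    | succ m ih =>
      rw [hρs, norm_smul, Real.norm_of_nonneg (by norm_num)]
      linarith [hg _ ih]
  refine ⟨fun m => z - (1 / 2 : ℝ) ^ m • ρ m, fun m => g (ρ m), ?_, fun m => hgN _ (hρ1 m), ?_, ?_⟩
  · simp [hρ]
  · intro m
    simp only
    rw [hρs, smul_smul, pow_succ, mul_assoc]
    norm_num
    module
  · intro m
    simp only [sub_sub_cancel]
    rw [norm_smul, Real.norm_of_nonneg (by positivity)]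
    exact mul_le_of_le_one_right (by positivity) (hρ1 m)

open scoped Classical in
/-- The possible `m`-th points of the chains over a net. -/
noncomputable def chainPoints (N : Finset E) : ℕ → Finset E
  | 0 => {0}
  | m + 1 => (chainPoints N m ×ˢ N).image fun p => p.1 + (1 / 2 : ℝ) ^ m • p.2

lemma card_chainPoints_le (N : Finset E) (m : ℕ) : (chainPoints N m).card ≤ N.card ^ m := by
  classical
  induction m with
  | zero => simp [chainPoints]
  | succ m ih =>
    rw [chainPoints, pow_succ]
    refine Finset.card_image_le.trans ?_
    rw [Finset.card_product]
    gcongr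

lemma chain_mem_chainPoints {N : Finset E} {s u : ℕ → E} (h0 : s 0 = 0) (hu : ∀ m, u m ∈ N)
    (hs : ∀ m, s (m + 1) = s m + (1 / 2 : ℝ) ^ m • u m) (m : ℕ) : s m ∈ chainPoints N m := by
  classical
  induction m with
  | zero => simp [chainPoints, h0]
  | succ m ih =>
    rw [chainPoints, Finset.mem_image]
    exact ⟨(s m, u m), Finset.mk_mem_product ih (hu m), (hs m).symm⟩

lemma tendsto_chain {E : Type*} [NormedAddCommGroup E] {s : ℕ → E} {z : E}
    (h : ∀ m, ‖z - s m‖ ≤ (1 / 2 : ℝ) ^ m) :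
    Filter.Tendsto s Filter.atTop (nhds z) := by
  rw [tendsto_iff_norm_sub_tendsto_zero]
  refine squeeze_zero (fun m => norm_nonneg _) (fun m => ?_)
    (tendsto_pow_atTop_nhds_zero_of_lt_one (by norm_num : (0 : ℝ) ≤ 1 / 2) (by norm_num))
  rw [norm_sub_rev]; exact h m

end Nets

/-- The norm of the pre-activations is controlled on the unit ball by its values on a net. -/
lemma norm_preact_le_of_net {k : ℕ} {E : Type*} [NormedAddCommGroup E] [InnerProductSpace ℝ E]
    {N : Finset E} (hN : ∀ z : E, ‖z‖ ≤ 1 → ∃ u ∈ N, ‖z - u‖ ≤ 1 / 2)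
    {W : PiLp 2 fun _ : Fin k => E} {B : ℝ} (hB : ∀ u ∈ N, ‖preact W u‖ ≤ B) (z : E) :
    ‖preact W z‖ ≤ 2 * B * ‖z‖ := by
  have key : ∀ z : E, ‖z‖ ≤ 1 → ‖preact W z‖ ≤ 2 * B := by
    intro z hz
    obtain ⟨s, u, h0, hu, hs, hlim⟩ := exists_chain hN hz
    have h1 : ∀ m, ‖preact W (s m)‖ ≤ 2 * B * (1 - (1 / 2 : ℝ) ^ m) := by
      intro m
      induction m with
      | zero => simp [h0, preact, EuclideanSpace.norm_eq]
      | succ m ih =>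
        rw [hs, preact_add_right, preact_smul_right]
        refine (norm_add_le _ _).trans ?_
        rw [norm_smul, Real.norm_of_nonneg (by positivity)]
        have := mul_le_mul_of_nonneg_left (hB _ (hu m))
          (by positivity : (0 : ℝ) ≤ (1 / 2) ^ m)
        rw [pow_succ]
        linarith
    have hB0 : 0 ≤ B := (norm_nonneg _).trans (hB _ (hu 0))
    have h2 : ∀ m, ‖preact W z‖ ≤ 2 * B + ‖W‖ * (1 / 2 : ℝ) ^ m := by
      intro m
      have h3 : preact W z = preact W (s m) + preact W (z - s m) := by
        rw [← preact_add_right, add_sub_cancel]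
      rw [h3]
      refine (norm_add_le _ _).trans (add_le_add ((h1 m).trans ?_) ((norm_preact_le _ _).trans ?_))
      · have : (0 : ℝ) ≤ (1 / 2) ^ m := by positivity
        nlinarith
      · gcongr
        exact hlim m
    refine ge_of_tendsto' (x := Filter.atTop) ?_ h2
    have := (tendsto_pow_atTop_nhds_zero_of_lt_one (by norm_num : (0 : ℝ) ≤ 1 / 2)
      (by norm_num)).const_mul ‖W‖
    simpa using this.const_add (2 * B)
  by_cases hz : z = 0
  · subst hz; simp [preact, EuclideanSpace.norm_eq]
  · have hz' : 0 < ‖z‖ := norm_pos_iff.2 hz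
    have h1 := key (‖z‖⁻¹ • z) (by rw [norm_smul, norm_inv, norm_norm, inv_mul_cancel₀ hz'.ne'])
    rw [preact_smul_right, norm_smul, norm_inv, norm_norm, inv_mul_le_iff₀ hz'] at h1
    linarith

/-! ### Events of high probability at initialization -/

section Events

variable {d k K : ℕ} {φ : ℝ → ℝ} {Γ : ℝ} {v : Fin k → ℝ} {I : Type*} [Fintype I]

lemma exp_neg_bound_of_sqrt_two (k : ℕ) : √2 ^ k * Real.exp (-(9 / 4 * k)) ≤ Real.exp (-k) := by
  have h1 : √2 ≤ Real.exp 1 := by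
    have h2 : √2 ≤ 2 := by rw [Real.sqrt_le_left (by norm_num)]; norm_num
    linarith [Real.add_one_le_exp 1]
  calc _ ≤ Real.exp 1 ^ k * Real.exp (-(9 / 4 * k)) := by gcongr
    _ = Real.exp (k * 1 + -(9 / 4 * k)) := by rw [← Real.exp_nat_mul, Real.exp_add]
    _ ≤ _ := Real.exp_le_exp.2 (by have : (0 : ℝ) ≤ k := Nat.cast_nonneg k; linarith)

/-- The outputs at the centers are of order `√(log K)`. -/
lemma measure_init_output (hv : IsOutputWeight v) (hk : 0 < k) (hφ : SmoothActivation φ Γ)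
    (hΓ : 0 < Γ) {ι : Type*} [Fintype ι] (c : ι → EuclideanSpace ℝ (Fin d)) (hc : ∀ l, ‖c l‖ ≤ 1)
    {lg : ℝ} (hlg : 0 ≤ lg) :
    gaussianArray k d {w | ¬ ∀ l, |net φ v (arrayWeights w) (c l)| ≤ 15 * Γ * √lg}
      ≤ ENNReal.ofReal (Fintype.card ι * (2 * Real.exp (-(112 * lg)))) := by
  have h1 : {w : Fin k → Fin d → ℝ | ¬ ∀ l, |net φ v (arrayWeights w) (c l)| ≤ 15 * Γ * √lg}
      ⊆ ⋃ l, {w | 15 * Γ * √lg ≤ |net φ v (arrayWeights w) (c l)|} := by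
    intro w hw
    simp only [Set.mem_ofPred_eq, not_forall, not_le, Set.mem_iUnion] at hw ⊢
    obtain ⟨l, hl⟩ := hw
    exact ⟨l, hl.le⟩
  refine (measure_mono h1).trans ((measure_iUnion_fintype_le _ _).trans ?_)
  rw [ENNReal.ofReal_mul (Nat.cast_nonneg _), ENNReal.ofReal_natCast]
  have h2 : ∀ l, gaussianArray k d {w | 15 * Γ * √lg ≤ |net φ v (arrayWeights w) (c l)|}
      ≤ ENNReal.ofReal (2 * Real.exp (-(112 * lg))) := by
    intro l
    have h3 := hasSubgaussianMGF_net hv hk hφ (z := c l) (c := ⟨Γ ^ 2, sq_nonneg Γ⟩) (by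
      change Γ ^ 2 * ‖c l‖ ^ 2 ≤ Γ ^ 2
      exact mul_le_of_le_one_right (sq_nonneg _) (pow_le_one₀ (norm_nonneg _) (hc l)))
    refine (measure_abs_ge_le_of_hasSubgaussianMGF h3 (by positivity)).trans ?_
    refine ENNReal.ofReal_le_ofReal ?_
    gcongr
    change -(15 * Γ * √lg) ^ 2 / (2 * Γ ^ 2) ≤ -(112 * lg)
    rw [mul_pow, mul_pow, Real.sq_sqrt hlg, div_le_iff₀ (by positivity)]
    nlinarith [mul_nonneg (sq_nonneg Γ) hlg]
  refine (Finset.sum_le_sum fun l _ => h2 l).trans ?_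
  simp

/-- The outputs at the inputs are close, in mean square, to those at the centers. -/
lemma measure_init_diff [Nonempty I] (hv : IsOutputWeight v) (hk : 0 < k)
    (hφ : SmoothActivation φ Γ) (hΓ : 0 < Γ) (x c : I → EuclideanSpace ℝ (Fin d)) {ε : ℝ}
    (hε : 0 < ε) (hxc : ∀ i, ‖x i - c i‖ ≤ ε) {lg : ℝ} (hlg : 0 ≤ lg) :
    gaussianArray k d {w | ¬ ∑ i, (net φ v (arrayWeights w) (x i)
        - net φ v (arrayWeights w) (c i)) ^ 2 ≤ 441 * (Fintype.card I * Γ ^ 2 * ε ^ 2 * lg)}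
      ≤ ENNReal.ofReal (2 * Real.exp (-(110 * lg))) := by
  have hcont : ∀ z : EuclideanSpace ℝ (Fin d),
      Measurable fun w : Fin k → Fin d → ℝ => net φ v (arrayWeights w) z := by
    intro z
    refine Continuous.measurable ?_
    simp_rw [net_arrayWeights]
    have h1 := hφ.diff.continuous
    have h2 := continuous_rowInner z
    fun_prop
  have h1 := fun i => exp_sq_of_hasSubgaussianMGF ((hcont (x i)).sub (hcont (c i)))
    (hasSubgaussianMGF_net_sub hv hk hφ (z := x i) (z' := c i)
      (c := ⟨(Γ * ε) ^ 2, sq_nonneg _⟩) (by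
        change Γ ^ 2 * ‖x i - c i‖ ^ 2 ≤ (Γ * ε) ^ 2
        rw [mul_pow]
        gcongr
        exact hxc i))
    (by change (0 : ℝ) < (Γ * ε) ^ 2; positivity)
  change ∀ i, Integrable (fun w => Real.exp ((net φ v (arrayWeights w) (x i)
    - net φ v (arrayWeights w) (c i)) ^ 2 / (4 * (Γ * ε) ^ 2))) _ ∧
    ∫ w, Real.exp ((net φ v (arrayWeights w) (x i)
    - net φ v (arrayWeights w) (c i)) ^ 2 / (4 * (Γ * ε) ^ 2)) ∂_ ≤ √2 at h1
  refine le_trans (measure_mono ?_) ((measure_avg_ge_le_of_exp (fun i => (h1 i).1)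
    (fun i => (h1 i).2) (441 / 4 * lg)).trans (ENNReal.ofReal_le_ofReal ?_))
  · intro w hw
    simp only [Set.mem_ofPred_eq, not_le] at hw ⊢
    rw [← Finset.sum_div, le_div_iff₀ (by positivity)]
    refine le_trans (le_of_eq ?_) hw.le
    ring
  · have h2 : √2 ≤ 2 := by rw [Real.sqrt_le_left (by norm_num)]; norm_num
    gcongr
    linarith

/-- The pre-activations at the deviations from the centers have the expected size, in mean
square. -/
lemma measure_init_preact [Nonempty I] (u : I → EuclideanSpace ℝ (Fin d)) {ε : ℝ}
    (hε : 0 < ε) (hu : ∀ i, ‖u i‖ ≤ ε) :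
    gaussianArray k d {w | ¬ ∑ i, ‖preact (arrayWeights w) (u i)‖ ^ 2
        ≤ 9 * (Fintype.card I * k * ε ^ 2)}
      ≤ ENNReal.ofReal (Real.exp (-k)) := by
  refine le_trans (measure_mono ?_) ((measure_avg_ge_le_of_exp
    (fun i => (exp_norm_preact_sq hε (hu i)).1) (fun i => (exp_norm_preact_sq hε (hu i)).2)
    (9 / 4 * k)).trans (ENNReal.ofReal_le_ofReal (exp_neg_bound_of_sqrt_two k)))
  intro w hw
  simp only [Set.mem_ofPred_eq, not_le] at hw ⊢
  rw [← Finset.sum_div, le_div_iff₀ (by positivity)]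
  refine le_trans (le_of_eq ?_) hw.le
  ring

/-- The operator norm of the initial weights is of order `√k + √d`. -/
lemma measure_init_opNorm :
    gaussianArray k d {w | ¬ ∀ u : EuclideanSpace ℝ (Fin d),
        ‖preact (arrayWeights w) u‖ ≤ 6 * (√k + √d) * ‖u‖}
      ≤ ENNReal.ofReal (Real.exp (-k)) := by
  obtain ⟨N, hcard, hN1, hN⟩ := exists_half_net (EuclideanSpace ℝ (Fin d))
  rw [finrank_euclideanSpace_fin] at hcard
  have h1 : {w : Fin k → Fin d → ℝ | ¬ ∀ u : EuclideanSpace ℝ (Fin d),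
        ‖preact (arrayWeights w) u‖ ≤ 6 * (√k + √d) * ‖u‖}
      ⊆ ⋃ u ∈ N, {w | 9 / 4 * ((k : ℝ) + d) ≤ ‖preact (arrayWeights w) u‖ ^ 2 / (4 * 1 ^ 2)} := by
    intro w hw
    by_contra hnot
    apply hw
    have h2 : ∀ u ∈ N, ‖preact (arrayWeights w) u‖ ≤ 3 * (√k + √d) := by
      intro u hu
      simp only [Set.mem_iUnion, Set.mem_ofPred_eq, not_exists, not_le] at hnot
      have h3 := hnot u hu
      apply le_of_sq_le_sq _ (by positivity)
      have h4 := Real.sq_sqrt (Nat.cast_nonneg (α := ℝ) k)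
      have h5 := Real.sq_sqrt (Nat.cast_nonneg (α := ℝ) d)
      have h6 : 0 ≤ √(k : ℝ) * √(d : ℝ) := by positivity
      nlinarith
    intro u
    refine (norm_preact_le_of_net hN h2 u).trans (le_of_eq (by ring))
  refine (measure_mono h1).trans ((measure_biUnion_finset_le _ _).trans ?_)
  have h2 : ∀ u ∈ N, gaussianArray k d
      {w | 9 / 4 * ((k : ℝ) + d) ≤ ‖preact (arrayWeights w) u‖ ^ 2 / (4 * 1 ^ 2)}
      ≤ ENNReal.ofReal (√2 ^ k * Real.exp (-(9 / 4 * ((k : ℝ) + d)))) := by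
    intro u hu
    have h3 := exp_norm_preact_sq (k := k) one_pos (hN1 u hu)
    have h4 := measure_avg_ge_le_of_exp (I := Unit) (fun _ => h3.1) (fun _ => h3.2)
      (9 / 4 * ((k : ℝ) + d))
    simpa using h4
  refine (Finset.sum_le_sum h2).trans ?_
  rw [Finset.sum_const, nsmul_eq_mul, ← ENNReal.ofReal_natCast,
    ← ENNReal.ofReal_mul (Nat.cast_nonneg _)]
  refine ENNReal.ofReal_le_ofReal ?_
  have h5 : (5 : ℝ) ≤ Real.exp 2 := by
    have := Real.exp_one_gt_d9
    rw [show (2 : ℝ) = 1 + 1 by norm_num, Real.exp_add]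
    nlinarith
  have h6 : (N.card : ℝ) ≤ Real.exp (d * 2) := by
    rw [Real.exp_nat_mul]
    calc (N.card : ℝ) ≤ (5 : ℝ) ^ d := by exact_mod_cast hcard
      _ ≤ _ := by gcongr
  calc _ ≤ Real.exp (d * 2) * (√2 ^ k * Real.exp (-(9 / 4 * ((k : ℝ) + d)))) := by gcongr
    _ = (√2 ^ k * Real.exp (-(9 / 4 * k))) * (Real.exp (d * 2) * Real.exp (-(9 / 4 * d))) := by
        rw [mul_add, neg_add, Real.exp_add]; ring
    _ ≤ Real.exp (-k) * 1 := by
        gcongr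
        · exact exp_neg_bound_of_sqrt_two k
        · rw [← Real.exp_add, Real.exp_le_one_iff]; linarith
    _ = _ := mul_one _

/-- Chaining: with probability `1 - exp (-100 d)`, the output varies by at most `60 Γ ε √d` on a
ball of radius `ε`. -/
lemma measure_init_ball (hv : IsOutputWeight v) (hk : 0 < k) (hφ : SmoothActivation φ Γ)
    (hΓ : 0 < Γ) (hd : 0 < d) (c : EuclideanSpace ℝ (Fin d)) {ε : ℝ} (hε : 0 < ε) :
    gaussianArray k d {w | ¬ ∀ z, ‖z - c‖ ≤ ε →
        |net φ v (arrayWeights w) z - net φ v (arrayWeights w) c| ≤ 60 * (Γ * ε * √d)}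
      ≤ ENNReal.ofReal (Real.exp (-100 * d)) := by
  obtain ⟨N, hcard, hN1, hN⟩ := exists_half_net (EuclideanSpace ℝ (Fin d))
  rw [finrank_euclideanSpace_fin] at hcard
  set T : ℝ := 15 * (Γ * ε * √d) with hT
  have hd1 : (1 : ℝ) ≤ d := by exact_mod_cast hd
  -- the increment along the link `u` of order `m`, from the chain point `s`
  set inc : ℕ → EuclideanSpace ℝ (Fin d) → EuclideanSpace ℝ (Fin d) → (Fin k → Fin d → ℝ) → ℝ :=
    fun m s u w => net φ v (arrayWeights w) (c + ε • (s + (1 / 2 : ℝ) ^ m • u))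
      - net φ v (arrayWeights w) (c + ε • s) with hinc
  have hsub : {w : Fin k → Fin d → ℝ | ¬ ∀ z, ‖z - c‖ ≤ ε →
        |net φ v (arrayWeights w) z - net φ v (arrayWeights w) c| ≤ 60 * (Γ * ε * √d)}
      ⊆ ⋃ m, ⋃ p ∈ chainPoints N m ×ˢ N,
        {w | T * ((m + 1) * (1 / 2 : ℝ) ^ m) ≤ |inc m p.1 p.2 w|} := by
    intro w hw
    by_contra hnot
    apply hw
    simp only [Set.mem_iUnion, Set.mem_ofPred_eq, not_exists, not_le] at hnot
    intro z hz
    obtain ⟨s, u, h0, hu, hs, hlim⟩ := exists_chain hN (z := ε⁻¹ • (z - c)) (by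
      rw [norm_smul, norm_inv, Real.norm_of_nonneg hε.le, inv_mul_le_iff₀ hε]; linarith)
    have h1 : ∀ m : ℕ, |net φ v (arrayWeights w) (c + ε • s m) - net φ v (arrayWeights w) c|
        ≤ T * (4 - (2 * m + 4) * (1 / 2 : ℝ) ^ m) := by
      intro m
      induction m with
      | zero => simp [h0]
      | succ m ih =>
        have h2 := hnot m (s m, u m)
          (Finset.mk_mem_product (chain_mem_chainPoints h0 hu hs m) (hu m))
        have h3 : net φ v (arrayWeights w) (c + ε • s (m + 1)) - net φ v (arrayWeights w) c
            = inc m (s m) (u m) w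
              + (net φ v (arrayWeights w) (c + ε • s m) - net φ v (arrayWeights w) c) := by
          rw [hs]; simp only [hinc]; ring
        rw [h3]
        refine (abs_add_le _ _).trans ((add_le_add h2.le ih).trans (le_of_eq ?_))
        push_cast
        ring
    have h2 : Filter.Tendsto
        (fun m => |net φ v (arrayWeights w) (c + ε • s m) - net φ v (arrayWeights w) c|)
        Filter.atTop (nhds |net φ v (arrayWeights w) z - net φ v (arrayWeights w) c|) := by
      have hcont : Continuous fun y =>
          |net φ v (arrayWeights w) (c + ε • y) - net φ v (arrayWeights w) c| := by
        have := hφ.diff.continuous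
        unfold net
        fun_prop
      have h3 := (hcont.tendsto _).comp (tendsto_chain hlim)
      rwa [smul_smul, mul_inv_cancel₀ hε.ne', one_smul, add_sub_cancel] at h3
    refine le_of_tendsto' h2 fun m => (h1 m).trans ?_
    have h4 : 0 ≤ (2 * (m : ℝ) + 4) * (1 / 2 : ℝ) ^ m := by positivity
    calc _ ≤ T * 4 := by gcongr; linarith
      _ = _ := by rw [hT]; ring
  have hterm : ∀ m : ℕ, ∀ p ∈ chainPoints N m ×ˢ N,
      gaussianArray k d {w | T * ((m + 1) * (1 / 2 : ℝ) ^ m) ≤ |inc m p.1 p.2 w|}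
        ≤ ENNReal.ofReal (2 * Real.exp (-(112 * (d * (m + 1))))) := by
    intro m p hp
    have h1 := hasSubgaussianMGF_net_sub hv hk hφ
      (z := c + ε • (p.1 + (1 / 2 : ℝ) ^ m • p.2)) (z' := c + ε • p.1)
      (c := ⟨(Γ * (ε * (1 / 2 : ℝ) ^ m)) ^ 2, sq_nonneg _⟩) (by
        change Γ ^ 2 * _ ≤ (Γ * (ε * (1 / 2 : ℝ) ^ m)) ^ 2
        rw [← mul_pow]
        gcongr
        have h2 : c + ε • (p.1 + (1 / 2 : ℝ) ^ m • p.2) - (c + ε • p.1)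
            = ε • ((1 / 2 : ℝ) ^ m • p.2) := by module
        rw [h2, norm_smul, norm_smul, Real.norm_of_nonneg hε.le,
          Real.norm_of_nonneg (by positivity)]
        gcongr
        exact mul_le_of_le_one_right (by positivity) (hN1 _ (Finset.mem_product.1 hp).2))
    refine (measure_abs_ge_le_of_hasSubgaussianMGF h1 (by positivity)).trans ?_
    refine ENNReal.ofReal_le_ofReal ?_
    gcongr
    change -(T * ((m + 1) * (1 / 2 : ℝ) ^ m)) ^ 2 / (2 * (Γ * (ε * (1 / 2 : ℝ) ^ m)) ^ 2)
      ≤ -(112 * (d * (m + 1)))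
    have h2 : (T * ((m + 1) * (1 / 2 : ℝ) ^ m)) ^ 2
        = 225 * d * (m + 1) ^ 2 * (Γ * (ε * (1 / 2 : ℝ) ^ m)) ^ 2 := by
      rw [hT]
      have := Real.sq_sqrt (Nat.cast_nonneg (α := ℝ) d)
      calc _ = 225 * √(d : ℝ) ^ 2 * (m + 1) ^ 2 * (Γ * (ε * (1 / 2 : ℝ) ^ m)) ^ 2 := by ring
        _ = _ := by rw [this]
    have h3 : -(T * ((m + 1) * (1 / 2 : ℝ) ^ m)) ^ 2 / (2 * (Γ * (ε * (1 / 2 : ℝ) ^ m)) ^ 2)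
        = -(225 / 2 * (d * (m + 1) ^ 2)) := by
      rw [h2]; field_simp
    rw [h3]
    have h5 : (d : ℝ) * (m + 1) ≤ d * (m + 1) ^ 2 := by
      gcongr; nlinarith
    have h6 : 0 ≤ (d : ℝ) * (m + 1) := by positivity
    linarith
  have hlevel : ∀ m : ℕ, gaussianArray k d (⋃ p ∈ chainPoints N m ×ˢ N,
        {w | T * ((m + 1) * (1 / 2 : ℝ) ^ m) ≤ |inc m p.1 p.2 w|})
      ≤ ENNReal.ofReal (Real.exp (-100 * d) * (1 / 2 * (1 / 2) ^ m)) := by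
    intro m
    refine (measure_biUnion_finset_le _ _).trans ((Finset.sum_le_sum (hterm m)).trans ?_)
    rw [Finset.sum_const, nsmul_eq_mul, ← ENNReal.ofReal_natCast,
      ← ENNReal.ofReal_mul (Nat.cast_nonneg _), Finset.card_product]
    refine ENNReal.ofReal_le_ofReal ?_
    have h5 : (5 : ℝ) ≤ Real.exp 2 := by
      have := Real.exp_one_gt_d9
      rw [show (2 : ℝ) = 1 + 1 by norm_num, Real.exp_add]
      nlinarith
    have h6 : (((chainPoints N m).card * N.card : ℕ) : ℝ) ≤ Real.exp (d * (m + 1) * 2) := by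
      have h7 : (chainPoints N m).card * N.card ≤ 5 ^ (d * (m + 1)) := by
        calc _ ≤ N.card ^ m * N.card := by gcongr; exact card_chainPoints_le N m
          _ = N.card ^ (m + 1) := by rw [pow_succ]
          _ ≤ (5 ^ d) ^ (m + 1) := by gcongr
          _ = _ := by rw [pow_mul]
      calc (((chainPoints N m).card * N.card : ℕ) : ℝ) ≤ (5 : ℝ) ^ (d * (m + 1)) := by
            exact_mod_cast h7
        _ ≤ Real.exp 2 ^ (d * (m + 1)) := by gcongr
        _ = _ := by rw [← Real.exp_nat_mul]; push_cast; ring_nf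
    have hm : (0 : ℝ) ≤ m := Nat.cast_nonneg m
    have h8 : 2 * Real.exp (-(10 * (m + 1))) ≤ 1 / 2 * (1 / 2) ^ m := by
      have h9 : Real.exp (-(10 * (m + 1))) = Real.exp (-10) ^ (m + 1) := by
        rw [← Real.exp_nat_mul]; push_cast; ring_nf
      have h10 : Real.exp (-10) ≤ 1 / 4 := by
        rw [Real.exp_neg, one_div]
        gcongr
        linarith [Real.add_one_le_exp (10 : ℝ)]
      have h11 : (1 / 4 : ℝ) ^ m ≤ (1 / 2) ^ m := by gcongr; norm_num
      rw [h9]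
      calc _ ≤ 2 * (1 / 4 : ℝ) ^ (m + 1) := by gcongr
        _ = 1 / 2 * (1 / 4) ^ m := by ring
        _ ≤ _ := by gcongr
    calc _ ≤ Real.exp (d * (m + 1) * 2) * (2 * Real.exp (-(112 * (d * (m + 1))))) := by gcongr
      _ = 2 * Real.exp (-(110 * (d * (m + 1)))) := by
          rw [mul_left_comm, ← Real.exp_add]; ring_nf
      _ ≤ 2 * Real.exp (-100 * d + -(10 * (m + 1))) := by
          gcongr
          nlinarith [mul_nonneg (sub_nonneg.2 hd1) hm]
      _ = Real.exp (-100 * d) * (2 * Real.exp (-(10 * (m + 1)))) := by rw [Real.exp_add]; ring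
      _ ≤ _ := by gcongr
  refine (measure_mono hsub).trans ((measure_iUnion_le _).trans
    ((ENNReal.tsum_le_tsum hlevel).trans ?_))
  have hsum : HasSum (fun m : ℕ => Real.exp (-100 * d) * (1 / 2 * (1 / 2) ^ m))
      (Real.exp (-100 * d)) := by
    have := (hasSum_geometric_two.mul_left (1 / 2 : ℝ)).mul_left (Real.exp (-100 * d))
    simpa using this
  rw [← ENNReal.ofReal_tsum_of_nonneg (fun m => by positivity) hsum.summable, hsum.tsum_eq]

end Events

/-! ### Conditioning of the Jacobian at initialization -/

section Conditioning

variable {d k : ℕ} {φ : ℝ → ℝ} {Γ : ℝ} {v : Fin k → ℝ} {ι : Type*} [Fintype ι]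

/-- The entry `E[φ'(⟪c, g⟫) φ'(⟪c', g⟫)]` of the Gaussian covariance of `φ'`. -/
noncomputable def derivCov (φ : ℝ → ℝ) (c c' : EuclideanSpace ℝ (Fin d)) : ℝ :=
  ∫ g, deriv φ (rowInner c g) * deriv φ (rowInner c' g) ∂(gaussianRow d)

lemma SmoothActivation.continuous_deriv (hφ : SmoothActivation φ Γ) : Continuous (deriv φ) := by
  have hl : LipschitzWith ⟨Γ, hφ.nonneg⟩ (deriv φ) :=
    LipschitzWith.of_dist_le_mul fun a b => by
      rw [Real.dist_eq, Real.dist_eq]; exact hφ.deriv_lip a b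
  exact hl.continuous

lemma abs_deriv_mul_deriv_le (hφ : SmoothActivation φ Γ) (a b : ℝ) :
    |deriv φ a * deriv φ b| ≤ Γ ^ 2 := by
  rw [abs_mul, sq]
  exact mul_le_mul (hφ.deriv_le a) (hφ.deriv_le b) (abs_nonneg _) hφ.nonneg

lemma abs_derivCov_le (hφ : SmoothActivation φ Γ) (c c' : EuclideanSpace ℝ (Fin d)) :
    |derivCov φ c c'| ≤ Γ ^ 2 := by
  have h := norm_integral_le_of_norm_le_const (μ := gaussianRow d) (C := Γ ^ 2)
    (f := fun g => deriv φ (rowInner c g) * deriv φ (rowInner c' g))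
    (ae_of_all _ fun g => abs_deriv_mul_deriv_le hφ _ _)
  simpa [derivCov] using h

lemma norm_sum_smul_netGrad_sq (W : PiLp 2 fun _ : Fin k => EuclideanSpace ℝ (Fin d))
    (c : ι → EuclideanSpace ℝ (Fin d)) (s : ι → ℝ) :
    ‖∑ l, s l • netGrad φ v W (c l)‖ ^ 2 = ∑ l, ∑ l', s l * s l' * (inner ℝ (c l) (c l')
      * ∑ r, v r ^ 2 * (deriv φ (inner ℝ (W r) (c l)) * deriv φ (inner ℝ (W r) (c l')))) := by
  rw [← real_inner_self_eq_norm_sq, sum_inner]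
  refine Finset.sum_congr rfl fun l _ => ?_
  rw [inner_sum]
  refine Finset.sum_congr rfl fun l' _ => ?_
  have e : inner ℝ (netGrad φ v W (c l)) (netGrad φ v W (c l')) = inner ℝ (c l) (c l')
      * ∑ r, v r ^ 2 * (deriv φ (inner ℝ (W r) (c l)) * deriv φ (inner ℝ (W r) (c l'))) := by
    rw [PiLp.inner_apply, Finset.mul_sum]
    refine Finset.sum_congr rfl fun r _ => ?_
    simp only [netGrad, real_inner_smul_left, real_inner_smul_right]
    ring
  rw [real_inner_smul_left, real_inner_smul_right, e]
  ring

/-- Hoeffding's inequality for one entry of the empirical covariance of `φ'`. -/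
lemma measure_entry (hv : IsOutputWeight v) (hk : 0 < k) (hφ : SmoothActivation φ Γ) (hΓ : 0 < Γ)
    (c c' : EuclideanSpace ℝ (Fin d)) {t : ℝ} (ht : 0 ≤ t) :
    gaussianArray k d {w | t ≤ |∑ r, v r ^ 2 * (deriv φ (rowInner c (w r))
        * deriv φ (rowInner c' (w r)) - derivCov φ c c')|}
      ≤ ENNReal.ofReal (2 * Real.exp (-(t ^ 2 * k / (2 * Γ ^ 4)))) := by
  have hk' : (0 : ℝ) < k := by exact_mod_cast hk
  set ψ : (Fin d → ℝ) → ℝ := fun g => deriv φ (rowInner c g) * deriv φ (rowInner c' g) with hψ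
  have hcont : Continuous ψ :=
    (hφ.continuous_deriv.comp (continuous_rowInner c)).mul
      (hφ.continuous_deriv.comp (continuous_rowInner c'))
  have hrow : HasSubgaussianMGF (fun g => ψ g - derivCov φ c c')
      ((‖Γ ^ 2 - -Γ ^ 2‖₊ / 2) ^ 2) (gaussianRow d) :=
    hasSubgaussianMGF_of_mem_Icc hcont.measurable.aemeasurable
      (ae_of_all _ fun g => abs_le.1 (abs_deriv_mul_deriv_le hφ _ _))
  have hind : iIndepFun (fun r (w : Fin k → Fin d → ℝ) => v r ^ 2 * (ψ (w r) - derivCov φ c c'))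
      (gaussianArray k d) :=
    iIndepFun_pi (X := fun r g => v r ^ 2 * (ψ g - derivCov φ c c'))
      fun r => ((hcont.sub continuous_const).const_mul _).measurable.aemeasurable
  have hΓk : 0 ≤ Γ ^ 4 / k := by positivity
  have hsum := HasSubgaussianMGF.sum_of_iIndepFun hind (s := Finset.univ)
    (c := fun r => (v r ^ 2 * (Γ ^ 4 / k)).toNNReal) (by
      intro r _
      have h1 : (gaussianArray k d).map (fun w => w r) = gaussianRow d := by
        rw [gaussianArray]; exact (measurePreserving_eval _ r).map_eq
      rw [← h1] at hrow
      refine hasSubgaussianMGF_mono ((HasSubgaussianMGF.of_map (μ := gaussianArray k d)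
        (Y := fun w => w r) (measurable_pi_apply r).aemeasurable hrow).const_mul _) ?_
      rw [← NNReal.coe_le_coe, Real.coe_toNNReal _ (mul_nonneg (sq_nonneg _) hΓk)]
      change (v r ^ 2) ^ 2 * (‖Γ ^ 2 - -Γ ^ 2‖ / 2) ^ 2 ≤ v r ^ 2 * (Γ ^ 4 / k)
      have h3 : ‖Γ ^ 2 - -Γ ^ 2‖ / 2 = Γ ^ 2 := by
        rw [Real.norm_of_nonneg (by nlinarith [sq_nonneg Γ])]; ring
      have h4 : v r ^ 2 ≤ 1 / k := by
        have := (hv.outputBound hk).abs_le r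
        calc v r ^ 2 = |v r| ^ 2 := (sq_abs _).symm
          _ ≤ (1 / √(k : ℝ)) ^ 2 := by gcongr
          _ = _ := by rw [div_pow, Real.sq_sqrt hk'.le, one_pow]
      rw [h3, sq (v r ^ 2), mul_assoc]
      refine mul_le_mul_of_nonneg_left ?_ (sq_nonneg _)
      calc _ ≤ 1 / k * (Γ ^ 2) ^ 2 := by gcongr
        _ = _ := by ring)
  have hle : ∑ r, (v r ^ 2 * (Γ ^ 4 / k)).toNNReal ≤ (Γ ^ 4 / k).toNNReal := by
    rw [← Real.toNNReal_sum_of_nonneg fun r _ => mul_nonneg (sq_nonneg _) hΓk, ← Finset.sum_mul]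
    refine Real.toNNReal_le_toNNReal ?_
    exact mul_le_of_le_one_left hΓk (hv.outputBound hk).sum_sq_le
  refine (measure_abs_ge_le_of_hasSubgaussianMGF (hasSubgaussianMGF_mono hsum hle) ht).trans
    (ENNReal.ofReal_le_ofReal (le_of_eq ?_))
  rw [Real.coe_toNNReal _ hΓk]
  congr 2
  field_simp

/-- With high probability the Gram matrix of the gradients at the centers is at least a quarter of
its smallest expected eigenvalue. -/
lemma measure_init_cond (hv : IsOutputWeight v) (hk : 2 ≤ k) (hφ : SmoothActivation φ Γ)
    (hΓ : 0 < Γ) (c : ι → EuclideanSpace ℝ (Fin d)) (hc : ∀ l, ‖c l‖ ≤ 1) [Nonempty ι] {lam : ℝ}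
    (hlam0 : 0 < lam) (hlam : ∀ s : ι → ℝ, lam * ∑ l, s l ^ 2
      ≤ ∑ l, ∑ l', s l * s l' * (inner ℝ (c l) (c l') * derivCov φ (c l) (c l'))) :
    gaussianArray k d {w | ¬ ∀ s : ι → ℝ, lam / 4 * ∑ l, s l ^ 2
        ≤ ‖∑ l, s l • netGrad φ v (arrayWeights w) (c l)‖ ^ 2}
      ≤ ENNReal.ofReal ((Fintype.card ι) ^ 2
          * (2 * Real.exp (-(lam ^ 2 * k / (32 * (Fintype.card ι) ^ 2 * Γ ^ 4))))) := by
  set K : ℝ := (Fintype.card ι : ℝ) with hK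
  have hK0 : 0 < K := by rw [hK]; exact_mod_cast Fintype.card_pos
  set t : ℝ := lam / (4 * K) with ht
  have ht0 : 0 ≤ t := by positivity
  set dev : ι → ι → (Fin k → Fin d → ℝ) → ℝ := fun l l' w => ∑ r, v r ^ 2 *
    (deriv φ (rowInner (c l) (w r)) * deriv φ (rowInner (c l') (w r)) - derivCov φ (c l) (c l'))
    with hdev
  have hsub : {w : Fin k → Fin d → ℝ | ¬ ∀ s : ι → ℝ, lam / 4 * ∑ l, s l ^ 2
        ≤ ‖∑ l, s l • netGrad φ v (arrayWeights w) (c l)‖ ^ 2}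
      ⊆ ⋃ l, ⋃ l', {w | t ≤ |dev l l' w|} := by
    intro w hw
    by_contra hnot
    apply hw
    simp only [Set.mem_iUnion, Set.mem_ofPred_eq, not_exists, not_le] at hnot
    intro s
    have e : ‖∑ l, s l • netGrad φ v (arrayWeights w) (c l)‖ ^ 2
        = (∑ r, v r ^ 2) * ∑ l, ∑ l', s l * s l' * (inner ℝ (c l) (c l') * derivCov φ (c l) (c l'))
          + ∑ l, ∑ l', s l * s l' * (inner ℝ (c l) (c l') * dev l l' w) := by
      rw [norm_sum_smul_netGrad_sq, Finset.mul_sum, ← Finset.sum_add_distrib]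
      refine Finset.sum_congr rfl fun l _ => ?_
      rw [Finset.mul_sum, ← Finset.sum_add_distrib]
      refine Finset.sum_congr rfl fun l' _ => ?_
      simp only [hdev, mul_sub, Finset.sum_sub_distrib, ← Finset.sum_mul]
      have e2 : ∀ r l, inner ℝ (arrayWeights w r) (c l) = rowInner (c l) (w r) := fun _ _ => rfl
      simp only [e2]
      ring
    have h1 : 1 / 2 * (lam * ∑ l, s l ^ 2) ≤ (∑ r, v r ^ 2) * ∑ l, ∑ l', s l * s l' *
        (inner ℝ (c l) (c l') * derivCov φ (c l) (c l')) :=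
      mul_le_mul (hv.half_le_sum_sq hk) (hlam s) (by positivity)
        (Finset.sum_nonneg fun _ _ => sq_nonneg _)
    have h2 : |∑ l, ∑ l', s l * s l' * (inner ℝ (c l) (c l') * dev l l' w)|
        ≤ t * (K * ∑ l, s l ^ 2) := by
      have h3 : ∀ l l', |s l * s l' * (inner ℝ (c l) (c l') * dev l l' w)|
          ≤ |s l| * (|s l'| * t) := by
        intro l l'
        rw [abs_mul, abs_mul, abs_mul, mul_assoc]
        gcongr
        have h4 : |inner ℝ (c l) (c l')| ≤ 1 :=
          (abs_real_inner_le_norm _ _).trans (mul_le_one₀ (hc l) (norm_nonneg _) (hc l'))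
        calc _ ≤ 1 * t := by gcongr; exact (hnot l l').le
          _ = t := one_mul t
      have h5 : (∑ l, |s l|) ^ 2 ≤ K * ∑ l, s l ^ 2 := by
        have := sq_sum_le_card_mul_sum_sq (s := Finset.univ) (f := fun l => |s l|)
        simpa only [sq_abs, Finset.card_univ] using this
      calc _ ≤ ∑ l, ∑ l', |s l| * (|s l'| * t) :=
            (Finset.abs_sum_le_sum_abs _ _).trans (Finset.sum_le_sum fun l _ =>
              (Finset.abs_sum_le_sum_abs _ _).trans (Finset.sum_le_sum fun l' _ => h3 l l'))
        _ = t * (∑ l, |s l|) ^ 2 := by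
            simp_rw [← Finset.mul_sum, ← Finset.sum_mul]; ring
        _ ≤ _ := by gcongr
    have h6 : t * (K * ∑ l, s l ^ 2) = lam / 4 * ∑ l, s l ^ 2 := by
      rw [ht]; field_simp
    rw [e]
    have := (abs_le.1 h2).1
    linarith
  refine (measure_mono hsub).trans ((measure_iUnion_fintype_le _ _).trans ?_)
  have h1 : ∀ l l', gaussianArray k d {w | t ≤ |dev l l' w|} ≤ ENNReal.ofReal
      (2 * Real.exp (-(lam ^ 2 * k / (32 * K ^ 2 * Γ ^ 4)))) := by
    intro l l'
    refine (measure_entry hv (by omega) hφ hΓ (c l) (c l') ht0).trans (le_of_eq ?_)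
    congr 4
    rw [ht]
    field_simp
    norm_num
  calc _ ≤ ∑ _l : ι, ∑ _l' : ι, ENNReal.ofReal
        (2 * Real.exp (-(lam ^ 2 * k / (32 * K ^ 2 * Γ ^ 4)))) :=
        Finset.sum_le_sum fun l _ => (measure_iUnion_fintype_le _ _).trans
          (Finset.sum_le_sum fun l' _ => h1 l l')
    _ = _ := by
      rw [Finset.sum_const, Finset.sum_const, Finset.card_univ, nsmul_eq_mul, nsmul_eq_mul,
        ← ENNReal.ofReal_natCast, ← ENNReal.ofReal_mul hK0.le, ← ENNReal.ofReal_mul hK0.le]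
      congr 1
      ring

end Conditioning

/-! ### The matrix of cluster centers -/

section CenterMatrix

variable {d K : ℕ} {φ : ℝ → ℝ} {Γ : ℝ} (c : Fin K → EuclideanSpace ℝ (Fin d))

/-- A lower bound for the eigenvalues of a symmetric matrix bounds its quadratic form. -/
lemma mul_sum_sq_le_of_le_eigenvalues {A : Matrix (Fin K) (Fin K) ℝ} (hA : A.IsHermitian)
    {lam : ℝ} (h : ∀ i, lam ≤ hA.eigenvalues i) (s : Fin K → ℝ) :
    lam * ∑ l, s l ^ 2 ≤ ∑ l, ∑ l', s l * s l' * A l l' := by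
  set x : EuclideanSpace ℝ (Fin K) := WithLp.toLp 2 s with hx
  set b := hA.eigenvectorBasis with hb
  have hsymm : (Matrix.toEuclideanLin A).IsSymmetric := Matrix.isSymmetric_toEuclideanLin_iff.2 hA
  have h1 : ∑ l, ∑ l', s l * s l' * A l l' = inner ℝ x (Matrix.toEuclideanLin A x) := by
    rw [PiLp.inner_apply]
    refine Finset.sum_congr rfl fun l _ => ?_
    simp only [Matrix.toLpLin_apply, hx, Matrix.mulVec, dotProduct, RCLike.inner_apply,
      conj_trivial, Finset.sum_mul]
    exact Finset.sum_congr rfl fun l' _ => by ring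
  have h2 : ∀ i, inner ℝ (b i) (Matrix.toEuclideanLin A x)
      = hA.eigenvalues i * inner ℝ (b i) x := by
    intro i
    rw [← hsymm]
    have h3 : Matrix.toEuclideanLin A (b i) = hA.eigenvalues i • b i := by
      ext j
      have := congrFun (hA.mulVec_eigenvectorBasis i) j
      simpa [Matrix.toLpLin_apply] using this
    rw [h3, real_inner_smul_left]
  have h4 : ∑ l, s l ^ 2 = ∑ i, inner ℝ (b i) x ^ 2 := by
    have h5 := b.sum_sq_norm_inner_right x
    simp only [Real.norm_eq_abs, sq_abs] at h5
    rw [h5, EuclideanSpace.norm_sq_eq]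
    simp [hx]
  rw [h1, h4, ← b.sum_inner_mul_inner x, Finset.mul_sum]
  refine Finset.sum_le_sum fun i _ => ?_
  rw [h2, real_inner_comm]
  nlinarith [mul_le_mul_of_nonneg_right (h i) (sq_nonneg (inner ℝ x (b i)))]

lemma minClusterEigenvalue_mul_le (s : Fin K → ℝ) :
    minClusterEigenvalue φ (Matrix.of fun l j => c l j) * ∑ l, s l ^ 2
      ≤ ∑ l, ∑ l', s l * s l' * (inner ℝ (c l) (c l') * derivCov φ (c l) (c l')) := by
  refine (mul_sum_sq_le_of_le_eigenvalues (clusterCovariance_isHermitian φ _)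
    (fun i => ciInf_le (Set.finite_range _).bddBelow i) s).trans (le_of_eq ?_)
  refine Finset.sum_congr rfl fun l _ => Finset.sum_congr rfl fun l' _ => ?_
  congr 1
  simp only [clusterCovariance, Matrix.hadamard_apply, Matrix.of_apply, Matrix.mul_apply,
    Matrix.transpose_apply, derivCov]
  congr 1
  simp [PiLp.inner_apply, mul_comm]

lemma minClusterEigenvalue_le (hφ : SmoothActivation φ Γ) (hc : ∀ l, ‖c l‖ = 1) (l : Fin K) :
    minClusterEigenvalue φ (Matrix.of fun l j => c l j) ≤ Γ ^ 2 := by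
  have h := minClusterEigenvalue_mul_le (φ := φ) c (Pi.single l 1)
  have h1 : ∑ l', (Pi.single l 1 : Fin K → ℝ) l' ^ 2 = 1 := by
    rw [Finset.sum_eq_single l] <;> simp +contextual
  rw [h1, mul_one, Finset.sum_eq_single l, Finset.sum_eq_single l] at h
  · rw [real_inner_self_eq_norm_sq, hc] at h
    simp only [Pi.single_eq_same, one_pow, one_mul] at h
    exact h.trans ((le_abs_self _).trans (abs_derivCov_le hφ _ _))
  · intro l' _ hl'; simp [hl']
  · simp
  · intro l' _ hl'; simp [hl']
  · simp

lemma sum_inner_sq_le_specNorm (u : EuclideanSpace ℝ (Fin d)) :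
    ∑ l, inner ℝ u (c l) ^ 2 ≤ specNorm (Matrix.of fun l j => c l j) ^ 2 * ‖u‖ ^ 2 := by
  set T := (Matrix.toEuclideanLin (Matrix.of fun l j => c l j)).toContinuousLinearMap with hT
  have h1 := pow_le_pow_left₀ (norm_nonneg _) (T.le_opNorm u) 2
  rw [mul_pow] at h1
  refine le_trans (le_of_eq ?_) h1
  rw [EuclideanSpace.norm_sq_eq]
  refine Finset.sum_congr rfl fun l _ => ?_
  rw [Real.norm_eq_abs, sq_abs]
  congr 1

lemma one_le_specNorm (hc : ∀ l, ‖c l‖ = 1) (l : Fin K) :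
    1 ≤ specNorm (Matrix.of fun l j => c l j) := by
  have h := sum_inner_sq_le_specNorm c (c l)
  have h1 : inner ℝ (c l) (c l) ^ 2 ≤ ∑ l', inner ℝ (c l) (c l') ^ 2 :=
    Finset.single_le_sum (f := fun l' => inner ℝ (c l) (c l') ^ 2) (fun _ _ => sq_nonneg _)
      (Finset.mem_univ l)
  rw [real_inner_self_eq_norm_sq, hc] at h1
  rw [hc] at h
  have h0 : 0 ≤ specNorm (Matrix.of fun l j => c l j) := norm_nonneg _
  nlinarith

end CenterMatrix

/-! ### Matrices of weights as vectors of rows -/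

section Bridge

variable {d k n : ℕ} {φ : ℝ → ℝ} {Γ : ℝ} {v : Fin k → ℝ}

/-- A matrix as the vector of its rows. -/
noncomputable def rowVec (W : Matrix (Fin k) (Fin d) ℝ) :
    PiLp 2 fun _ : Fin k => EuclideanSpace ℝ (Fin d) :=
  WithLp.toLp 2 fun r => WithLp.toLp 2 (W r)

lemma network_eq_net (W : Matrix (Fin k) (Fin d) ℝ) (z : EuclideanSpace ℝ (Fin d)) :
    network φ v W z = net φ v (rowVec W) z := by
  simp [network, net, rowVec, dotProduct, Matrix.mulVec, PiLp.inner_apply, mul_comm]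

lemma frobNorm_eq_norm (W : Matrix (Fin k) (Fin d) ℝ) : frobNorm W = ‖rowVec W‖ := by
  rw [frobNorm, ← Real.sqrt_sq (norm_nonneg (rowVec W)), PiLp.norm_sq_eq_of_L2]
  simp [rowVec, EuclideanSpace.norm_sq_eq]

lemma rowVec_sub (W W' : Matrix (Fin k) (Fin d) ℝ) : rowVec (W - W') = rowVec W - rowVec W' := rfl

lemma hasDerivAt_network (hφ : Differentiable ℝ φ) (W : Matrix (Fin k) (Fin d) ℝ) (a : Fin k)
    (b : Fin d) (z : EuclideanSpace ℝ (Fin d)) :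
    HasDerivAt (fun t : ℝ => network φ v (W + t • Matrix.single a b (1 : ℝ)) z)
      (v a * deriv φ (inner ℝ (rowVec W a) z) * z b) 0 := by
  have e : ∀ (t : ℝ) (r : Fin k), ((W + t • Matrix.single a b (1 : ℝ)) *ᵥ z.ofLp) r
      = inner ℝ (rowVec W r) z + t * (if a = r then z b else 0) := by
    intro t r
    have h1 : inner ℝ (rowVec W r) z = (W *ᵥ z.ofLp) r := by
      simp [rowVec, dotProduct, Matrix.mulVec, PiLp.inner_apply, mul_comm]
    rw [h1, Matrix.add_mulVec, Matrix.smul_mulVec, Matrix.single_mulVec]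
    simp [Function.update_apply, eq_comm]
  simp only [network, dotProduct, e]
  have h : ∀ r : Fin k, HasDerivAt
      (fun t : ℝ => v r * φ (inner ℝ (rowVec W r) z + t * (if a = r then z b else 0)))
      (v r * (deriv φ (inner ℝ (rowVec W r) z) * (if a = r then z b else 0))) 0 := by
    intro r
    have h1 : HasDerivAt
        (fun t : ℝ => inner ℝ (rowVec W r) z + t * (if a = r then z b else 0))
        (if a = r then z b else 0) 0 := by
      simpa using ((hasDerivAt_id (0 : ℝ)).mul_const (if a = r then z b else 0)).const_add
        (inner ℝ (rowVec W r) z)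
    have h2 : HasDerivAt φ (deriv φ (inner ℝ (rowVec W r) z))
        (inner ℝ (rowVec W r) z + 0 * (if a = r then z b else 0)) := by
      simpa using (hφ (inner ℝ (rowVec W r) z)).hasDerivAt
    exact (h2.comp (0 : ℝ) h1).const_mul (v r)
  have hsum := HasDerivAt.fun_sum (u := Finset.univ) fun r _ => h r
  refine hsum.congr_deriv ?_
  simp [mul_assoc]

lemma rowVec_matrixGradient (hφ : Differentiable ℝ φ) (x : Fin n → EuclideanSpace ℝ (Fin d))
    (y : Fin n → ℝ) (W : Matrix (Fin k) (Fin d) ℝ) :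
    rowVec (matrixGradient (trainLoss φ v x y) W) = trainGrad φ v x y (rowVec W) := by
  have key : ∀ a b, matrixGradient (trainLoss φ v x y) W a b
      = ∑ i, (net φ v (rowVec W) (x i) - y i)
        * (v a * deriv φ (inner ℝ (rowVec W a) (x i)) * x i b) := by
    intro a b
    have h : HasDerivAt (fun t : ℝ => trainLoss φ v x y (W + t • Matrix.single a b (1 : ℝ)))
        (1 / 2 * ∑ i, (2 * (y i - network φ v (W + (0 : ℝ) • Matrix.single a b (1 : ℝ)) (x i))
          ^ (2 - 1) * -(v a * deriv φ (inner ℝ (rowVec W a) (x i)) * x i b))) 0 := by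
      unfold trainLoss
      refine (HasDerivAt.fun_sum fun i _ => ?_).const_mul _
      exact_mod_cast ((hasDerivAt_network hφ W a b (x i)).const_sub (y i)).pow 2
    simp only [matrixGradient, Matrix.of_apply]
    rw [h.deriv, Finset.mul_sum]
    refine Finset.sum_congr rfl fun i _ => ?_
    rw [zero_smul, add_zero, network_eq_net]
    ring
  ext a b
  change matrixGradient (trainLoss φ v x y) W a b = _
  rw [key]
  simp only [trainGrad, netGrad, WithLp.ofLp_sum, Finset.sum_apply, PiLp.smul_apply, smul_eq_mul]

lemma rowVec_gradientDescent_succ (hφ : Differentiable ℝ φ) (x : Fin n → EuclideanSpace ℝ (Fin d))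
    (y : Fin n → ℝ) (η : ℝ) (W : Matrix (Fin k) (Fin d) ℝ) (t : ℕ) :
    rowVec (gradientDescent (trainLoss φ v x y) η W (t + 1))
      = rowVec (gradientDescent (trainLoss φ v x y) η W t)
        - η • trainGrad φ v x y (rowVec (gradientDescent (trainLoss φ v x y) η W t)) := by
  rw [← rowVec_matrixGradient hφ]
  rfl

end Bridge

namespace Clustered

/-! ### The parameter regime -/

/-- The distance, up to constants, that the weights travel to fit the cluster centers. -/
noncomputable def driftScale (K Γ lg lam : ℝ) : ℝ := Γ * √(K * lg / lam)

/-- The radius `R`: the trajectory stays within `8 R` of the initial weights. -/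
noncomputable def driftRadius (b K Γ lg lam : ℝ) : ℝ := 68 / √b * driftScale K Γ lg lam

/-- The rate `a` in the inequality `a Q ≤ ‖p‖²`, for the center loss `Q` and half its gradient
`p`. -/
noncomputable def lossRate (b n K lam : ℝ) : ℝ := lam / 16 * (b * (n / K))

/-- The bound for the difference of the training gradient and the gradient of the center loss. -/
noncomputable def gradNoise (b n K Γ ε lg lam : ℝ) : ℝ :=
  Γ ^ 2 * ε * n * (331 * √lg + 50 * driftRadius b K Γ lg lam)

/-- The effect of the input noise `ε` on the outputs, up to constants. -/
noncomputable def outputNoise (K Γ ε lg lam : ℝ) : ℝ := ε * Γ ^ 3 * K * √lg / lam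

/-- The constant in the bound of `gradNoise` by `driftScale`. -/
noncomputable def noiseConst (b : ℝ) : ℝ := 331 + 3400 / √b

/-- The relations between the parameters of the problem: `b` and `u` are the balancedness constants,
`lg = log K`, and `A`, `cs`, `B` are the constants for the number `T` of iterations, the input
noise `ε` and the width `k`. -/
structure Regime (b u A cs B n K k Γ ρ ε lam S η L lg T : ℝ) : Prop where
  b_pos : 0 < b
  b_le : b ≤ u
  one_le_u : 1 ≤ u
  one_le_n : 1 ≤ n
  one_le_K : 1 ≤ K
  one_le_Γ : 1 ≤ Γ
  one_le_S : 1 ≤ S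
  lam_pos : 0 < lam
  lam_le : lam ≤ Γ ^ 2
  lg_ge : 2 / 3 ≤ lg
  lg_le : lg ≤ 7 * L
  one_le_L : 1 ≤ 11 * L
  ρ_pos : 0 < ρ
  exp_neg_L : Real.exp (-L) = ρ / (Γ * √(n * lg))
  ε_pos : 0 < ε
  ε_le : ε ≤ cs * (lam / (Γ ^ 2 * K * L))
  width : B * (Γ ^ 10 * (K ^ 2 * S ^ 4 / lam ^ 4) * lg) ≤ k
  η_pos : 0 < η
  η_le : η ≤ K / (2 * u * n * Γ ^ 2 * S ^ 2)
  T_ge : 1088 / b * (K / (η * n * lam)) * L ≤ T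
  T_le : T ≤ A * (K / (η * n * lam)) * L + 1

namespace Regime

variable {b u A cs B n K k Γ ρ ε lam S η L lg T : ℝ}

lemma pos (h : Regime b u A cs B n K k Γ ρ ε lam S η L lg T) :
    0 < u ∧ 0 < n ∧ 0 < K ∧ 0 < Γ ∧ 0 < S ∧ 0 < lg ∧ 0 < L :=
  ⟨by linarith [h.one_le_u], by linarith [h.one_le_n], by linarith [h.one_le_K],
    by linarith [h.one_le_Γ], by linarith [h.one_le_S], by linarith [h.lg_ge],
    by linarith [h.one_le_L]⟩

lemma driftScale_eq (h : Regime b u A cs B n K k Γ ρ ε lam S η L lg T) :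
    driftScale K Γ lg lam = Γ * (√K * √lg / √lam) := by
  obtain ⟨_, _, hK, _, _, hlg, _⟩ := h.pos
  rw [driftScale, Real.sqrt_div (by positivity), Real.sqrt_mul hK.le]

lemma driftScale_pos (h : Regime b u A cs B n K k Γ ρ ε lam S η L lg T) :
    0 < driftScale K Γ lg lam := by
  obtain ⟨_, _, hK, _, _, hlg, _⟩ := h.pos
  have := h.lam_pos
  rw [driftScale]; positivity

lemma driftRadius_pos (h : Regime b u A cs B n K k Γ ρ ε lam S η L lg T) :
    0 < driftRadius b K Γ lg lam := by
  have := h.driftScale_pos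
  have := h.b_pos
  rw [driftRadius]; positivity

lemma lossRate_pos (h : Regime b u A cs B n K k Γ ρ ε lam S η L lg T) :
    0 < lossRate b n K lam := by
  obtain ⟨_, hn, hK, _, _, hlg, _⟩ := h.pos
  have := h.lam_pos
  have := h.b_pos
  rw [lossRate]; positivity

lemma sqrt_lossRate (h : Regime b u A cs B n K k Γ ρ ε lam S η L lg T) :
    √(lossRate b n K lam) = √lam * √b * √n / (4 * √K) := by
  obtain ⟨_, hn, hK, _, _, hlg, _⟩ := h.pos
  have hlam := h.lam_pos
  have hb := h.b_pos
  rw [Real.sqrt_eq_iff_mul_self_eq h.lossRate_pos.le (by positivity), ← sq, div_pow, mul_pow,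
    mul_pow, mul_pow, Real.sq_sqrt hlam.le, Real.sq_sqrt hb.le, Real.sq_sqrt hn.le,
    Real.sq_sqrt hK.le, lossRate]
  field_simp
  norm_num

lemma driftScale_sq (h : Regime b u A cs B n K k Γ ρ ε lam S η L lg T) :
    driftScale K Γ lg lam ^ 2 = Γ ^ 2 * (K * lg / lam) := by
  obtain ⟨_, hn, hK, _, _, hlg, _⟩ := h.pos
  have hlam := h.lam_pos
  rw [driftScale, mul_pow, Real.sq_sqrt (by positivity)]

lemma driftRadius_sq (h : Regime b u A cs B n K k Γ ρ ε lam S η L lg T) :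
    driftRadius b K Γ lg lam ^ 2 = 4624 * (Γ ^ 2 * (K * lg / (lam * b))) := by
  have hb := h.b_pos
  rw [driftRadius, mul_pow, h.driftScale_sq, div_pow, Real.sq_sqrt hb.le]
  field_simp
  ring

lemma driftRadius_sq_mul_lossRate (h : Regime b u A cs B n K k Γ ρ ε lam S η L lg T) :
    driftRadius b K Γ lg lam ^ 2 * lossRate b n K lam = 289 * (Γ ^ 2 * n * lg) := by
  obtain ⟨_, hn, hK, _, _, hlg, _⟩ := h.pos
  have hlam := h.lam_pos
  have hb := h.b_pos
  rw [h.driftRadius_sq, lossRate]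
  field_simp
  norm_num

lemma sqrt_lam_le (h : Regime b u A cs B n K k Γ ρ ε lam S η L lg T) : √lam ≤ Γ := by
  rw [Real.sqrt_le_left (by linarith [h.one_le_Γ])]; exact h.lam_le

lemma sqrt_lg_le_driftScale (h : Regime b u A cs B n K k Γ ρ ε lam S η L lg T) :
    √lg ≤ driftScale K Γ lg lam := by
  obtain ⟨_, hn, hK, hΓ, _, hlg, _⟩ := h.pos
  have hlam := h.lam_pos
  rw [h.driftScale_eq, mul_div_assoc', le_div_iff₀ (by positivity)]
  have h1 : 1 ≤ √K := Real.one_le_sqrt.2 h.one_le_K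
  calc √lg * √lam ≤ √lg * Γ := by gcongr; exact h.sqrt_lam_le
    _ = Γ * (1 * √lg) := by ring
    _ ≤ _ := by gcongr

lemma noiseConst_pos (b : ℝ) : 0 < noiseConst b := by rw [noiseConst]; positivity

lemma gradNoise_pos (h : Regime b u A cs B n K k Γ ρ ε lam S η L lg T) :
    0 < gradNoise b n K Γ ε lg lam := by
  obtain ⟨_, hn, hK, hΓ, _, hlg, _⟩ := h.pos
  have := h.driftRadius_pos
  have := h.ε_pos
  rw [gradNoise]; positivity

lemma gradNoise_le (h : Regime b u A cs B n K k Γ ρ ε lam S η L lg T) :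
    gradNoise b n K Γ ε lg lam ≤ noiseConst b * (Γ ^ 2 * ε * n * driftScale K Γ lg lam) := by
  obtain ⟨_, hn, hK, hΓ, _, hlg, _⟩ := h.pos
  have := h.ε_pos
  calc _ ≤ Γ ^ 2 * ε * n * (331 * driftScale K Γ lg lam + 50 * driftRadius b K Γ lg lam) := by
        rw [gradNoise]; gcongr; exact h.sqrt_lg_le_driftScale
    _ = _ := by rw [driftRadius, noiseConst]; ring

lemma step_mul_curvature_le (h : Regime b u A cs B n K k Γ ρ ε lam S η L lg T) :
    η * (2 * (u * (n / K) * (Γ ^ 2 * S ^ 2))) ≤ 1 := by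
  obtain ⟨hu, hn, hK, hΓ, hS, hlg, _⟩ := h.pos
  have h1 := h.η_le
  rw [le_div_iff₀ (by positivity)] at h1
  calc _ = η * (2 * u * n * Γ ^ 2 * S ^ 2) / K := by ring
    _ ≤ 1 := by rwa [div_le_one hK]

lemma step_mul_lossRate_le (h : Regime b u A cs B n K k Γ ρ ε lam S η L lg T) :
    η * lossRate b n K lam ≤ 1 := by
  obtain ⟨hu, hn, hK, hΓ, hS, hlg, _⟩ := h.pos
  have hη := h.η_pos
  have hlam := h.lam_pos
  refine le_trans ?_ h.step_mul_curvature_le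
  gcongr
  have h1 : 1 ≤ S ^ 2 := one_le_pow₀ h.one_le_S
  calc lossRate b n K lam = b * (n / K) * (lam / 16) := by rw [lossRate]; ring
    _ ≤ u * (n / K) * (2 * (Γ ^ 2 * S ^ 2)) := by
        gcongr
        · exact h.b_le
        · nlinarith [h.lam_le]
    _ = _ := by ring

lemma one_le_cond (h : Regime b u A cs B n K k Γ ρ ε lam S η L lg T) : 1 ≤ Γ ^ 2 / lam := by
  rw [one_le_div h.lam_pos]; exact h.lam_le

/-- The width dominates `log K` times the powers of `Γ² / λ`, `K` and `S` that bound the quantities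
which have to be small compared to `k`. -/
lemma le_width (h : Regime b u A cs B n K k Γ ρ ε lam S η L lg T) {C : ℝ} (hC : 0 ≤ C)
    (hCB : C ≤ B) {p i j : ℕ} (hp : p ≤ 4) (hi : i ≤ 2) (hj : j ≤ 4) :
    C * ((Γ ^ 2 / lam) ^ p * (K ^ i * S ^ j * lg)) ≤ k := by
  obtain ⟨_, _, _, _, _, hlg, _⟩ := h.pos
  have h1 := h.one_le_cond
  have h2 := h.one_le_K
  have h3 := h.one_le_S
  refine le_trans ?_ h.width
  calc _ ≤ B * ((Γ ^ 2 / lam) ^ 4 * (K ^ 2 * S ^ 4 * lg)) := by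
        gcongr
        exact hC.trans hCB
    _ = B * ((Γ ^ 2 / lam) ^ 4 * (K ^ 2 * S ^ 4 * lg) * 1) := by ring
    _ ≤ B * ((Γ ^ 2 / lam) ^ 4 * (K ^ 2 * S ^ 4 * lg) * Γ ^ 2) := by
        gcongr
        · exact hC.trans hCB
        · exact one_le_pow₀ h.one_le_Γ
    _ = _ := by field_simp

lemma width_pos (h : Regime b u A cs B n K k Γ ρ ε lam S η L lg T) (hB : 4624 ≤ B) :
    4624 * lg ≤ k := by
  simpa using h.le_width (C := 4624) (p := 0) (i := 0) (j := 0) (by norm_num) hB (by norm_num)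
    (by norm_num) (by norm_num)

/-- The trajectory moves the weights by at most `√k`. -/
lemma scale_mul_driftRadius_le (h : Regime b u A cs B n K k Γ ρ ε lam S η L lg T)
    (hB0 : 4624 ≤ B) (hB : 4734976 / b ≤ B) : 1 / √k * (8 * driftRadius b K Γ lg lam) ≤ 1 := by
  have hlam := h.lam_pos
  have hb := h.b_pos
  obtain ⟨_, _, hK, _, _, hlg, _⟩ := h.pos
  have hk : 0 < k := by linarith [h.width_pos hB0]
  rw [one_div_mul_eq_div, div_le_one (by positivity)]
  refine Real.le_sqrt_of_sq_le ?_
  refine le_trans ?_ (h.le_width (C := 4734976 / b) (p := 1) (i := 1) (j := 0) (by positivity) hB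
    (by norm_num) (by norm_num) (by norm_num))
  rw [mul_pow, h.driftRadius_sq]
  have e : 0 ≤ Γ ^ 2 * K * lg / (lam * b) := by positivity
  calc _ = 295936 * (Γ ^ 2 * K * lg / (lam * b)) := by ring
    _ ≤ 4734976 * (Γ ^ 2 * K * lg / (lam * b)) := by linarith
    _ = _ := by field_simp

/-- The trajectory changes the Jacobian at the centers by at most half of its smallest singular
value at initialization, which is at least `√λ / 2`. -/
lemma driftRadius_le_cond (h : Regime b u A cs B n K k Γ ρ ε lam S η L lg T)
    (hB0 : 4624 ≤ B) (hB : 4734976 / b ≤ B) :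
    Γ * (1 / √k) * S * (8 * driftRadius b K Γ lg lam) ≤ √lam / 4 := by
  have hlam := h.lam_pos
  have hb := h.b_pos
  obtain ⟨_, _, hK, hΓ, hS, hlg, _⟩ := h.pos
  have hk : 0 < k := by linarith [h.width_pos hB0]
  have h1 : Γ * S * (8 * driftRadius b K Γ lg lam) * 4 / √lam ≤ √k := by
    refine Real.le_sqrt_of_sq_le ?_
    refine le_trans (le_of_eq ?_) (h.le_width (C := 4734976 / b) (p := 2) (i := 1) (j := 2)
      (by positivity) hB (by norm_num) (by norm_num) (by norm_num))
    rw [div_pow, mul_pow, mul_pow, mul_pow, mul_pow, h.driftRadius_sq, Real.sq_sqrt hlam.le]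
    field_simp
    norm_num
  rw [div_le_iff₀ (by positivity)] at h1
  rw [mul_one_div, div_mul_eq_mul_div, div_mul_eq_mul_div, div_le_iff₀ (by positivity)]
  linarith

/-- The second derivative of the network contributes less to the curvature of the center loss than
its Jacobian. -/
lemma width_curvature (h : Regime b u A cs B n K k Γ ρ ε lam S η L lg T) (hB0 : 4624 ≤ B) :
    68 * (1 / √k * Γ ^ 2 * n * √lg) ≤ u * (n / K) * (Γ ^ 2 * S ^ 2) := by
  obtain ⟨_, hn, hK, hΓ, hS, hlg, _⟩ := h.pos
  have hk : 0 < k := by linarith [h.width_pos hB0]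
  have h1 : 68 * K * √lg ≤ √k := by
    refine Real.le_sqrt_of_sq_le ?_
    refine le_trans (le_of_eq ?_) (h.le_width (C := 4624) (p := 0) (i := 2) (j := 0)
      (by norm_num) hB0 (by norm_num) (by norm_num) (by norm_num))
    rw [mul_pow, mul_pow, Real.sq_sqrt hlg.le]
    ring
  calc _ = (68 * K * √lg) / √k * (1 * (n / K) * (Γ ^ 2 * 1)) := by field_simp
    _ ≤ 1 * (u * (n / K) * (Γ ^ 2 * S ^ 2)) := by
        gcongr
        · rwa [div_le_one (by positivity)]
        · exact h.one_le_u
        · exact one_le_pow₀ h.one_le_S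
    _ = _ := one_mul _

lemma step_mul_time_le (h : Regime b u A cs B n K k Γ ρ ε lam S η L lg T) :
    η * T ≤ (A + 6) * (K / (n * lam) * L) := by
  obtain ⟨hu, hn, hK, hΓ, hS, hlg, hL⟩ := h.pos
  have hlam := h.lam_pos
  have hη := h.η_pos
  have h1 : η ≤ 6 * (K / (n * lam) * L) := by
    refine h.η_le.trans ?_
    calc K / (2 * u * n * Γ ^ 2 * S ^ 2) ≤ K / (2 * 1 * n * lam * 1) := by
          gcongr
          · exact h.one_le_u
          · exact h.lam_le
          · exact one_le_pow₀ h.one_le_S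
      _ = K / (n * lam) * (1 / 2) := by field_simp
      _ ≤ K / (n * lam) * (6 * L) := by
          gcongr
          linarith [h.one_le_L]
      _ = _ := by ring
  calc η * T ≤ η * (A * (K / (η * n * lam)) * L + 1) := by gcongr; exact h.T_le
    _ = A * (K / (n * lam) * L) + η := by field_simp
    _ ≤ _ := by linarith

/-- The accumulated gradient noise moves the weights by at most half of the allowed radius. -/
lemma noise_budget (h : Regime b u A cs B n K k Γ ρ ε lam S η L lg T) (hA : 0 ≤ A)
    (hcs : cs * (noiseConst b * (704 / b + 5 * (A + 6))) ≤ 272 / √b) :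
    4 * gradNoise b n K Γ ε lg lam / lossRate b n K lam
      + 5 * (η * T) * gradNoise b n K Γ ε lg lam ≤ 4 * driftRadius b K Γ lg lam := by
  obtain ⟨hu, hn, hK, hΓ, hS, hlg, hL⟩ := h.pos
  have hlam := h.lam_pos
  have hb := h.b_pos
  have hX := h.gradNoise_pos
  have hω := h.driftScale_pos
  have hε' := h.ε_le
  have hC := noiseConst_pos b
  have h1 : Γ ^ 2 * ε * n * (K / (n * lam) * L) ≤ cs := by
    calc _ = ε * (Γ ^ 2 * K * L / lam) := by field_simp
      _ ≤ cs * (lam / (Γ ^ 2 * K * L)) * (Γ ^ 2 * K * L / lam) := by gcongr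
      _ = cs := by field_simp
  have h2 : 4 / lossRate b n K lam ≤ 704 / b * (K / (n * lam) * L) := by
    calc _ = 64 / b * (K / (n * lam)) * 1 := by rw [lossRate]; field_simp; norm_num
      _ ≤ 64 / b * (K / (n * lam)) * (11 * L) := by gcongr; exact h.one_le_L
      _ = _ := by ring
  calc _ = (4 / lossRate b n K lam + 5 * (η * T)) * gradNoise b n K Γ ε lg lam := by ring
    _ ≤ (704 / b * (K / (n * lam) * L) + 5 * ((A + 6) * (K / (n * lam) * L)))
        * (noiseConst b * (Γ ^ 2 * ε * n * driftScale K Γ lg lam)) :=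
        mul_le_mul (add_le_add h2 (mul_le_mul_of_nonneg_left h.step_mul_time_le (by norm_num)))
          h.gradNoise_le hX.le (by positivity)
    _ = (Γ ^ 2 * ε * n * (K / (n * lam) * L))
        * (noiseConst b * (704 / b + 5 * (A + 6)) * driftScale K Γ lg lam) := by ring
    _ ≤ cs * (noiseConst b * (704 / b + 5 * (A + 6)) * driftScale K Γ lg lam) := by gcongr
    _ = cs * (noiseConst b * (704 / b + 5 * (A + 6))) * driftScale K Γ lg lam := by ring
    _ ≤ 272 / √b * driftScale K Γ lg lam := by gcongr
    _ = _ := by rw [driftRadius]; ring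

lemma outputNoise_pos (h : Regime b u A cs B n K k Γ ρ ε lam S η L lg T) :
    0 < outputNoise K Γ ε lg lam := by
  obtain ⟨hu, hn, hK, hΓ, hS, hlg, hL⟩ := h.pos
  have hlam := h.lam_pos
  have hε := h.ε_pos
  rw [outputNoise]; positivity

/-- The stationary level of the square root of the center loss. -/
lemma gradNoise_div_sqrt_le (h : Regime b u A cs B n K k Γ ρ ε lam S η L lg T) :
    √(gradNoise b n K Γ ε lg lam ^ 2 / lossRate b n K lam)
      ≤ 4 * noiseConst b / √b * (√n * outputNoise K Γ ε lg lam) := by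
  obtain ⟨hu, hn, hK, hΓ, hS, hlg, hL⟩ := h.pos
  have hlam := h.lam_pos
  have hb := h.b_pos
  have hX := h.gradNoise_pos
  have h1 : 0 < √lam * √b * √n / (4 * √K) := by positivity
  rw [Real.sqrt_div (sq_nonneg _), Real.sqrt_sq hX.le, h.sqrt_lossRate, div_le_iff₀ h1]
  refine h.gradNoise_le.trans (le_of_eq ?_)
  rw [h.driftScale_eq, outputNoise]
  have h2 := Real.mul_self_sqrt hn.le
  have h3 := Real.mul_self_sqrt hK.le
  have h4 := Real.mul_self_sqrt hlam.le
  generalize √n = sn at *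
  generalize √K = sK at *
  generalize √lam = sl at *
  subst h2 h3 h4
  field_simp

/-- The drift radius times `ε`, in terms of the output noise. -/
lemma driftRadius_mul_le (h : Regime b u A cs B n K k Γ ρ ε lam S η L lg T) :
    √K * (Γ * ε * driftRadius b K Γ lg lam) ≤ 68 / √b * outputNoise K Γ ε lg lam := by
  obtain ⟨hu, hn, hK, hΓ, hS, hlg, hL⟩ := h.pos
  have hlam := h.lam_pos
  have hε := h.ε_pos
  have h3 := Real.mul_self_sqrt hK.le
  have h4 := Real.mul_self_sqrt hlam.le
  calc _ = 68 / √b * (ε * Γ ^ 2 * (√K * √K) * √lg / (√lam * √lam) * √lam) := by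
        rw [driftRadius, h.driftScale_eq]; field_simp
    _ ≤ 68 / √b * (ε * Γ ^ 2 * (√K * √K) * √lg / (√lam * √lam) * Γ) := by
        gcongr; exact h.sqrt_lam_le
    _ = _ := by rw [h3, h4, outputNoise]; ring

lemma sqrt_lg_mul_le (h : Regime b u A cs B n K k Γ ρ ε lam S η L lg T) :
    Γ * ε * √lg ≤ outputNoise K Γ ε lg lam := by
  obtain ⟨hu, hn, hK, hΓ, hS, hlg, hL⟩ := h.pos
  have hε := h.ε_pos
  have hlam := h.lam_pos
  calc _ = Γ * ε * √lg * (1 * 1) := by ring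
    _ ≤ Γ * ε * √lg * (Γ ^ 2 / lam * K) := by
        gcongr
        · exact h.one_le_cond
        · exact h.one_le_K
    _ = _ := by rw [outputNoise]; ring

lemma input_shift_le (h : Regime b u A cs B n K k Γ ρ ε lam S η L lg T) :
    Γ * ε * (37 * √lg + 50 * driftRadius b K Γ lg lam)
      ≤ (37 + 3400 / √b) * outputNoise K Γ ε lg lam := by
  obtain ⟨hu, hn, hK, hΓ, hS, hlg, hL⟩ := h.pos
  have hε := h.ε_pos
  have hR := h.driftRadius_pos
  have h1 := h.sqrt_lg_mul_le
  have h2 := h.driftRadius_mul_le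
  have h3 : 1 * (Γ * ε * driftRadius b K Γ lg lam)
      ≤ √K * (Γ * ε * driftRadius b K Γ lg lam) := by
    gcongr
    exact Real.one_le_sqrt.2 h.one_le_K
  calc _ = 37 * (Γ * ε * √lg) + 50 * (1 * (Γ * ε * driftRadius b K Γ lg lam)) := by ring
    _ ≤ 37 * outputNoise K Γ ε lg lam + 50 * (68 / √b * outputNoise K Γ ε lg lam) := by
        linarith
    _ = _ := by ring

/-- After the prescribed number of iterations the initial loss has decayed below `ρ²`. -/
lemma decay_le (h : Regime b u A cs B n K k Γ ρ ε lam S η L lg T) {τ : ℕ} (hτ : T = τ) :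
    √((1 - η * lossRate b n K lam) ^ τ * (289 * (Γ ^ 2 * n * lg))) ≤ ρ := by
  obtain ⟨hu, hn, hK, hΓ, hS, hlg, hL⟩ := h.pos
  have hlam := h.lam_pos
  have hη := h.η_pos
  have hb := h.b_pos
  have ha := h.lossRate_pos
  have h1 : 68 * L ≤ η * lossRate b n K lam * τ := by
    have h2 : η * lossRate b n K lam * (1088 / b * (K / (η * n * lam)) * L)
        ≤ η * lossRate b n K lam * T := mul_le_mul_of_nonneg_left h.T_ge (by positivity)
    rw [← hτ]
    refine le_trans (le_of_eq ?_) h2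
    rw [lossRate]
    field_simp
    norm_num
  have h3 : (1 - η * lossRate b n K lam) ^ τ ≤ Real.exp (-L) ^ 68 := by
    calc _ ≤ Real.exp (-(η * lossRate b n K lam)) ^ τ := by
          gcongr
          · linarith [h.step_mul_lossRate_le]
          · exact Real.one_sub_le_exp_neg _
      _ = Real.exp (-(η * lossRate b n K lam * τ)) := by
          rw [← Real.exp_nat_mul]; ring_nf
      _ ≤ Real.exp (-(68 * L)) := by gcongr
      _ = _ := by rw [← Real.exp_nat_mul]; push_cast; ring_nf
  -- `L ≥ 1 / 11`, so `33` of the `34` powers of `exp (-L)` absorb the constant `17`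
  have h4 : Real.exp (-L) ^ 33 * 17 ≤ 1 := by
    have e : Real.exp (-L) ^ 33 ≤ Real.exp (-3) := by
      rw [← Real.exp_nat_mul]
      gcongr
      push_cast
      linarith [h.one_le_L]
    have e2 : Real.exp (-3) * 17 ≤ 1 := by
      rw [Real.exp_neg, inv_mul_le_iff₀ (Real.exp_pos _), mul_one,
        show (3 : ℝ) = ((3 : ℕ) : ℝ) * 1 by norm_num, Real.exp_nat_mul]
      calc (17 : ℝ) ≤ 2.7 ^ 3 := by norm_num
        _ ≤ _ := by gcongr; linarith [Real.exp_one_gt_d9]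
    linarith
  rw [Real.sqrt_le_left h.ρ_pos.le]
  have h5 : Real.exp (-L) * (Γ * √(n * lg)) = ρ := by
    rw [h.exp_neg_L]; field_simp
  have h6 : √(n * lg) ^ 2 = n * lg := Real.sq_sqrt (by positivity)
  calc _ ≤ Real.exp (-L) ^ 68 * (289 * (Γ ^ 2 * n * lg)) := by gcongr
    _ = (Real.exp (-L) ^ 33 * 17) ^ 2 * (Real.exp (-L) * (Γ * √(n * lg))) ^ 2 := by
        rw [mul_pow _ (Γ * _), mul_pow Γ, h6]; ring
    _ ≤ 1 ^ 2 * (Real.exp (-L) * (Γ * √(n * lg))) ^ 2 := by gcongr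
    _ = ρ ^ 2 := by rw [h5]; ring

/-- Under the stronger assumption on `ε`, the output noise is small even in the supremum norm. -/
lemma outputNoise_mul_sqrt_le (h : Regime b u A cs B n K k Γ ρ ε lam S η L lg T) {δ : ℝ}
    (hε : ε ≤ cs * δ * (lam ^ 2 / (Γ ^ 5 * K ^ 2 * L ^ 3))) :
    √K * outputNoise K Γ ε lg lam ≤ 1100 * (cs * δ) := by
  obtain ⟨hu, hn, hK, hΓ, hS, hlg, hL⟩ := h.pos
  have hlam := h.lam_pos
  have hε0 := h.ε_pos
  have hδ : 0 < cs * δ := by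
    have h1 : 0 < cs * δ * (lam ^ 2 / (Γ ^ 5 * K ^ 2 * L ^ 3)) := hε0.trans_le hε
    exact pos_of_mul_pos_left h1 (by positivity)
  have h1 : √K ≤ K := by
    rw [Real.sqrt_le_left hK.le]; nlinarith [h.one_le_K]
  have h2 : √lg ≤ 1100 * L ^ 3 := by
    have e1 : √lg ≤ 5 / 4 * lg := by
      rw [Real.sqrt_le_left (by positivity)]; nlinarith [h.lg_ge]
    have e2 : 1 ≤ (11 * L) ^ 2 := one_le_pow₀ h.one_le_L
    nlinarith [h.lg_le]
  calc _ ≤ K * (cs * δ * (lam ^ 2 / (Γ ^ 5 * K ^ 2 * L ^ 3)) * Γ ^ 3 * K * (1100 * L ^ 3)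
        / lam) := by rw [outputNoise]; gcongr
    _ = 1100 * (cs * δ) * (lam / Γ ^ 2) := by field_simp
    _ ≤ 1100 * (cs * δ) * 1 := by
        gcongr
        rw [div_le_one (by positivity)]
        exact h.lam_le
    _ = _ := mul_one _

end Regime

end Clustered

namespace Clustered

/-! ### Errors with respect to the ground truth labels -/

lemma sqrt_sum_sq_add_le {I : Type*} [Fintype I] (f g : I → ℝ) :
    √(∑ i, (f i + g i) ^ 2) ≤ √(∑ i, f i ^ 2) + √(∑ i, g i ^ 2) := by
  have h := norm_add_le (WithLp.toLp 2 f : EuclideanSpace ℝ I) (WithLp.toLp 2 g)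
  simpa [EuclideanSpace.norm_eq] using h

lemma sqrt_add_le {p q : ℝ} (hp : 0 ≤ p) (hq : 0 ≤ q) : √(p + q) ≤ √p + √q := by
  rw [Real.sqrt_le_left (by positivity)]
  nlinarith [Real.sq_sqrt hp, Real.sq_sqrt hq, mul_nonneg (Real.sqrt_nonneg p) (Real.sqrt_nonneg q)]

lemma assignedTo_of_abs_sub_lt {Kbar : ℕ} {α : Fin Kbar → ℝ} {δ u : ℝ} {r : Fin Kbar}
    (hα : ∀ r s, r ≠ s → δ ≤ |α r - α s|) (hu : |u - α r| < δ / 2) : AssignedTo α u r := by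
  intro s hs
  have h1 := hα r s hs.symm
  have h2 := abs_sub_le (α r) u (α s)
  rw [abs_sub_comm (α r) u] at h2
  linarith

section Errors

variable {b u ρ ε δ Γ : ℝ} {n K Kbar d k : ℕ} (D : CorruptedDataset b u ρ ε δ n K Kbar d)
  {φ : ℝ → ℝ} {v : Fin k → ℝ} {W : PiLp 2 fun _ : Fin k => EuclideanSpace ℝ (Fin d)} {e₁ e₂ : ℝ}

lemma abs_label_le (i : Fin n) : |D.y i| ≤ 1 := by
  obtain ⟨r, hr⟩ := D.y_mem i
  rw [← hr]
  exact abs_le.2 (D.label_mem r)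

/-- A corrupted label differs from the ground truth by at most two, so the mean label of a cluster
is `2 ρ`-close to the ground truth. -/
lemma abs_clusterMean_sub_label_le (hpos : ∀ l, 0 < clusterSize D.cl l) (l : Fin K) :
    |clusterMean D.cl D.y l - D.α (D.cls l)| ≤ 2 * ρ := by
  refine (abs_clusterMean_sub_le hpos l _).trans ((div_le_iff₀ (hpos l)).2 ?_)
  calc ∑ i with D.cl i = l, |D.y i - D.α (D.cls l)|
      ≤ ∑ i with D.cl i = l, if D.y i ≠ D.α (D.cls (D.cl i)) then (2 : ℝ) else 0 := by
        refine Finset.sum_le_sum fun i hi => ?_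
        have hl : D.cl i = l := (Finset.mem_filter.1 hi).2
        subst hl
        split_ifs with h
        · have h1 := abs_le.1 (abs_label_le D i)
          have h2 := D.label_mem (D.cls (D.cl i))
          exact abs_le.2 ⟨by linarith [h2.2], by linarith [h2.1]⟩
        · rw [not_not.1 h]; simp
    _ = 2 * ((Finset.univ.filter fun i => D.cl i = l ∧ D.y i ≠ D.α (D.cls (D.cl i))).card : ℝ) := by
        rw [← Finset.sum_filter, Finset.filter_filter, Finset.sum_const, nsmul_eq_mul, mul_comm]
    _ ≤ 2 * (ρ * clusterSize D.cl l) := by gcongr; exact D.corruption l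
    _ = _ := by ring

lemma sqrt_sum_sub_label_sq_le (hn : 0 < n) (hρ : 0 ≤ ρ) (hpos : ∀ l, 0 < clusterSize D.cl l)
    (h₁ : √(∑ i, (net φ v W (D.x i) - net φ v W (D.c (D.cl i))) ^ 2) ≤ √n * e₁)
    (h₂ : √(∑ i, (net φ v W (D.c (D.cl i)) - clusterMean D.cl D.y (D.cl i)) ^ 2) ≤ ρ + √n * e₂) :
    √(∑ i, (net φ v W (D.x i) - D.trueLabel i) ^ 2) / √n ≤ 3 * ρ + (e₁ + e₂) := by
  have hn1 : 1 ≤ √(n : ℝ) := Real.one_le_sqrt.2 (by exact_mod_cast hn)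
  rw [div_le_iff₀ (by linarith)]
  have h₃ : √(∑ i, (clusterMean D.cl D.y (D.cl i) - D.trueLabel i) ^ 2) ≤ √n * (2 * ρ) := by
    rw [Real.sqrt_le_left (by positivity), mul_pow, Real.sq_sqrt (Nat.cast_nonneg _)]
    calc _ ≤ ∑ _i : Fin n, (2 * ρ) ^ 2 := by
          refine Finset.sum_le_sum fun i _ => ?_
          rw [← sq_abs]
          gcongr
          exact abs_clusterMean_sub_label_le D hpos (D.cl i)
      _ = _ := by simp
  have h4 := sqrt_sum_sq_add_le (fun i => net φ v W (D.x i) - net φ v W (D.c (D.cl i)))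
    (fun i => net φ v W (D.c (D.cl i)) - clusterMean D.cl D.y (D.cl i))
  have h5 := sqrt_sum_sq_add_le (fun i => net φ v W (D.x i) - clusterMean D.cl D.y (D.cl i))
    (fun i => clusterMean D.cl D.y (D.cl i) - D.trueLabel i)
  simp only [sub_add_sub_cancel] at h4 h5
  nlinarith

/-- A training input with a wrong prediction has an error of at least `δ / 4` that is not due to
the corruption of the labels. -/
lemma numErrors_le (hn : 0 < n) (hρδ : ρ ≤ δ / 8) (he : 0 ≤ e₁ + e₂)
    (hpos : ∀ l, 0 < clusterSize D.cl l) {M : Matrix (Fin k) (Fin d) ℝ} (hM : rowVec M = W)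
    (h₁ : √(∑ i, (net φ v W (D.x i) - net φ v W (D.c (D.cl i))) ^ 2) ≤ √n * e₁)
    (h₂ : √(∑ i, (net φ v W (D.c (D.cl i)) - clusterMean D.cl D.y (D.cl i)) ^ 2) ≤ ρ + √n * e₂) :
    (numErrors D.toClusterableDataset φ v M : ℝ) / n ≤ 8 * (e₁ + e₂) / δ := by
  classical
  have hδ := D.separation_pos
  have hn0 : (0 : ℝ) < n := by exact_mod_cast hn
  have h4 := sqrt_sum_sq_add_le (fun i => net φ v W (D.x i) - net φ v W (D.c (D.cl i)))
    (fun i => net φ v W (D.c (D.cl i)) - clusterMean D.cl D.y (D.cl i))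
  simp only [sub_add_sub_cancel] at h4
  set E := Finset.univ.filter fun i =>
    ¬ AssignedTo D.α (network φ v M (D.x i)) (D.cls (D.cl i)) with hE
  have hN : numErrors D.toClusterableDataset φ v M = E.card := by
    rw [numErrors, hE]
  rw [hN]
  rcases E.eq_empty_or_nonempty with h0 | h0
  · rw [h0]; simpa using by positivity
  have hE1 : 1 ≤ √(E.card : ℝ) := Real.one_le_sqrt.2 (by exact_mod_cast h0.card_pos)
  have h5 : √(E.card : ℝ) * (δ / 4)
      ≤ √(∑ i, (net φ v W (D.x i) - clusterMean D.cl D.y (D.cl i)) ^ 2) := by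
    refine Real.le_sqrt_of_sq_le ?_
    rw [mul_pow, Real.sq_sqrt (Nat.cast_nonneg _)]
    calc (E.card : ℝ) * (δ / 4) ^ 2 = ∑ _i ∈ E, (δ / 4) ^ 2 := by simp
      _ ≤ ∑ i ∈ E, (net φ v W (D.x i) - clusterMean D.cl D.y (D.cl i)) ^ 2 := by
          refine Finset.sum_le_sum fun i hi => ?_
          have h6 : δ / 2 ≤ |net φ v W (D.x i) - D.α (D.cls (D.cl i))| := by
            by_contra! hlt
            refine (Finset.mem_filter.1 hi).2 ?_
            rw [network_eq_net, hM]
            exact assignedTo_of_abs_sub_lt D.label_sep hlt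
          have h7 := abs_clusterMean_sub_label_le D hpos (D.cl i)
          have h8 := abs_sub_le (net φ v W (D.x i)) (clusterMean D.cl D.y (D.cl i))
            (D.α (D.cls (D.cl i)))
          rw [← sq_abs (net φ v W (D.x i) - _)]
          gcongr
          linarith
      _ ≤ _ := Finset.sum_le_sum_of_subset_of_nonneg (Finset.subset_univ _)
          fun _ _ _ => sq_nonneg _
  have h6 : √(E.card : ℝ) ≤ √n * (8 * (e₁ + e₂) / δ) := by
    rw [mul_div_assoc', le_div_iff₀ hδ]
    nlinarith
  have hEn : (E.card : ℝ) ≤ n := by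
    exact_mod_cast (Finset.card_le_univ E).trans_eq (Fintype.card_fin n)
  -- the fraction of errors is at most one, so it is at most its square root
  rw [div_le_iff₀ hn0]
  calc (E.card : ℝ) = √E.card * √E.card := (Real.mul_self_sqrt (Nat.cast_nonneg _)).symm
    _ ≤ √n * (8 * (e₁ + e₂) / δ) * √n := by gcongr
    _ = 8 * (e₁ + e₂) / δ * (√n * √n) := by ring
    _ = _ := by rw [Real.mul_self_sqrt hn0.le]

/-- The cluster `l` has the weight `n_l ≥ b n / K` in the center loss, which therefore bounds the
error at its center. -/
lemma abs_net_center_sub_label_le (hn : 0 < n) (hK : 0 < K) (hb : 0 < b) (hρ : 0 ≤ ρ)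
    (hpos : ∀ l, 0 < clusterSize D.cl l) (he₂ : 0 ≤ e₂)
    (h₂ : √(∑ i, (net φ v W (D.c (D.cl i)) - clusterMean D.cl D.y (D.cl i)) ^ 2) ≤ ρ + √n * e₂)
    (l : Fin K) : |net φ v W (D.c l) - D.α (D.cls l)| ≤ 3 * ρ + √K / √b * e₂ := by
  have hn0 : (0 : ℝ) < n := by exact_mod_cast hn
  set s := clusterSize D.cl l with hs
  have hs1 : 1 ≤ √s := by
    rw [Real.one_le_sqrt]
    have := hpos l
    rw [clusterSize] at this
    rw [hs, clusterSize]
    exact_mod_cast Nat.cast_pos.1 this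
  have hs2 : √b * (√n / √K) ≤ √s := by
    rw [← Real.sqrt_div hn0.le, ← Real.sqrt_mul hb.le]
    exact Real.sqrt_le_sqrt (D.balanced_low l)
  have h3 : √s * |net φ v W (D.c l) - clusterMean D.cl D.y l| ≤ ρ + √n * e₂ := by
    refine le_trans (Real.le_sqrt_of_sq_le ?_) h₂
    rw [mul_pow, Real.sq_sqrt (hpos l).le, sq_abs,
      ← sum_clusterSize_mul fun l => (net φ v W (D.c l) - clusterMean D.cl D.y l) ^ 2]
    exact Finset.single_le_sum
      (f := fun l => clusterSize D.cl l * (net φ v W (D.c l) - clusterMean D.cl D.y l) ^ 2)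
      (fun l _ => mul_nonneg (hpos l).le (sq_nonneg _)) (Finset.mem_univ l)
  have h4 : √n * e₂ ≤ √s * (√K / √b * e₂) := by
    calc √n * e₂ = √b * (√n / √K) * (√K / √b * e₂) := by field_simp
      _ ≤ _ := by gcongr
  have h5 : ρ ≤ √s * ρ := le_mul_of_one_le_left hρ hs1
  have h6 : |net φ v W (D.c l) - clusterMean D.cl D.y l| ≤ ρ + √K / √b * e₂ := by
    have h7 : √s * |net φ v W (D.c l) - clusterMean D.cl D.y l| ≤ √s * (ρ + √K / √b * e₂) := by
      linarith
    exact le_of_mul_le_mul_left h7 (by linarith)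
  have h7 := abs_clusterMean_sub_label_le D hpos l
  have h8 := abs_sub_le (net φ v W (D.c l)) (clusterMean D.cl D.y l) (D.α (D.cls l))
  linarith

end Errors

/-- The change of the output within distance `ε` of a center, at weights in a ball around weights
of controlled operator norm. -/
lemma abs_net_sub_center_le {φ : ℝ → ℝ} {Γ ε R : ℝ} {k d : ℕ} {v : Fin k → ℝ}
    {W W₀ : PiLp 2 fun _ : Fin k => EuclideanSpace ℝ (Fin d)} (hk : 0 < k)
    (hφ : SmoothActivation φ Γ) (hv : OutputBound v (1 / √k)) (hR : ‖W - W₀‖ ≤ 8 * R)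
    (hκR : 1 / √k * (8 * R) ≤ 1)
    (hop : ∀ u : EuclideanSpace ℝ (Fin d), ‖preact W₀ u‖ ≤ 6 * (√k + √d) * ‖u‖)
    {z c : EuclideanSpace ℝ (Fin d)} (hc : ‖c‖ ≤ 1) (hz : ‖z - c‖ ≤ ε)
    (hball : |net φ v W₀ z - net φ v W₀ c| ≤ 60 * (Γ * ε * √d)) :
    |net φ v W z - net φ v W c| ≤ 64 * (Γ * ε * R) + 66 * (Γ * ε * √d) := by
  have hΓ := hφ.nonneg
  have hκ := hv.nonneg
  have hε : 0 ≤ ε := (norm_nonneg _).trans hz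
  have h1 := abs_net_sub_sub_le W₀ (W - W₀) hφ hv z hc
  rw [add_sub_cancel] at h1
  have hR0 : 0 ≤ 8 * R := (norm_nonneg _).trans hR
  have h2 : 1 / √k * ‖preact W₀ (z - c)‖ ≤ 6 * ε + 1 / √k * (6 * √d * ε) := by
    calc _ ≤ 1 / √k * (6 * (√k + √d) * ε) := by
          gcongr
          exact (hop _).trans (by gcongr)
      _ = _ := by field_simp
  have h3 : 1 / √k * ‖W - W₀‖ * ‖z - c‖ ≤ 1 * ε :=
    mul_le_mul ((mul_le_mul_of_nonneg_left hR hκ).trans hκR) hz (norm_nonneg _) zero_le_one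
  have h4 : |(net φ v W z - net φ v W c) - (net φ v W₀ z - net φ v W₀ c)|
      ≤ Γ * (8 * R) * (8 * ε) + 6 * (Γ * ε * √d) := by
    calc _ ≤ Γ * (8 * R) * (8 * ε + 1 / √k * (6 * √d * ε)) := by
          refine h1.trans (mul_le_mul (by gcongr) (by linarith) (by positivity) (by positivity))
      _ = Γ * (8 * R) * (8 * ε) + 6 * (Γ * ε * √d) * (1 / √k * (8 * R)) := by ring
      _ ≤ Γ * (8 * R) * (8 * ε) + 6 * (Γ * ε * √d) * 1 := by gcongr
      _ = _ := by ring
  have h5 := abs_add_le ((net φ v W z - net φ v W c) - (net φ v W₀ z - net φ v W₀ c))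
    (net φ v W₀ z - net φ v W₀ c)
  rw [sub_add_cancel] at h5
  linarith

/-- The constant that `cs` has to compensate for all points near a center to get its label. -/
noncomputable def labelConst (b : ℝ) : ℝ := 66 + 1100 * (4352 / √b + 4 * noiseConst b / b)

/-- The constant in front of `outputNoise` in the bound of the normalized `ℓ₂` error. -/
noncomputable def errorConst (b : ℝ) : ℝ := 37 + 3400 / √b + 4 * noiseConst b / √b

section Deterministic

variable {b u A cs cb B ρ ε δ Γ lam η L : ℝ} {n K Kbar d k : ℕ}
  {D : CorruptedDataset b u ρ ε δ n K Kbar d}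
  {φ : ℝ → ℝ} {v : Fin k → ℝ} {M : ℕ → Matrix (Fin k) (Fin d) ℝ} {τ : ℕ}

/-- From a good start, gradient descent satisfies all conclusions. -/
theorem robustAt_of_goodStart
    (hp : Regime b u A cs B n K k Γ ρ ε lam (specNorm D.centerMatrix) η L (Real.log K) τ)
    (hg : GoodStart φ v D.x D.y D.c D.cl (rowVec (M 0)) Γ (1 / √k) ε (Real.log K) lam
      (specNorm D.centerMatrix) (b * (n / K)) (u * (n / K)))
    (hop : ∀ z : EuclideanSpace ℝ (Fin d), ‖preact (rowVec (M 0)) z‖ ≤ 6 * (√k + √d) * ‖z‖)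
    (hball : ∀ l z, ‖z - D.c l‖ ≤ ε →
      |net φ v (rowVec (M 0)) z - net φ v (rowVec (M 0)) (D.c l)| ≤ 60 * (Γ * ε * √d))
    (hM : ∀ t, rowVec (M (t + 1)) = rowVec (M t) - η • trainGrad φ v D.x D.y (rowVec (M t)))
    (hA : 0 ≤ A) (hB0 : 4624 ≤ B) (hB : 4734976 / b ≤ B)
    (hcs : cs * (noiseConst b * (704 / b + 5 * (A + 6))) ≤ 272 / √b)
    (hcs' : 9 * (cs * labelConst b) ≤ 1)
    (hcb : 88 * errorConst b ≤ cb) (hcb' : 544 / √b ≤ cb) :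
    RobustAt D φ v Γ η lam L cs cb M τ := by
  obtain ⟨hu, hn, hK, hΓ, hS, hlg, hL⟩ := hp.pos
  have hn' : 0 < n := by exact_mod_cast hn
  have hK' : 0 < K := by exact_mod_cast hK
  have hb := hp.b_pos
  have hlam := hp.lam_pos
  have hη := hp.η_pos
  have hε := hp.ε_pos
  have hδ := D.separation_pos
  have hpos := hg.clusterSize_pos
  set R := driftRadius b K Γ (Real.log K) lam with hR
  set ν := outputNoise K Γ ε (Real.log K) lam with hν
  have hν0 : 0 < ν := hp.outputNoise_pos
  have hk' : 0 < k := by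
    have h1 : (0 : ℝ) < k := by linarith [hp.width_pos hB0]
    exact_mod_cast h1
  have hκR := hp.scale_mul_driftRadius_le hB0 hB
  have htraj := hg.trajectory (by simpa using hn) hp.driftRadius_pos hη (τ := τ)
    (w := fun t => rowVec (M t)) rfl hM (a := lossRate b n K lam) rfl
    (X := gradNoise b n K Γ ε (Real.log K) lam) (by simp [gradNoise])
    (by simpa using hp.driftRadius_sq_mul_lossRate) hp.step_mul_lossRate_le
    hp.step_mul_curvature_le hκR (hp.driftRadius_le_cond hB0 hB)
    (by simpa using hp.width_curvature hB0) (hp.noise_budget hA hcs)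
  simp only [Fintype.card_fin] at htraj
  obtain ⟨hWτ, hQτ⟩ := htraj τ le_rfl
  have h₁ : √(∑ i, (net φ v (rowVec (M τ)) (D.x i) - net φ v (rowVec (M τ)) (D.c (D.cl i))) ^ 2)
      ≤ √n * ((37 + 3400 / √b) * ν) := by
    have h := hg.sqrt_sum_net_sub_sq_le hp.driftRadius_pos.le hWτ hκR
    rw [Fintype.card_fin] at h
    exact h.trans (mul_le_mul_of_nonneg_left hp.input_shift_le (Real.sqrt_nonneg _))
  have h₂ : √(∑ i, (net φ v (rowVec (M τ)) (D.c (D.cl i)) - clusterMean D.cl D.y (D.cl i)) ^ 2)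
      ≤ ρ + √n * (4 * noiseConst b / √b * ν) := by
    rw [← centerLoss_clusterMean]
    have h0 : 0 ≤ 1 - η * lossRate b n K lam := by linarith [hp.step_mul_lossRate_le]
    have ha := hp.lossRate_pos
    refine (Real.sqrt_le_sqrt hQτ).trans ((sqrt_add_le (by positivity) (by positivity)).trans
      (add_le_add (hp.decay_le rfl) (hp.gradNoise_div_sqrt_le.trans (le_of_eq ?_))))
    ring
  have hC := Regime.noiseConst_pos b
  have hcorrect : ρ ≤ δ / 8 →
      ε ≤ cs * δ * min (lam ^ 2 / (Γ ^ 5 * K ^ 2 * L ^ 3)) (1 / (Γ * √(d : ℝ))) →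
      ∀ l z, ‖z - D.c l‖ ≤ ε → AssignedTo D.α (network φ v (M τ) z) (D.cls l) := by
    intro hρδ hε₂ l z hz
    refine assignedTo_of_abs_sub_lt D.label_sep ?_
    rw [network_eq_net]
    have hcs0 : 0 < cs := by
      have h1 : 0 < cs * (lam / (Γ ^ 2 * K * L)) := hε.trans_le hp.ε_le
      exact pos_of_mul_pos_left h1 (by positivity)
    have hd : Γ * ε * √d ≤ cs * δ := by
      have h1 : ε ≤ cs * δ * (1 / (Γ * √(d : ℝ))) :=
        hε₂.trans (mul_le_mul_of_nonneg_left (min_le_right _ _) (by positivity))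
      rcases (Real.sqrt_nonneg (d : ℝ)).eq_or_lt with h0 | h0
      · rw [← h0]; simp only [mul_zero]; positivity
      · calc Γ * ε * √d ≤ Γ * (cs * δ * (1 / (Γ * √(d : ℝ)))) * √d := by gcongr
          _ = cs * δ := by field_simp
    have hνK : √K * ν ≤ 1100 * (cs * δ) := hp.outputNoise_mul_sqrt_le
      (hε₂.trans (mul_le_mul_of_nonneg_left (min_le_left _ _) (by positivity)))
    have hRε : Γ * ε * R ≤ 68 / √b * (√K * ν) := by
      have hK1 : 1 ≤ √(K : ℝ) := Real.one_le_sqrt.2 hp.one_le_K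
      have h1 := hp.driftRadius_mul_le
      have h2 : 0 ≤ Γ * ε * R := by
        have := hp.driftRadius_pos
        positivity
      calc Γ * ε * R ≤ √K * (Γ * ε * R) := le_mul_of_one_le_left h2 hK1
        _ ≤ 68 / √b * ν := h1
        _ ≤ 68 / √b * (√K * ν) := by
            gcongr
            exact le_mul_of_one_le_left hν0.le hK1
    have h3 := abs_net_sub_center_le hk' hg.smooth hg.output hWτ hκR hop (hg.norm_center l) hz
      (hball l z hz)
    have h4 := abs_net_center_sub_label_le D hn' hK' hb hp.ρ_pos.le hpos (by positivity) h₂ l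
    have h5 := abs_sub_le (net φ v (rowVec (M τ)) z) (net φ v (rowVec (M τ)) (D.c l))
      (D.α (D.cls l))
    have h6 : √K / √b * (4 * noiseConst b / √b * ν) = 4 * noiseConst b / b * (√K * ν) := by
      have : √b * √b = b := Real.mul_self_sqrt hb.le
      calc _ = 4 * noiseConst b / (√b * √b) * (√K * ν) := by field_simp
        _ = _ := by rw [this]
    -- `3 ρ ≤ 3 δ / 8` leaves less than `δ / 8` for the terms that are proportional to `ε`
    have h7 : 64 * (68 / √b * (√K * ν)) + 66 * (cs * δ) + 4 * noiseConst b / b * (√K * ν)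
        ≤ δ / 9 := by
      calc _ = (4352 / √b + 4 * noiseConst b / b) * (√K * ν) + 66 * (cs * δ) := by ring
        _ ≤ (4352 / √b + 4 * noiseConst b / b) * (1100 * (cs * δ)) + 66 * (cs * δ) := by gcongr
        _ = (cs * labelConst b) * δ := by rw [labelConst]; ring
        _ ≤ (1 / 9) * δ := by gcongr; linarith
        _ = _ := by ring
    rw [h6] at h4
    linarith
  have hνL : ν ≤ 11 * (ν * L) := by nlinarith [hp.one_le_L]
  have hE0 : 0 < errorConst b := by rw [errorConst]; positivity
  have hsum : (37 + 3400 / √b) * ν + 4 * noiseConst b / √b * ν = errorConst b * ν := by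
    rw [errorConst]; ring
  have hcb8 : 8 * (errorConst b * ν) ≤ cb * (ν * L) := by
    calc 8 * (errorConst b * ν) ≤ 8 * (errorConst b * (11 * (ν * L))) := by gcongr
      _ = 88 * errorConst b * (ν * L) := by ring
      _ ≤ _ := by gcongr
  refine ⟨?_, fun hρδ => ?_, fun hρδ hε₂ => ⟨fun l z hz => ⟨hcorrect hρδ hε₂ l z hz, ?_⟩,
    fun i => hcorrect hρδ hε₂ _ _ (D.input_near i)⟩, fun t ht => ?_⟩
  · have h3 := sqrt_sum_sub_label_sq_le D hn' hp.ρ_pos.le hpos h₁ h₂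
    rw [hsum] at h3
    simp only [network_eq_net]
    refine h3.trans ?_
    have e : cb * (ε * Γ ^ 3 * K * √(Real.log K) / lam) * L = cb * (ν * L) := by
      rw [hν, outputNoise]; ring
    have : 0 < errorConst b * ν := by positivity
    rw [e]
    linarith [hp.ρ_pos]
  · have h3 := numErrors_le D hn' hρδ (by rw [hsum]; positivity) hpos rfl h₁ h₂
    rw [hsum] at h3
    refine h3.trans ?_
    have e : cb * (ε * K / δ) * (Γ ^ 3 * √(Real.log K) / lam) * L = cb * (ν * L) / δ := by
      rw [hν, outputNoise]; ring
    rw [e]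
    gcongr
  · -- the center closest to `z` is within `ε` of `z` as well
    rintro r ⟨l', hl', rfl⟩
    exact hcorrect hρδ hε₂ l' z ((hl' l).trans hz)
  · rw [frobNorm_eq_norm, rowVec_sub]
    refine (htraj t ht).1.trans ?_
    have h3 : 0 ≤ t * η * ε * (Γ ^ 4 * K * n / lam) * L ^ 2 := by positivity
    calc 8 * R = 544 / √b * (Γ * √(K * Real.log K / lam)) := by
          rw [hR, driftRadius, driftScale]; ring
      _ ≤ cb * (Γ * √(K * Real.log K / lam)) := by gcongr
      _ ≤ _ := by
          have : 0 ≤ cb := le_trans (by positivity) hcb'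
          gcongr
          linarith

end Deterministic

end Clustered

namespace Clustered

/-! ### The logarithmic factor -/

section LogFactor

variable {Γ ρ : ℝ} {n K : ℕ}

lemma log_pos_of_two_le (hK : 2 ≤ K) : 0.69 ≤ Real.log K := by
  have h1 : Real.log 2 ≤ Real.log K := Real.log_le_log (by norm_num) (by exact_mod_cast hK)
  linarith [Real.log_two_gt_d9]

/-- The logarithmic factor is at least `(log K + log log K) / 2`, and
`log log K ≥ 1 - 1 / log K`. -/
lemma le_logFactor (hK : 2 ≤ K) (hKn : K ≤ n) (hΓ : 1 ≤ Γ) (hρ : 0 < ρ) (hρ1 : ρ ≤ 1) :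
    (Real.log K + 1 - (Real.log K)⁻¹) / 2 ≤ logFactor Γ n K ρ := by
  have hx : 0 < Real.log K := by linarith [log_pos_of_two_le hK]
  have hK0 : (0 : ℝ) < K := by exact_mod_cast (by omega : 0 < K)
  have h1 : √(K * Real.log K) ≤ Γ * √(n * Real.log K) / ρ := by
    rw [le_div_iff₀ hρ]
    calc √(K * Real.log K) * ρ ≤ √(n * Real.log K) * 1 := by gcongr
      _ = 1 * √(n * Real.log K) := by ring
      _ ≤ _ := by gcongr
  have h2 := Real.log_le_log (by positivity) h1
  rw [Real.log_sqrt (by positivity), Real.log_mul hK0.ne' hx.ne'] at h2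
  rw [logFactor]
  linarith [Real.one_sub_inv_le_log_of_pos hx]

lemma log_le_logFactor (hK : 2 ≤ K) (hKn : K ≤ n) (hΓ : 1 ≤ Γ) (hρ : 0 < ρ) (hρ1 : ρ ≤ 1) :
    Real.log K ≤ 7 * logFactor Γ n K ρ := by
  have hx := log_pos_of_two_le hK
  refine le_trans ?_ (mul_le_mul_of_nonneg_left (le_logFactor hK hKn hΓ hρ hρ1) (by norm_num))
  have h1 : (Real.log K)⁻¹ ≤ 1 + 5 / 7 * Real.log K := by
    rw [inv_le_iff_one_le_mul₀ (by linarith)]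
    nlinarith
  linarith

lemma one_le_logFactor (hK : 2 ≤ K) (hKn : K ≤ n) (hΓ : 1 ≤ Γ) (hρ : 0 < ρ) (hρ1 : ρ ≤ 1) :
    1 ≤ 11 * logFactor Γ n K ρ := by
  have hx := log_pos_of_two_le hK
  refine le_trans ?_ (mul_le_mul_of_nonneg_left (le_logFactor hK hKn hΓ hρ hρ1) (by norm_num))
  have h1 : (Real.log K)⁻¹ ≤ 9 / 11 + Real.log K := by
    rw [inv_le_iff_one_le_mul₀ (by linarith)]
    nlinarith
  linarith

lemma exp_neg_logFactor (hn : 0 < n) (hK : 2 ≤ K) (hΓ : 1 ≤ Γ) (hρ : 0 < ρ) :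
    Real.exp (-logFactor Γ n K ρ) = ρ / (Γ * √(n * Real.log K)) := by
  have hx := log_pos_of_two_le hK
  rw [logFactor, Real.exp_neg, Real.exp_log (by positivity), inv_div]

end LogFactor

/-! ### Balanced clusters -/

section Balanced

variable {b u ε δ : ℝ} {n K Kbar d : ℕ}

lemma one_le_clusterSize (D : ClusterableDataset b u ε δ n K Kbar d) (hb : 0 < b)
    (hn : 0 < n) (hK : 0 < K) (l : Fin K) :
    1 ≤ clusterSize D.cl l := by
  have h1 : 0 < b * ((n : ℝ) / K) := by positivity
  rw [clusterSize]
  exact_mod_cast Nat.cast_pos.1 (h1.trans_le (D.balanced_low l))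

lemma clusters_le_samples (D : ClusterableDataset b u ε δ n K Kbar d) (hb : 0 < b)
    (hn : 0 < n) (hK : 0 < K) : K ≤ n := by
  have h1 : ∑ _l : Fin K, (1 : ℝ) ≤ ∑ l, clusterSize D.cl l :=
    Finset.sum_le_sum fun l _ => one_le_clusterSize D hb hn hK l
  rw [sum_clusterSize] at h1
  simpa using h1

lemma one_le_of_balanced_up (D : ClusterableDataset b u ε δ n K Kbar d) (hn : 0 < n)
    (hK : 0 < K) : 1 ≤ u := by
  have hn0 : (0 : ℝ) < n := by exact_mod_cast hn
  have hK0 : (0 : ℝ) < K := by exact_mod_cast hK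
  have h1 : ∑ l, clusterSize D.cl l ≤ ∑ _l : Fin K, u * ((n : ℝ) / K) :=
    Finset.sum_le_sum fun l _ => D.balanced_up l
  rw [sum_clusterSize] at h1
  simp only [Fintype.card_fin, Finset.sum_const, Finset.card_univ, nsmul_eq_mul] at h1
  rw [mul_left_comm, mul_div_cancel₀ _ hK0.ne'] at h1
  nlinarith

lemma dim_pos (D : ClusterableDataset b u ε δ n K Kbar d) (hK : 0 < K) : 0 < d := by
  by_contra h0
  have h1 := D.norm_center ⟨0, hK⟩
  obtain rfl : d = 0 := by omega
  rw [Subsingleton.elim (D.c ⟨0, hK⟩) 0, norm_zero] at h1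
  exact zero_ne_one h1

end Balanced

/-! ### The initial weights are good with high probability -/

section Probability

variable {b u A cs B ρ ε δ Γ η L T : ℝ} {n K Kbar d k : ℕ}
  {D : CorruptedDataset b u ρ ε δ n K Kbar d} {φ : ℝ → ℝ} {v : Fin k → ℝ}

/-- The failure probabilities of the five events whose bounds do not involve the dimension `d`. -/
lemma failure_sum_le (hK : 2 ≤ K) {m : ℝ} (hk : 4624 * Real.log K ≤ k)
    (hm : 110 * Real.log K ≤ m) :
    K * (2 * Real.exp (-(112 * Real.log K))) + (2 * Real.exp (-(110 * Real.log K))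
      + (Real.exp (-k) + (K ^ 2 * (2 * Real.exp (-m)) + Real.exp (-k)))) ≤ 3 / (K : ℝ) ^ 100 := by
  have hK0 : (0 : ℝ) < K := by exact_mod_cast (by omega : 0 < K)
  set q : ℝ := (K : ℝ)⁻¹ with hq
  have hq0 : 0 < q := by positivity
  have hq2 : q ≤ 1 / 2 := by
    rw [hq, one_div]; gcongr; exact_mod_cast hK
  have hKq : K * q = 1 := mul_inv_cancel₀ hK0.ne'
  have e : ∀ N : ℕ, Real.exp (-(N * Real.log K)) = q ^ N := by
    intro N
    rw [Real.exp_neg, Real.exp_nat_mul, Real.exp_log hK0, hq, inv_pow]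
  have e112 := e 112
  have e110 := e 110
  push_cast at e112 e110
  have h1 : Real.exp (-k) ≤ q ^ 110 := by
    rw [← e110]; gcongr; linarith
  have h2 : Real.exp (-m) ≤ q ^ 110 := by
    rw [← e110]; gcongr
  have h3 : (K : ℝ) ^ 2 * (2 * Real.exp (-m)) ≤ 2 * q ^ 108 := by
    calc _ ≤ (K : ℝ) ^ 2 * (2 * q ^ 110) := by gcongr
      _ = 2 * (K * q) ^ 2 * q ^ 108 := by ring
      _ = _ := by rw [hKq]; ring
  have h4 : (K : ℝ) * (2 * q ^ 112) = 2 * q ^ 111 := by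
    calc _ = 2 * (K * q) * q ^ 111 := by ring
      _ = _ := by rw [hKq]; ring
  have h5 : ∀ j, 108 ≤ j → q ^ j ≤ q ^ 100 * (1 / 2) ^ 8 := by
    intro j hj
    calc q ^ j ≤ q ^ 108 := pow_le_pow_of_le_one hq0.le (by linarith) hj
      _ = q ^ 100 * q ^ 8 := by ring
      _ ≤ _ := by gcongr
  have h6 : 3 / (K : ℝ) ^ 100 = 3 * q ^ 100 := by rw [hq, inv_pow]; rfl
  rw [e112, e110, h4, h6]
  have h7 : 0 < q ^ 100 := by positivity
  have h108 := h5 108 le_rfl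
  have h110 := h5 110 (by norm_num)
  have h111 := h5 111 (by norm_num)
  norm_num at h108 h110 h111
  linarith

/-- With the probability claimed in the theorem, the initial weights are a good start, have a
controlled operator norm, and give a network that varies little near each center. -/
theorem measure_not_goodStart
    (hp : Regime b u A cs B n K k Γ ρ ε (minClusterEigenvalue φ D.centerMatrix)
      (specNorm D.centerMatrix) η L (Real.log K) T)
    (hφ : SmoothActivation φ Γ) (hv : IsOutputWeight v) (hK : 2 ≤ K) (hB : 4624 ≤ B) :
    gaussianArray k d {w | ¬ (GoodStart φ v D.x D.y D.c D.cl (arrayWeights w) Γ (1 / √k) ε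
        (Real.log K) (minClusterEigenvalue φ D.centerMatrix) (specNorm D.centerMatrix)
        (b * (n / K)) (u * (n / K))
      ∧ (∀ z : EuclideanSpace ℝ (Fin d), ‖preact (arrayWeights w) z‖ ≤ 6 * (√k + √d) * ‖z‖)
      ∧ ∀ l z, ‖z - D.c l‖ ≤ ε →
        |net φ v (arrayWeights w) z - net φ v (arrayWeights w) (D.c l)| ≤ 60 * (Γ * ε * √d))}
      ≤ ENNReal.ofReal (3 / (K : ℝ) ^ 100 + K * Real.exp (-100 * d)) := by
  obtain ⟨_, hn, hK0, hΓ, hS, hlg, hL⟩ := hp.pos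
  have hK' : 0 < K := by omega
  have hn' : 0 < n := by exact_mod_cast hn
  have hε := hp.ε_pos
  have hlam := hp.lam_pos
  have hb := hp.b_pos
  have hkR : (2 : ℝ) ≤ k := by linarith [hp.width_pos hB, hp.lg_ge]
  have hk : 2 ≤ k := by exact_mod_cast hkR
  have : Nonempty (Fin n) := ⟨⟨0, hn'⟩⟩
  have : Nonempty (Fin K) := ⟨⟨0, hK'⟩⟩
  have hc : ∀ l, ‖D.c l‖ ≤ 1 := fun l => (D.norm_center l).le
  have h1 := measure_init_output hv (by omega) hφ hΓ D.c hc hlg.le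
  have h2 := measure_init_diff hv (by omega) hφ hΓ D.x (fun i => D.c (D.cl i)) hε D.input_near
    hlg.le
  have h3 := measure_init_preact (k := k) (fun i => D.x i - D.c (D.cl i)) hε D.input_near
  have h4 := measure_init_cond hv hk hφ hΓ D.c hc hlam (minClusterEigenvalue_mul_le D.c)
  have h5 := measure_init_opNorm (k := k) (d := d)
  have h6 : gaussianArray k d (⋃ l, {w | ¬ ∀ z, ‖z - D.c l‖ ≤ ε →
      |net φ v (arrayWeights w) z - net φ v (arrayWeights w) (D.c l)| ≤ 60 * (Γ * ε * √d)})
      ≤ ENNReal.ofReal (K * Real.exp (-100 * d)) := by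
    refine (measure_iUnion_fintype_le _ _).trans ?_
    calc _ ≤ ∑ _l : Fin K, ENNReal.ofReal (Real.exp (-100 * d)) :=
          Finset.sum_le_sum fun l _ => measure_init_ball hv (by omega) hφ hΓ
            (dim_pos D.toClusterableDataset hK') (D.c l) hε
      _ = _ := by
          rw [ENNReal.ofReal_mul (Nat.cast_nonneg _), ENNReal.ofReal_natCast]
          simp
  have hm : 110 * Real.log K ≤ minClusterEigenvalue φ D.centerMatrix ^ 2 * k
      / (32 * (Fintype.card (Fin K) : ℝ) ^ 2 * Γ ^ 4) := by
    have h := hp.le_width (C := 3520) (p := 2) (i := 2) (j := 0) (by norm_num) (by linarith)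
      (by norm_num) (by norm_num) (by norm_num)
    rw [Fintype.card_fin, le_div_iff₀ (by positivity)]
    calc _ = minClusterEigenvalue φ D.centerMatrix ^ 2
          * (3520 * ((Γ ^ 2 / minClusterEigenvalue φ D.centerMatrix) ^ 2
            * (K ^ 2 * specNorm D.centerMatrix ^ 0 * Real.log K))) := by field_simp; norm_num
      _ ≤ _ := by gcongr
  have hU := (measure_union_le _ _).trans (add_le_add h1 ((measure_union_le _ _).trans
    (add_le_add h2 ((measure_union_le _ _).trans (add_le_add h3 ((measure_union_le _ _).trans
    (add_le_add h4 ((measure_union_le _ _).trans (add_le_add h5 h6)))))))))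
  refine le_trans (measure_mono fun w hw => ?_) (hU.trans ?_)
  · by_contra hnot
    simp only [Set.mem_union, Set.mem_iUnion, not_or, not_exists, Set.mem_ofPred_eq,
      not_not] at hnot
    obtain ⟨g1, g2, g3, g4, g5, g6⟩ := hnot
    refine hw ⟨?_, g5, g6⟩
    exact {
      smooth := hφ
      one_le := hp.one_le_Γ
      output := hv.outputBound (by omega)
      scale := by
        rw [div_pow, Real.sq_sqrt (Nat.cast_nonneg _), one_pow, one_div_mul_cancel (by linarith)]
      norm_input := fun i => (D.norm_input i).le
      norm_center := hc
      near := D.input_near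
      eps_pos := hε
      label := abs_label_le D
      spec_nonneg := hS.le
      spec := sum_inner_sq_le_specNorm D.c
      size_pos := by positivity
      size_ge := D.balanced_low
      size_le := D.balanced_up
      lam_pos := hlam
      log_ge := hp.lg_ge
      init_output := g1
      init_cond := g4
      init_diff := g2
      init_preact := g3 }
  · rw [← ENNReal.ofReal_add (by positivity) (by positivity),
      ← ENNReal.ofReal_add (by positivity) (by positivity),
      ← ENNReal.ofReal_add (by positivity) (by positivity),
      ← ENNReal.ofReal_add (by positivity) (by positivity),
      ← ENNReal.ofReal_add (by positivity) (by positivity)]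
    refine ENNReal.ofReal_le_ofReal ?_
    have h := failure_sum_le hK (hp.width_pos hB) hm
    rw [Fintype.card_fin] at h ⊢
    linarith

end Probability

end Clustered

open Clustered in
theorem mainTheorem1 (clow cup : ℝ) (hclow : 0 < clow) (hcup : clow < cup) :
    ∃ A₁ : ℝ, 0 < A₁ ∧ ∀ A₂ : ℝ, A₁ ≤ A₂ →
    ∃ cs cb : ℝ, 0 < cs ∧ 0 < cb ∧
    ∀ (n K Kbar d k : ℕ) (_hn : 0 < n) (_hK : 0 < K)
      (Γ : ℝ) (_hΓ : 1 ≤ Γ) (φ : ℝ → ℝ)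
      (_hφ : Differentiable ℝ φ) (_hφ' : Differentiable ℝ (deriv φ))
      (_hφ0 : |φ 0| ≤ Γ) (_hφ1 : ∀ z, |deriv φ z| ≤ Γ) (_hφ2 : ∀ z, |deriv (deriv φ) z| ≤ Γ)
      (v : Fin k → ℝ) (_hv : IsOutputWeight v)
      (ρ ε₀ δ : ℝ) (_hρ0 : 0 < ρ) (_hρ1 : ρ ≤ 1)
      (D : CorruptedDataset clow cup ρ ε₀ δ n K Kbar d)
      (_hlam : 0 < minClusterEigenvalue φ D.centerMatrix)
      (_hε₀ : ε₀ ≤ cs * (minClusterEigenvalue φ D.centerMatrix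
        / (Γ ^ 2 * K * logFactor Γ n K ρ)))
      (_hk : cb * (Γ ^ 10 * (K ^ 2 * specNorm D.centerMatrix ^ 4
        / minClusterEigenvalue φ D.centerMatrix ^ 4) * logFactor Γ n K ρ ^ 6) ≤ (k : ℝ))
      (η : ℝ) (_hη0 : 0 < η)
      (_hη : η ≤ K / (2 * cup * n * Γ ^ 2 * specNorm D.centerMatrix ^ 2))
      (τ : ℕ)
      (_hτ1 : ⌈A₁ * (K / (η * n * minClusterEigenvalue φ D.centerMatrix))
        * logFactor Γ n K ρ⌉₊ ≤ τ)
      (_hτ2 : τ ≤ ⌈A₂ * (K / (η * n * minClusterEigenvalue φ D.centerMatrix))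
        * logFactor Γ n K ρ⌉₊),
      gaussianArray k d
          {w | ¬ RobustAt D φ v Γ η (minClusterEigenvalue φ D.centerMatrix)
            (logFactor Γ n K ρ) cs cb
            (gradientDescent (trainLoss φ v D.x D.y) η (Matrix.of w)) τ}
        ≤ ENNReal.ofReal (3 / (K : ℝ) ^ 100 + K * Real.exp (-100 * d)) := by
  refine ⟨1088 / clow, by positivity, fun A hA => ?_⟩
  have hA0 : 0 ≤ A := le_trans (by positivity) hA
  have hC := Regime.noiseConst_pos clow
  set B : ℝ := 4734976 / clow + 4624 with hB
  set P : ℝ := noiseConst clow * (704 / clow + 5 * (A + 6)) with hP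
  have hB0 : 4624 ≤ B := by rw [hB]; linarith [show 0 ≤ 4734976 / clow by positivity]
  have hB1 : 4734976 / clow ≤ B := by rw [hB]; linarith
  have hP0 : 0 < P := by positivity
  have hlab : 0 < labelConst clow := by rw [labelConst]; positivity
  have herr : 0 < errorConst clow := by rw [errorConst]; positivity
  -- `cs` serves the noise budget and the labels near the centers; the terms of the big constant
  -- serve the error bounds, the distance to initialization, and the width
  refine ⟨min (272 / √clow / P) (1 / (9 * labelConst clow)),
    88 * errorConst clow + 544 / √clow + 7 * 11 ^ 5 * B, by positivity, by positivity, ?_⟩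
  intro n K Kbar d k hn hK Γ hΓ φ hφ hφ' _ hφ1 hφ2 v hv ρ ε₀ δ hρ0 hρ1 D hlam hε₀ hk η hη0 hη τ
    hτ1 hτ2
  have hsm := SmoothActivation.of_second_deriv hφ hφ' hφ1 hφ2
  -- for `K = 1` the logarithmic factor is zero, and no positive `ε₀` is allowed
  have hK2 : 2 ≤ K := by
    by_contra hlt
    obtain rfl : K = 1 := by omega
    have h1 : logFactor Γ n 1 ρ = 0 := by simp [logFactor]
    rw [h1] at hε₀
    simp only [mul_zero, div_zero] at hε₀
    linarith [D.noise_pos]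
  have hKn := clusters_le_samples D.toClusterableDataset hclow hn hK
  have hlog := log_le_logFactor hK2 hKn hΓ hρ0 hρ1
  have hL1 := one_le_logFactor hK2 hKn hΓ hρ0 hρ1
  have hx := log_pos_of_two_le hK2
  set L := logFactor Γ n K ρ with hL
  set cs : ℝ := min (272 / √clow / P) (1 / (9 * labelConst clow)) with hcs
  have hL0 : 0 < L := by linarith
  have hp : Regime clow cup A cs B n K k Γ ρ ε₀ (minClusterEigenvalue φ D.centerMatrix)
      (specNorm D.centerMatrix) η L (Real.log K) τ :=
    { b_pos := hclow
      b_le := hcup.le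
      one_le_u := one_le_of_balanced_up D.toClusterableDataset hn hK
      one_le_n := by exact_mod_cast hn
      one_le_K := by exact_mod_cast hK
      one_le_Γ := hΓ
      one_le_S := one_le_specNorm D.c D.norm_center ⟨0, hK⟩
      lam_pos := hlam
      lam_le := minClusterEigenvalue_le D.c hsm D.norm_center ⟨0, hK⟩
      lg_ge := by linarith
      lg_le := hlog
      one_le_L := hL1
      ρ_pos := hρ0
      exp_neg_L := exp_neg_logFactor hn hK2 hΓ hρ0
      ε_pos := D.noise_pos
      ε_le := hε₀
      width := by
        refine le_trans ?_ hk
        have h1 : Real.log K ≤ 7 * 11 ^ 5 * L ^ 6 := by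
          have h2 : 1 ≤ (11 * L) ^ 5 := one_le_pow₀ hL1
          calc Real.log K ≤ 7 * L * 1 := by linarith
            _ ≤ 7 * L * (11 * L) ^ 5 := by gcongr
            _ = _ := by ring
        calc _ ≤ B * (Γ ^ 10 * (K ^ 2 * specNorm D.centerMatrix ^ 4
              / minClusterEigenvalue φ D.centerMatrix ^ 4) * (7 * 11 ^ 5 * L ^ 6)) := by gcongr
          _ = 7 * 11 ^ 5 * B * (Γ ^ 10 * (K ^ 2 * specNorm D.centerMatrix ^ 4
              / minClusterEigenvalue φ D.centerMatrix ^ 4) * L ^ 6) := by ring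
          _ ≤ _ := by
              gcongr
              have : 0 ≤ 88 * errorConst clow + 544 / √clow := by positivity
              linarith
      η_pos := hη0
      η_le := hη
      T_ge := (Nat.le_ceil _).trans (by exact_mod_cast hτ1)
      T_le := by
        have h1 : (τ : ℝ) ≤ _ := Nat.cast_le.2 hτ2
        exact h1.trans (Nat.ceil_lt_add_one (by positivity)).le }
  refine le_trans (measure_mono fun w hw => ?_) (measure_not_goodStart hp hsm hv hK2 hB0)
  rintro ⟨hg, hop, hball⟩
  refine hw ?_
  refine robustAt_of_goodStart hp hg hop hball (rowVec_gradientDescent_succ hφ D.x D.y η _) hA0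
    hB0 hB1 ?_ ?_ ?_ ?_
  · rw [← le_div_iff₀ hP0]
    exact min_le_left _ _
  · have h1 : cs ≤ 1 / (9 * labelConst clow) := min_le_right _ _
    rw [le_div_iff₀ (by positivity)] at h1
    linarith
  · have h1 : 0 ≤ 544 / √clow + 7 * 11 ^ 5 * B := by positivity
    linarith
  · have h1 : 0 ≤ 88 * errorConst clow + 7 * 11 ^ 5 * B := by positivity
    linarith
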